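/- **Setting (DDP-SC).** There are $n$ deliveries with closed delivery time intervals $I_j=[t_j^L,t_j^R]$ and costs $cost(I_j)\in(0,B]$, where $B>0$ is the battery capacity of identical drones, and $r$ battery stations with waiting intervals $I_\ell^c=[t_\ell^A,t_\ell^D]$, $t_1^A<t_1^D<t_2^A<\dots<t_r^D$. No $I_j$ is contained in a waiting interval, and no $I_j$ meets two waiting intervals. Each station is a swapping station (a drone that swaps stays for all of $I_\ell^c$ and leaves with level $B$) or a charging station (a drone may choose a sub-interval $[t',t'']\subseteq I_\ell^c$; its level $x\in[0,B]$ becomes $Ch_\ell([t',t''],x)\in[0,B]$, with $Ch_\ell(I_\ell^c,x)=B$). A drone starts with level $B$; a feasible assignment is a finite set of deliveries and station stays (at most one per station) with pairwise disjoint intervals such that, in chronological order, each delivery costs at most the current battery level. $OPT_{SC}$ is the least number of drones with feasible assignments such that each delivery is completed by exactly one drone. Let $\omega$ be the maximum number of pairwise conflicting (intersecting) delivery intervals and $n_e$ the number of conflicting pairs. **AlgoFor-DDP-NS** (for a set of deliveries, ignoring stations): colour its interval graph with as many colours as its clique number; treat each colour class greedily in any order, giving each delivery to any drone already opened for this class whose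 remaining battery suffices, and opening a new drone only if there is none. Its results are blocks (pairwise disjoint intervals, total cost at most $B$). $OPT_{NS}$ of a set of deliveries is the least number of blocks into which it can be partitioned. **AlgoFor-DDP-SC.** Let $\mathcal I_1=\{I_j: t_j^L<t_1^A\}$, $\mathcal I_\ell=\{I_j: t_{\ell-1}^A\le t_j^L<t_\ell^A\}$ for $2\le\ell\le r$, $\mathcal I_{r+1}=\{I_j: t_j^L\ge t_r^A\}$. Pack each $\mathcal I_\ell$ by AlgoFor-DDP-NS into $m_\ell$ blocks, and open $m_{\max}+2\omega$ drones, $m_{\max}=\max_\ell m_\ell$. Call a block of $\mathcal I_\ell$ *first* if one of its intervals contains $t_{\ell-1}^D$, and *last* if one contains $t_\ell^A$; let $\mathcal D_\ell^{first},\mathcal D_\ell^{last}$ be the sets of drones of these blocks. For $\ell=1,\dots,r+1$, give the first blocks of $\mathcal I_\ell$ to distinct drones that have no block of $\mathcal I_{\ell-1}$ and are not in $\mathcal D_{\ell-2}^{last}$; give the other blocks to distinct drones not in $\mathcal D_{\ell-1}^{last}\cup\mathcal D_\ell^{first}$; then, if $\ell\le r$, all drones with remaining battery less than $B$, except those in $\mathcal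 D_\ell^{last}$, are charged (or swap) at station $\ell$ during all of $I_\ell^c$. **Theorem.** For every instance of DDP-SC: 1. AlgoFor-DDP-SC can be carried out (the required drones always exist), and it has an implementation, with balanced search trees, that takes $O(n\log n+n_e+r)$ steps on the unit-cost real RAM (precisely, at most $C\,(n\log n+n_e+r+1)$ steps with an absolute constant $C$). 2. Whatever choices the algorithm makes, it returns feasible assignments of $m_{\max}+2\omega$ drones that complete each delivery by exactly one drone. 3. If $\beta$ is an approximation factor of AlgoFor-DDP-NS on the subsets of the deliveries (every run on every subset gives at most $\beta$ times the optimum $OPT_{NS}$ of that subset), then $$m_{\max}+2\omega\le\beta\cdot OPT_{SC}+2\omega .$$ 4. With $\epsilon_{\min}=\frac1B\min_j cost(I_j)$, $\epsilon_{\max}=\min\{\frac12,\frac1B\max_j cost(I_j)\}$ and $\psi=\frac{\epsilon_{\max}-\epsilon_{\min}}{1-\epsilon_{\max}}$, the number $2+\psi$ is such a factor. Moreover $\omega\le OPT_{SC}$. Hence $$m_{\max}+2\omega\le(2+\psi)\,OPT_{SC}+2\omega\le(4+\psi)\,OPT_{SC}.$$ -/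

import Mathlib

noncomputable section

namespace DroneDelivery

/-! ## The model -/

/-- How a battery service station works.  At a swapping station the battery is replaced by a full
one.  At a charging station, `Ch s t x` is the battery level of a drone that is charged during
`[s, t]` and whose level at time `s` is `x`. -/
inductive Policy where
  | swapping
  | charging (Ch : ℝ → ℝ → ℝ → ℝ)

/-- An instance of the drone delivery packing problem with stations: `n` deliveries with closed
delivery time intervals `[launch j, rendez j]`, and `r` stations with waiting intervals
`[arr k, dep k]`. -/
structure Instance where
  n : ℕ
  r : ℕ
  B : ℝ
  launch : Fin n → ℝ
  rendez : Fin n → ℝ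
  cost : Fin n → ℝ
  arr : Fin r → ℝ
  dep : Fin r → ℝ
  policy : Fin r → Policy
  B_pos : 0 < B
  launch_le_rendez : ∀ j, launch j ≤ rendez j
  cost_pos : ∀ j, 0 < cost j
  cost_le : ∀ j, cost j ≤ B
  arr_lt_dep : ∀ k, arr k < dep k
  dep_lt_arr : ∀ k l, k < l → dep k < arr l
  /-- No delivery interval lies inside a waiting interval. -/
  not_contained : ∀ j k, ¬ Set.Icc (launch j) (rendez j) ⊆ Set.Icc (arr k) (dep k)
  /-- No delivery interval meets two waiting intervals. -/
  meets_one : ∀ j k l, (Set.Icc (launch j) (rendez j) ∩ Set.Icc (arr k) (dep k)).Nonempty →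
    (Set.Icc (launch j) (rendez j) ∩ Set.Icc (arr l) (dep l)).Nonempty → k = l
  /-- Charging during a whole waiting interval fills the battery. -/
  charge_full : ∀ k Ch, policy k = .charging Ch → ∀ x, 0 ≤ x → x ≤ B →
    Ch (arr k) (dep k) x = B
  /-- Charging during a part of a waiting interval leaves a level between `0` and `B`. -/
  charge_mem : ∀ k Ch, policy k = .charging Ch → ∀ s t x, arr k ≤ s → s ≤ t → t ≤ dep k →
    0 ≤ x → x ≤ B → 0 ≤ Ch s t x ∧ Ch s t x ≤ B

namespace Instance

variable (I : Instance)

/-- What can be scheduled on a drone: a delivery, or a stay `[s, t]` at a station. -/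
inductive Event (I : Instance) where
  | deliver (j : Fin I.n)
  | service (k : Fin I.r) (s t : ℝ)

def Event.start {I : Instance} : I.Event → ℝ
  | .deliver j => I.launch j
  | .service _ s _ => s

def Event.finish {I : Instance} : I.Event → ℝ
  | .deliver j => I.rendez j
  | .service _ _ t => t

/-- A swap takes the whole waiting interval; charging may use any part of it. -/
def Event.Allowed {I : Instance} : I.Event → Prop
  | .deliver _ => True
  | .service k s t =>
    match I.policy k with
    | .swapping => s = I.arr k ∧ t = I.dep k
    | .charging _ => I.arr k ≤ s ∧ s ≤ t ∧ t ≤ I.dep k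

/-- `e` lies strictly before `f`, and they are not two stays at the same station. -/
def Event.Before {I : Instance} (e f : I.Event) : Prop :=
  e.finish < f.start ∧
    ∀ k s t l s' t', e = .service k s t → f = .service l s' t' → k ≠ l

/-- The battery level after the stay `[s, t]` at station `k` begun with level `x`. -/
def levelAfter (k : Fin I.r) (s t x : ℝ) : ℝ :=
  match I.policy k with
  | .swapping => I.B
  | .charging Ch => Ch s t x

/-- Starting with battery level `x`, the battery suffices for each delivery of the list. -/
def WithinBudget : ℝ → List I.Event → Prop
  | _, [] => True
  | x, .deliver j :: L => I.cost j ≤ x ∧ WithinBudget (x - I.cost j) L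
  | x, .service k s t :: L => WithinBudget (I.levelAfter k s t x) L

/-- A feasible assignment of one drone: a finite set of pairwise compatible events which, in
chronological order, respects the battery budget of a drone that starts with a full battery. -/
def Feasible (A : Set I.Event) : Prop :=
  ∃ L : List I.Event, (∀ e, e ∈ L ↔ e ∈ A) ∧ L.Pairwise Event.Before ∧
    (∀ e ∈ L, e.Allowed) ∧ I.WithinBudget I.B L

/-- `m` drones with feasible assignments that complete each delivery by exactly one drone. -/
def IsSolution (m : ℕ) (A : Fin m → Set I.Event) : Prop :=
  (∀ i, I.Feasible (A i)) ∧ ∀ j, ∃! i, Event.deliver j ∈ A i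

/-- The minimum number of drones of a solution. -/
def optSC : ℕ := sInf {m | ∃ A : Fin m → Set I.Event, I.IsSolution m A}

/-- The interval graph of the delivery time intervals. -/
def conflictGraph : SimpleGraph (Fin I.n) where
  Adj i j := i ≠ j ∧
    (Set.Icc (I.launch i) (I.rendez i) ∩ Set.Icc (I.launch j) (I.rendez j)).Nonempty
  symm := ⟨fun _ _ h => ⟨h.1.symm, by rw [Set.inter_comm]; exact h.2⟩⟩
  loopless := ⟨fun _ h => h.1 rfl⟩

/-- The maximum number of pairwise conflicting intervals. -/
def omega : ℕ := I.conflictGraph.cliqueNum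

/-- The number of conflicts. -/
def numConflicts : ℕ := I.conflictGraph.edgeSet.ncard

/-- The maximum number of pairwise conflicting intervals in a subcollection. -/
def omegaOn (s : Finset (Fin I.n)) : ℕ := (I.conflictGraph.induce (s : Set (Fin I.n))).cliqueNum

/-- A compatible set of deliveries of total cost at most `B`. -/
def IsBlock (P : Finset (Fin I.n)) : Prop :=
  (∀ i ∈ P, ∀ j ∈ P, ¬ I.conflictGraph.Adj i j) ∧ ∑ j ∈ P, I.cost j ≤ I.B

/-- The minimum number of drones for the deliveries in `s` without battery stations: the minimum
number of blocks into which `s` can be partitioned. -/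
def optNS (s : Finset (Fin I.n)) : ℕ :=
  sInf {m | ∃ P : Fin m → Finset (Fin I.n), (∀ i, I.IsBlock (P i)) ∧
    (∀ i i', i ≠ i' → Disjoint (P i) (P i')) ∧ ∀ j, j ∈ s ↔ ∃ i, j ∈ P i}

def epsMin : ℝ := (⨅ j, I.cost j) / I.B

def epsMax : ℝ := min (1 / 2) ((⨆ j, I.cost j) / I.B)

def psi : ℝ := (I.epsMax - I.epsMin) / (1 - I.epsMax)

/-! ## The algorithms, with all their free choices -/

/-- The energy needed by a list of deliveries. -/
def load (b : List (Fin I.n)) : ℝ := (b.map I.cost).sum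

/-- `GreedyRun js bins out`: treating the deliveries `js` in this order, starting from the open
drones `bins` (each given by the list of its deliveries), the greedy rule can end with `out`.  A
delivery goes to any open drone that has enough battery left; a drone is opened only if there is
none. -/
inductive GreedyRun :
    List (Fin I.n) → Multiset (List (Fin I.n)) → Multiset (List (Fin I.n)) → Prop
  | done (bins) : GreedyRun [] bins bins
  | fit (j js b rest out) : I.cost j ≤ I.B - I.load b →
      GreedyRun js ((j :: b) ::ₘ rest) out → GreedyRun (j :: js) (b ::ₘ rest) out
  | fresh (j js bins out) : (∀ b ∈ bins, I.B - I.load b < I.cost j) →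
      GreedyRun js ([j] ::ₘ bins) out → GreedyRun (j :: js) bins out

/-- A possible result of the algorithm for the problem without stations on the deliveries `s`:
colour the interval graph of `s` with as many colours as its largest clique has vertices, list each
colour class in any order, and treat each class by the greedy rule. -/
def NSRun (s : Finset (Fin I.n)) (blocks : Multiset (List (Fin I.n))) : Prop :=
  ∃ (c : Fin I.n → ℕ) (J : ℕ → List (Fin I.n)) (out : ℕ → Multiset (List (Fin I.n))),
    (∀ j ∈ s, c j < I.omegaOn s) ∧
    (∀ i ∈ s, ∀ j ∈ s, I.conflictGraph.Adj i j → c i ≠ c j) ∧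
    (∀ k, (J k).Nodup ∧ ∀ j, j ∈ J k ↔ j ∈ s ∧ c j = k) ∧
    (∀ k < I.omegaOn s, I.GreedyRun (J k) 0 (out k)) ∧
    blocks = ∑ k ∈ Finset.range (I.omegaOn s), out k

/-- `β` is an approximation factor of the algorithm for the problem without stations, on the
subcollections of the deliveries of `I`. -/
def IsFactorNS (β : ℝ) : Prop :=
  ∀ s blocks, I.NSRun s blocks → (Multiset.card blocks : ℝ) ≤ β * I.optNS s

open Classical in
/-- The deliveries launched between the arrival at station `l - 1` and the arrival at station `l`
(the stations are numbered from `0` and the segments from `0` to `r`). -/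
def segment (l : ℕ) : Finset (Fin I.n) :=
  Finset.univ.filter fun j =>
    (∀ k : Fin I.r, k.val < l → I.arr k ≤ I.launch j) ∧
    ∀ k : Fin I.r, l ≤ k.val → I.launch j < I.arr k

/-- Among the blocks of segment `l`: those with a delivery whose interval contains the departure
time from station `l - 1`. -/
def IsFirst (l : ℕ) (b : List (Fin I.n)) : Prop :=
  ∃ k : Fin I.r, k.val + 1 = l ∧ ∃ j ∈ b, I.launch j ≤ I.dep k ∧ I.dep k ≤ I.rendez j

/-- Among the blocks of segment `l`: those with a delivery whose interval contains the arrival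
time at station `l`. -/
def IsLast (l : ℕ) (b : List (Fin I.n)) : Prop :=
  ∃ k : Fin I.r, k.val = l ∧ ∃ j ∈ b, I.launch j ≤ I.arr k ∧ I.arr k ≤ I.rendez j

/-- What the algorithm for the general problem returns: the number of opened drones; for each
segment the list of its blocks, each with its drone; for each station the list of the drones that
are serviced there during the whole waiting interval. -/
structure Outcome (I : Instance) where
  drones : ℕ
  assigned : List (List (ℕ × List (Fin I.n)))
  serviced : List (List ℕ)

end Instance

namespace Instance.Outcome

variable {I : Instance} (o : I.Outcome)

def assignedAt (l : ℕ) : List (ℕ × List (Fin I.n)) := o.assigned.getD l []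

def servicedAt (l : ℕ) : List ℕ := o.serviced.getD l []

/-- The largest number of blocks of a segment. -/
def mMax : ℕ := (Finset.range (I.r + 1)).sup fun l => (o.assignedAt l).length

/-- The drones used for segment `l`. -/
def busy (l : ℕ) : Set ℕ := {i | ∃ p ∈ o.assignedAt l, p.1 = i}

def firstDrones (l : ℕ) : Set ℕ := {i | ∃ p ∈ o.assignedAt l, p.1 = i ∧ I.IsFirst l p.2}

def lastDrones (l : ℕ) : Set ℕ := {i | ∃ p ∈ o.assignedAt l, p.1 = i ∧ I.IsLast l p.2}

/-- The energy that drone `i` needs for its deliveries of segment `l`. -/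
def spent (i l : ℕ) : ℝ :=
  (((o.assignedAt l).filter fun p => p.1 = i).map fun p => I.load p.2).sum

open Classical in
/-- The battery level of drone `i` before segment `l`, as the algorithm keeps track of it. -/
def battery (i : ℕ) : ℕ → ℝ
  | 0 => I.B
  | l + 1 => if i ∈ o.servicedAt l then I.B else battery i l - o.spent i l

/-- The events scheduled on drone `i`. -/
def assignment (i : ℕ) : Set I.Event :=
  {e | (∃ l ≤ I.r, ∃ p ∈ o.assignedAt l, p.1 = i ∧ ∃ j ∈ p.2, e = .deliver j) ∨
    ∃ k : Fin I.r, i ∈ o.servicedAt k ∧ e = .service k (I.arr k) (I.dep k)}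

/-- `o` is a possible result of the algorithm for the general problem. -/
structure IsRun : Prop where
  length_assigned : o.assigned.length = I.r + 1
  length_serviced : o.serviced.length = I.r
  /-- Each segment is packed by the algorithm for the problem without stations. -/
  packed : ∀ l ≤ I.r, I.NSRun (I.segment l) ((o.assignedAt l).map Prod.snd : Multiset _)
  drones_eq : o.drones = o.mMax + 2 * I.omega
  lt_drones : ∀ l, ∀ i ∈ o.busy l, i < o.drones
  /-- Different blocks of a segment get different drones. -/
  unique : ∀ l, ((o.assignedAt l).map Prod.fst).Nodup
  /-- The first blocks of a segment avoid the drones of the preceding segment and the last drones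
  of the segment before that one. -/
  first_rule : ∀ l ≤ I.r, ∀ p ∈ o.assignedAt l, I.IsFirst l p.2 →
    (∀ l', l' + 1 = l → p.1 ∉ o.busy l') ∧ ∀ l', l' + 2 = l → p.1 ∉ o.lastDrones l'
  /-- The other blocks avoid the last drones of the preceding segment and the first drones of
  their own. -/
  other_rule : ∀ l ≤ I.r, ∀ p ∈ o.assignedAt l, ¬ I.IsFirst l p.2 →
    (∀ l', l' + 1 = l → p.1 ∉ o.lastDrones l') ∧ p.1 ∉ o.firstDrones l
  /-- At station `l`, all drones with less than a full battery are serviced, except for the last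
  drones of segment `l`. -/
  service_rule : ∀ l < I.r, ∀ i, i ∈ o.servicedAt l ↔
    i < o.drones ∧ i ∉ o.lastDrones l ∧ o.battery i l - o.spent i l < I.B

end Instance.Outcome

/-! ## An implementation with a step count

The cost model is the unit-cost real RAM.  Every call of one of the functions below whose type ends
in `Timed _` and which inspects a list, a tree or a number charges one step for the bounded number
of real operations, comparisons and pointer operations that it makes besides its calls of other
such functions. -/

/-- A result together with the number of steps spent on it. -/
structure Timed (α : Type) where
  val : α
  time : ℕ

instance : Monad Timed where
  pure a := ⟨a, 0⟩
  bind x f := ⟨(f x.val).val, x.time + (f x.val).time⟩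

def tick : Timed Unit := ⟨(), 1⟩

/-- Search trees in which each node stores its height. -/
inductive Tree (α : Type) where
  | nil
  | node (h : ℕ) (l : Tree α) (x : α) (r : Tree α)

namespace Tree

variable {α : Type}

def height : Tree α → ℕ
  | nil => 0
  | node h _ _ _ => h

def mk (l : Tree α) (x : α) (r : Tree α) : Tree α := node (max l.height r.height + 1) l x r

/-- `mk`, followed by a single or double rotation if the heights differ by more than one. -/
def balance (l : Tree α) (x : α) (r : Tree α) : Tree α :=
  if r.height + 1 < l.height then
    match l with
    | nil => mk l x r
    | node _ ll y lr =>
      if lr.height ≤ ll.height then mk ll y (mk lr x r)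
      else
        match lr with
        | nil => mk l x r
        | node _ lrl z lrr => mk (mk ll y lrl) z (mk lrr x r)
  else if l.height + 1 < r.height then
    match r with
    | nil => mk l x r
    | node _ rl y rr =>
      if rl.height ≤ rr.height then mk (mk l x rl) y rr
      else
        match rl with
        | nil => mk l x r
        | node _ rll z rlr => mk (mk l x rll) z (mk rlr y rr)
  else mk l x r

def insert (key : α → ℝ) (x : α) : Tree α → Timed (Tree α)
  | nil => do
    tick
    return mk nil x nil
  | node _ l y r => do
    tick
    if key x ≤ key y then
      let l' ← insert key x l
      return balance l' y r
    else
      let r' ← insert key x r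
      return balance l y r'

/-- Remove the leftmost entry of the tree with left subtree `l`, root `x`, right subtree `r`. -/
def popMin : Tree α → α → Tree α → Timed (α × Tree α)
  | nil, x, r => do
    tick
    return (x, r)
  | node _ ll y lr, x, r => do
    tick
    let (m, l') ← popMin ll y lr
    return (m, balance l' x r)

/-- Join the two subtrees of a removed root. -/
def glue (l r : Tree α) : Timed (Tree α) := do
  tick
  match r with
  | nil => return l
  | node _ rl y rr =>
    let (m, r') ← popMin rl y rr
    return balance l m r'

/-- Find an entry whose key is at least `c` (the root if it qualifies, and otherwise by a search in
the right subtree), and take it out of the tree. -/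
def findPop (key : α → ℝ) (c : ℝ) : Tree α → Timed (Option (α × Tree α))
  | nil => do
    tick
    return none
  | node _ l x r => do
    tick
    if c ≤ key x then
      let t ← glue l r
      return some (x, t)
    else
      match ← findPop key c r with
      | none => return none
      | some (y, r') => return some (y, balance l x r')

/-- The entries from left to right, followed by `acc`. -/
def toListAcc : Tree α → List α → Timed (List α)
  | nil, acc => do
    tick
    return acc
  | node _ l x r, acc => do
    tick
    let acc' ← toListAcc r acc
    toListAcc l (x :: acc')

def insertAll (key : α → ℝ) : List α → Tree α → Timed (Tree α)
  | [], t => do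
    tick
    return t
  | x :: xs, t => do
    tick
    let t' ← insert key x t
    insertAll key xs t'

end Tree

def sortBy {α : Type} (key : α → ℝ) (xs : List α) : Timed (List α) := do
  let t ← Tree.insertAll key xs .nil
  t.toListAcc []

def lengthT {α : Type} : List α → Timed ℕ
  | [] => do
    tick
    return 0
  | _ :: xs => do
    tick
    let m ← lengthT xs
    return m + 1

def appendT {α : Type} : List α → List α → Timed (List α)
  | [], ys => do
    tick
    return ys
  | x :: xs, ys => do
    tick
    let zs ← appendT xs ys
    return x :: zs

def sndsT {α β : Type} : List (α × β) → Timed (List β)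
  | [] => do
    tick
    return []
  | p :: ps => do
    tick
    let bs ← sndsT ps
    return p.2 :: bs

def maxLengthT {α : Type} : List (List α) → Timed ℕ
  | [] => do
    tick
    return 0
  | xs :: xss => do
    tick
    let a ← lengthT xs
    let b ← maxLengthT xss
    return max a b

/-- The list of the numbers `i, i + 1, …, i + m - 1`. -/
def countFrom : ℕ → ℕ → Timed (List ℕ)
  | _, 0 => do
    tick
    return []
  | i, m + 1 => do
    tick
    let is ← countFrom (i + 1) m
    return i :: is

/-- The list of the entries of the input array `f`. -/
def readT {α : Type} : (m : ℕ) → (Fin m → α) → Timed (List α)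
  | 0, _ => do
    tick
    return []
  | m + 1, f => do
    tick
    let xs ← readT m fun i => f i.succ
    return f 0 :: xs

namespace Instance

variable (I : Instance)

/-- Split colour classes, each given with the time at which its latest interval ends, into those
that ended before time `t` and those that did not. -/
def splitActive (t : ℝ) : List (ℝ × List (Fin I.n)) →
    Timed (List (ℝ × List (Fin I.n)) × List (ℝ × List (Fin I.n)))
  | [] => do
    tick
    return ([], [])
  | c :: cs => do
    tick
    let (e, a) ← splitActive t cs
    if c.1 < t then return (c :: e, a) else return (e, c :: a)

/-- Colour intervals that are given in the order of their launching times.  The colours are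
represented by their classes; `active` are the classes in use at the present time, and `free` are
the others.  A new colour is used only if none is free. -/
def sweep : List (Fin I.n) → List (ℝ × List (Fin I.n)) → List (ℝ × List (Fin I.n)) →
    Timed (List (List (Fin I.n)))
  | [], active, free => do
    tick
    let all ← appendT active free
    sndsT all
  | j :: js, active, free => do
    tick
    let (e, a) ← I.splitActive (I.launch j) active
    let free' ← appendT e free
    match free' with
    | [] => sweep js ((I.rendez j, [j]) :: a) []
    | c :: f => sweep js ((I.rendez j, j :: c.2) :: a) f

/-- The colour classes of the interval graph of the deliveries in `js`. -/
def colour (js : List (Fin I.n)) : Timed (List (List (Fin I.n))) := do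
  let xs ← sortBy I.launch js
  I.sweep xs [] []

/-- The greedy rule; the nodes of the tree are the open drones, each with its remaining battery
level, which is the key, and the list of its deliveries. -/
def greedy : List (Fin I.n) → Tree (ℝ × List (Fin I.n)) → Timed (Tree (ℝ × List (Fin I.n)))
  | [], t => do
    tick
    return t
  | j :: js, t => do
    tick
    match ← t.findPop Prod.fst (I.cost j) with
    | some (p, t') =>
      let t'' ← t'.insert Prod.fst (p.1 - I.cost j, j :: p.2)
      greedy js t''
    | none =>
      let t' ← t.insert Prod.fst (I.B - I.cost j, [j])
      greedy js t'

def greedyAll : List (List (Fin I.n)) → Timed (List (List (Fin I.n)))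
  | [] => do
    tick
    return []
  | js :: jss => do
    tick
    let t ← I.greedy js .nil
    let ps ← t.toListAcc []
    let bs ← sndsT ps
    let rest ← greedyAll jss
    appendT bs rest

/-- The algorithm for the problem without stations. -/
def algoNS (js : List (Fin I.n)) : Timed (List (List (Fin I.n))) := do
  let classes ← I.colour js
  I.greedyAll classes

def algoNSAll : List (List (Fin I.n)) → Timed (List (List (List (Fin I.n))))
  | [] => do
    tick
    return []
  | js :: jss => do
    tick
    let bs ← I.algoNS js
    let rest ← algoNSAll jss
    return bs :: rest

/-- Cut a list of deliveries, sorted by launching time, at the time `t`. -/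
def cutAt (t : ℝ) : List (Fin I.n) → Timed (List (Fin I.n) × List (Fin I.n))
  | [] => do
    tick
    return ([], [])
  | j :: js => do
    tick
    if I.launch j < t then
      let (a, b) ← cutAt t js
      return (j :: a, b)
    else return ([], j :: js)

/-- Cut a list of deliveries, sorted by launching time, into the segments. -/
def cutAll : List (Fin I.r) → List (Fin I.n) → Timed (List (List (Fin I.n)))
  | [], js => do
    tick
    return [js]
  | k :: ks, js => do
    tick
    let (a, b) ← I.cutAt (I.arr k) js
    let rest ← cutAll ks b
    return a :: rest

/-- Does some interval of the list contain the time `t`? -/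
def hits (t : ℝ) : List (Fin I.n) → Timed Bool
  | [] => do
    tick
    return false
  | j :: js => do
    tick
    if I.launch j ≤ t ∧ t ≤ I.rendez j then return true else hits t js

/-- As `hits`, with the answer `false` if no time is given. -/
def hitsOpt (t : Option ℝ) (js : List (Fin I.n)) : Timed Bool := do
  tick
  match t with
  | none => return false
  | some t => I.hits t js

/-- Separate the blocks with an interval that contains the given time from the others. -/
def splitBlocks (t : Option ℝ) :
    List (List (Fin I.n)) → Timed (List (List (Fin I.n)) × List (List (Fin I.n)))
  | [] => do
    tick
    return ([], [])
  | b :: bs => do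
    tick
    let h ← I.hitsOpt t b
    let (x, y) ← splitBlocks t bs
    if h then return (b :: x, y) else return (x, b :: y)

/-- Give the blocks to the drones of the list, one after the other; return the drones left. -/
def deal : List (List (Fin I.n)) → List ℕ → Timed (List (ℕ × List (Fin I.n)) × List ℕ)
  | [], ds => do
    tick
    return ([], ds)
  | _ :: _, [] => do
    tick
    return ([], [])
  | b :: bs, d :: ds => do
    tick
    let (ps, rest) ← deal bs ds
    return ((d, b) :: ps, rest)

/-- Separate the drones of blocks with an interval that contains the given time from the others. -/
def splitDrones (t : Option ℝ) : List (ℕ × List (Fin I.n)) → Timed (List ℕ × List ℕ)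
  | [] => do
    tick
    return ([], [])
  | p :: ps => do
    tick
    let h ← I.hitsOpt t p.2
    let (x, y) ← splitDrones t ps
    if h then return (p.1 :: x, y) else return (x, p.1 :: y)

/-- Assign the blocks of the segments to drones.  `prev` is the last station passed, and the two
lists that come next are the stations and the segments still ahead.  The drones are kept in three
lists: `last`, the last drones of the preceding segment; `served`, the other drones serviced at
`prev`; `idle`, the drones that had a full battery before `prev`. -/
def assignAll : Option (Fin I.r) → List (Fin I.r) → List (List (List (Fin I.n))) →
    List ℕ → List ℕ → List ℕ → Timed (List (List (ℕ × List (Fin I.n))) × List (List ℕ))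
  | _, _, [], _, _, _ => do
    tick
    return ([], [])
  | prev, ks, bs :: bss, last, served, idle => do
    tick
    let (firsts, others) ← I.splitBlocks (prev.map I.dep) bs
    let (ps, idle') ← I.deal firsts idle
    let pool ← appendT served idle'
    let (qs, pool') ← I.deal others pool
    let pairs ← appendT ps qs
    match ks with
    | [] => return ([pairs], [])
    | k :: ks' =>
      let (last', done) ← I.splitDrones (some (I.arr k)) pairs
      let served' ← appendT last done
      let (out, ser) ← assignAll (some k) ks' bss last' served' pool'
      return (pairs :: out, served' :: ser)

/-- The algorithm for the general problem. -/
def algoSC : Timed I.Outcome := do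
  let js ← readT I.n id
  let ks ← readT I.r id
  let classes ← I.colour js
  let w ← lengthT classes
  let xs ← sortBy I.launch js
  let segs ← I.cutAll ks xs
  let blocks ← I.algoNSAll segs
  let m ← maxLengthT blocks
  let ds ← countFrom 0 (m + 2 * w)
  let (out, ser) ← I.assignAll none ks blocks [] [] ds
  return ⟨m + 2 * w, out, ser⟩

end Instance

end DroneDelivery

end

noncomputable section

namespace DroneDelivery

/-! ### Sequential composition of counted computations -/

namespace Timed

variable {α β : Type}

/-! Feasibility rests on two facts about time. An interval launched at or after an arrival outlasts
that waiting interval, since it is not contained in it (`dep_lt_rendez`). An interval launched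
before arrival `l` ends before arrival `l + 1`, since it meets at most one waiting interval
(`rendez_lt_arr`). So a block interferes with a stay only as a last block (at the station ahead) or
as a first block (at the station behind). The assignment rules keep last drones out of the next
segment, so every drone that receives a block has a full battery (`IsRun.battery_eq_of_busy`). The
drone of a first block was full and idle during the preceding segment, so it was not serviced at the
station that its block overlaps (`IsRun.not_serviced_of_first`). Hence every run is a solution
(`IsRun.isSolution`).

For the approximation, no station can be visited between two deliveries of one segment. Whatever the
stations do, a drone of any solution therefore performs its deliveries of one segment on a single
battery charge, and these deliveries form a block (`Feasible.isBlock`). So `optNS` of each segment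
is at most `optSC`, and a factor for the problem without stations carries over to the largest
segment (`IsRun.mMax_le`). A clique needs pairwise different drones, which gives `omega ≤ optSC`.

The factor `2 + psi` comes from a threshold argument. With `θ = (1 - epsMax) * B`, a greedy run on
one colour class leaves at most one block of load at most `θ` (`GreedyRun.countP_le`), and that
block has load at least `epsMin * B`. Summing over the classes bounds the number of blocks by the
total cost plus one deficit per colour. Total cost and number of colours are both controlled by
`optNS` (`isFactorNS_psi`).

The implementation keeps the drones in three lists `last`, `served`, `idle`, which always partition
all drones (`droneLists_perm`). Blocks containing a given time number at most `omega`, so the two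
extra `omega` drones keep the lists long enough (`Packing.snd_perm`). The drones with less than a
full battery before a segment are exactly those in `last` (`Packing.battery_lt_iff`), so the lists
implement the service rule.

The running time is an amortised count. The sweep pays for scanning a busy class with a conflict,
which yields `n_e` (`sweep_spec`). AVL trees give a logarithmic cost per delivery
(`two_pow_height_le`, `greedy_spec`). The assignment touches only drones in current or recent use,
never the whole idle list (`time_assignAll_le`). -/

@[simp] theorem val_bind (x : Timed α) (f : α → Timed β) : (x >>= f).val = (f x.val).val := rfl

@[simp] theorem time_bind (x : Timed α) (f : α → Timed β) :
    (x >>= f).time = x.time + (f x.val).time := rfl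

@[simp] theorem val_pure (a : α) : (pure a : Timed α).val = a := rfl

@[simp] theorem time_pure (a : α) : (pure a : Timed α).time = 0 := rfl

@[simp] theorem time_tick : tick.time = 1 := rfl

end Timed

namespace Tree

variable {α : Type}

/-! ### Search trees: contents and balance -/

/-- The entries of a tree from left to right. -/
def toList : Tree α → List α
  | nil => []
  | node _ l x r => l.toList ++ x :: r.toList

/-- The heights are stored correctly, and those of siblings differ by at most one. -/
def IsAvl : Tree α → Prop
  | nil => True
  | node h l _ r => h = max l.height r.height + 1 ∧ l.height ≤ r.height + 1 ∧
      r.height ≤ l.height + 1 ∧ l.IsAvl ∧ r.IsAvl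

@[simp] theorem toList_nil : (nil : Tree α).toList = [] := rfl

@[simp] theorem toList_node (h : ℕ) (l : Tree α) (x : α) (r : Tree α) :
    (node h l x r).toList = l.toList ++ x :: r.toList := rfl

@[simp] theorem toList_mk (l : Tree α) (x : α) (r : Tree α) :
    (mk l x r).toList = l.toList ++ x :: r.toList := rfl

@[simp] theorem height_nil : (nil : Tree α).height = 0 := rfl

@[simp] theorem height_node (h : ℕ) (l : Tree α) (x : α) (r : Tree α) :
    (node h l x r).height = h := rfl

@[simp] theorem height_mk (l : Tree α) (x : α) (r : Tree α) :
    (mk l x r).height = max l.height r.height + 1 := rfl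

theorem isAvl_mk {l r : Tree α} (x : α) (hl : l.IsAvl) (hr : r.IsAvl)
    (h₁ : l.height ≤ r.height + 1) (h₂ : r.height ≤ l.height + 1) : (mk l x r).IsAvl :=
  ⟨rfl, h₁, h₂, hl, hr⟩

@[simp] theorem toList_balance (l : Tree α) (x : α) (r : Tree α) :
    (balance l x r).toList = l.toList ++ x :: r.toList := by
  unfold balance
  split_ifs
  · cases l with
    | nil => simp
    | node h ll y lr =>
      dsimp only
      split_ifs
      · simp
      · cases lr <;> simp
  · cases r with
    | nil => simp
    | node h rl y rr =>
      dsimp only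
      split_ifs
      · simp
      · cases rl <;> simp
  · simp

/-- Balancing restores the AVL property after one insertion or deletion in a subtree. -/
theorem isAvl_balance {l r : Tree α} (x : α) (hl : l.IsAvl) (hr : r.IsAvl)
    (h₁ : l.height ≤ r.height + 2) (h₂ : r.height ≤ l.height + 2) :
    (balance l x r).IsAvl ∧ max l.height r.height ≤ (balance l x r).height ∧
      (balance l x r).height ≤ max l.height r.height + 1 ∧
      (l.height ≤ r.height + 1 → r.height ≤ l.height + 1 →
        (balance l x r).height = max l.height r.height + 1) := by
  unfold balance
  split_ifs with c₁ c₂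
  · cases l with
    | nil => simp at c₁
    | node h ll y lr =>
      obtain ⟨e, a, b, hll, hlr⟩ := hl
      simp only [height_node] at *
      split_ifs with c₃
      · simp only [IsAvl, mk, height_node, hll, hlr, hr]
        refine ⟨⟨?_, ?_, ?_, ?_, ?_, ?_⟩, ?_, ?_, ?_⟩ <;> first | trivial | omega | (simp; omega)
      -- The inner subtree is strictly taller than the outer one, hence a node, and a double
      -- rotation lifts its root.
      · cases lr with
        | nil => simp at c₃
        | node h' lrl z lrr =>
          obtain ⟨e', a', b', h₃, h₄⟩ := hlr
          simp only [IsAvl, mk, height_node, hll, hr, h₃, h₄] at *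
          refine ⟨⟨?_, ?_, ?_, ?_, ?_⟩, ?_, ?_, ?_⟩ <;> first | trivial | omega | (simp; omega)
  · cases r with
    | nil => simp at c₂
    | node h rl y rr =>
      obtain ⟨e, a, b, hrl, hrr⟩ := hr
      simp only [height_node] at *
      split_ifs with c₃
      · simp only [IsAvl, mk, height_node, hrl, hrr, hl]
        refine ⟨⟨?_, ?_, ?_, ?_, ?_⟩, ?_, ?_, ?_⟩ <;> first | trivial | omega | (simp; omega)
      · cases rl with
        | nil => simp at c₃
        | node h' rll z rlr =>
          obtain ⟨e', a', b', h₃, h₄⟩ := hrl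
          simp only [IsAvl, mk, height_node, hrr, hl, h₃, h₄] at *
          refine ⟨⟨?_, ?_, ?_, ?_, ?_⟩, ?_, ?_, ?_⟩ <;> first | trivial | omega | (simp; omega)
  · refine ⟨isAvl_mk x hl hr (by omega) (by omega), ?_, ?_, ?_⟩ <;> simp

/-- An AVL tree of height `h` has at least `2 ^ (h / 2) - 1` entries. -/
theorem two_pow_height_le {t : Tree α} (ht : t.IsAvl) :
    2 ^ t.height ≤ (t.toList.length + 1) ^ 2 := by
  induction t with
  | nil => simp
  | node h l x r ihl ihr =>
    obtain ⟨e, a, b, hl, hr⟩ := ht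
    have h₁ := ihl hl
    have h₂ := ihr hr
    simp only [toList_node, List.length_append, List.length_cons, height_node]
    set p := l.toList.length + 1
    set q := r.toList.length + 1
    -- Two levels of height multiply the left side by four. This inequality does the same for the
    -- right side, because both subtrees of a tree of height `k + 2` have height at least `k`.
    have key : ∀ X : ℕ, X ≤ p ^ 2 → X ≤ q ^ 2 → 4 * X ≤ (p + q) ^ 2 := by
      intro X hp hq
      have : X ≤ p * q := by
        by_contra hc
        push Not at hc
        rcases le_total p q with hpq | hpq <;> nlinarith
      nlinarith
    have e' : (l.toList.length + (r.toList.length + 1) + 1) = p + q := by omega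
    rw [e']
    by_cases h0 : h = 1
    · subst h0
      nlinarith [Nat.succ_pos l.toList.length, Nat.succ_pos r.toList.length]
    · obtain ⟨k, rfl⟩ : ∃ k, h = k + 2 := ⟨h - 2, by omega⟩
      have := key (2 ^ k)
        ((Nat.pow_le_pow_right (by norm_num) (by omega)).trans h₁)
        ((Nat.pow_le_pow_right (by norm_num) (by omega)).trans h₂)
      rw [pow_add]
      linarith

/-! ### Insertion -/

variable (key : α → ℝ)

theorem insert_nil (x : α) : insert key x nil = ⟨mk nil x nil, 1⟩ := rfl

theorem val_insert_node (x : α) (h : ℕ) (l : Tree α) (y : α) (r : Tree α) :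
    (insert key x (node h l y r)).val =
      if key x ≤ key y then balance (insert key x l).val y r
      else balance l y (insert key x r).val := by
  rw [insert]; split_ifs <;> simp [*]

theorem time_insert_node (x : α) (h : ℕ) (l : Tree α) (y : α) (r : Tree α) :
    (insert key x (node h l y r)).time =
      if key x ≤ key y then 1 + (insert key x l).time else 1 + (insert key x r).time := by
  rw [insert]; split_ifs <;> simp [*]

theorem perm_insert (x : α) (t : Tree α) : (insert key x t).val.toList.Perm (x :: t.toList) := by
  induction t with
  | nil => simp [insert_nil]
  | node h l y r ihl ihr =>
    rw [val_insert_node]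
    split_ifs
    · simpa using ihl.append_right _
    · simp only [toList_balance, toList_node]
      refine ((ihr.cons y).append_left _).trans ?_
      exact ((List.Perm.swap x y _).append_left _).trans List.perm_middle

/-- The entries are in the order of their keys. -/
def Sorted (t : Tree α) : Prop := t.toList.Pairwise fun a b => key a ≤ key b

/-- Rotations do not alter the left-to-right list, so only the descent matters and no balance
hypothesis is needed. -/
theorem Sorted.insert {t : Tree α} (ht : t.Sorted key) (x : α) :
    (insert key x t).val.Sorted key := by
  induction t with
  | nil => simp [insert_nil, Sorted]
  | node h l y r ihl ihr =>
    have hp := fun t : Tree α => fun a => (perm_insert key x t).mem_iff (a := a)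
    rw [val_insert_node]
    simp only [Sorted, toList_node, List.pairwise_append, List.pairwise_cons] at ht
    obtain ⟨hl, ⟨hy, hr⟩, hlr⟩ := ht
    split_ifs with hc
    · simp only [Sorted, toList_balance, List.pairwise_append, List.pairwise_cons]
      refine ⟨ihl hl, ⟨hy, hr⟩, ?_⟩
      intro a ha b hb
      rcases List.mem_cons.1 ((hp l a).1 ha) with rfl | ha
      · rcases List.mem_cons.1 hb with rfl | hb
        · exact hc
        · exact hc.trans (hy b hb)
      · exact hlr a ha b hb
    · simp only [Sorted, toList_balance, List.pairwise_append, List.pairwise_cons]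
      refine ⟨hl, ⟨?_, ihr hr⟩, ?_⟩
      · intro b hb
        rcases List.mem_cons.1 ((hp r b).1 hb) with rfl | hb
        · exact (not_le.1 hc).le
        · exact hy b hb
      · intro a ha b hb
        rcases List.mem_cons.1 hb with rfl | hb
        · exact hlr a ha b (by simp)
        · rcases List.mem_cons.1 ((hp r b).1 hb) with rfl | hb
          · exact (hlr a ha y (by simp)).trans (not_le.1 hc).le
          · exact hlr a ha b (by simp [hb])

/-- The height bounds are part of the induction: a subtree that grows by at most one stays within
the difference of two that `isAvl_balance` can repair. -/
theorem isAvl_insert {t : Tree α} (ht : t.IsAvl) (x : α) :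
    (insert key x t).val.IsAvl ∧ t.height ≤ (insert key x t).val.height ∧
      (insert key x t).val.height ≤ t.height + 1 := by
  induction t with
  | nil => simp [insert_nil, mk, IsAvl]
  | node h l y r ihl ihr =>
    obtain ⟨e, a, b, hl, hr⟩ := ht
    rw [val_insert_node]
    split_ifs
    · obtain ⟨h₁, h₂, h₃⟩ := ihl hl
      obtain ⟨h₄, h₅, h₆, h₇⟩ := isAvl_balance y h₁ hr (by omega) (by omega)
      refine ⟨h₄, ?_, ?_⟩ <;> simp only [height_node] <;> omega
    · obtain ⟨h₁, h₂, h₃⟩ := ihr hr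
      obtain ⟨h₄, h₅, h₆, h₇⟩ := isAvl_balance y hl h₁ (by omega) (by omega)
      refine ⟨h₄, ?_, ?_⟩ <;> simp only [height_node] <;> omega

/-- One step is spent per level of a single path. The AVL hypothesis is needed because `height`
reads the stored number, which must be the true height. -/
theorem time_insert_le {t : Tree α} (ht : t.IsAvl) (x : α) :
    (insert key x t).time ≤ t.height + 1 := by
  induction t with
  | nil => simp [insert_nil]
  | node h l y r ihl ihr =>
    obtain ⟨e, a, b, hl, hr⟩ := ht
    have := ihl hl
    have := ihr hr
    rw [time_insert_node, height_node]
    split_ifs <;> omega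

/-! ### Deletion -/

theorem popMin_nil (x : α) (r : Tree α) : popMin nil x r = ⟨(x, r), 1⟩ := rfl

theorem val_popMin_node (h : ℕ) (ll : Tree α) (y : α) (lr : Tree α) (x : α) (r : Tree α) :
    (popMin (node h ll y lr) x r).val =
      ((popMin ll y lr).val.1, balance (popMin ll y lr).val.2 x r) := rfl

theorem time_popMin_node (h : ℕ) (ll : Tree α) (y : α) (lr : Tree α) (x : α) (r : Tree α) :
    (popMin (node h ll y lr) x r).time = 1 + (popMin ll y lr).time := by
  rw [popMin]; simp

theorem toList_popMin (l : Tree α) (x : α) (r : Tree α) :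
    (popMin l x r).val.1 :: (popMin l x r).val.2.toList = l.toList ++ x :: r.toList := by
  induction l generalizing x r with
  | nil => simp [popMin_nil]
  | node h ll y lr ih =>
    rw [val_popMin_node]
    simp only [toList_balance, toList_node, ← ih]
    simp

theorem isAvl_popMin {l r : Tree α} (x : α) (hl : l.IsAvl) (hr : r.IsAvl)
    (h₁ : l.height ≤ r.height + 1) (h₂ : r.height ≤ l.height + 1) :
    (popMin l x r).val.2.IsAvl ∧ max l.height r.height ≤ (popMin l x r).val.2.height ∧
      (popMin l x r).val.2.height ≤ max l.height r.height + 1 := by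
  induction l generalizing x r with
  | nil =>
    simp only [popMin_nil, height_nil] at *
    exact ⟨hr, by omega, by omega⟩
  | node h ll y lr ih =>
    obtain ⟨e, a, b, hll, hlr⟩ := hl
    obtain ⟨h₃, h₄, h₅⟩ := ih y hll hlr a b
    rw [val_popMin_node]
    simp only [height_node] at *
    obtain ⟨h₆, h₇, h₈, h₉⟩ := isAvl_balance x h₃ hr (by omega) (by omega)
    exact ⟨h₆, by omega, by omega⟩

theorem time_popMin_le {l : Tree α} (hl : l.IsAvl) (x : α) (r : Tree α) :
    (popMin l x r).time ≤ l.height + 1 := by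
  induction l generalizing x r with
  | nil => simp [popMin_nil]
  | node h ll y lr ih =>
    obtain ⟨e, a, b, hll, hlr⟩ := hl
    have := ih hll y lr
    rw [time_popMin_node, height_node]
    omega

theorem glue_nil (l : Tree α) : glue l nil = ⟨l, 1⟩ := rfl

theorem val_glue_node (l : Tree α) (h : ℕ) (rl : Tree α) (y : α) (rr : Tree α) :
    (glue l (node h rl y rr)).val =
      balance l (popMin rl y rr).val.1 (popMin rl y rr).val.2 := rfl

theorem time_glue_node (l : Tree α) (h : ℕ) (rl : Tree α) (y : α) (rr : Tree α) :
    (glue l (node h rl y rr)).time = 1 + (popMin rl y rr).time := by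
  rw [glue]; simp

@[simp] theorem toList_glue (l r : Tree α) : (glue l r).val.toList = l.toList ++ r.toList := by
  cases r with
  | nil => simp [glue_nil]
  | node h rl y rr => simp [val_glue_node, toList_popMin]

theorem isAvl_glue {l r : Tree α} (hl : l.IsAvl) (hr : r.IsAvl)
    (h₁ : l.height ≤ r.height + 1) (h₂ : r.height ≤ l.height + 1) :
    (glue l r).val.IsAvl ∧ max l.height r.height ≤ (glue l r).val.height ∧
      (glue l r).val.height ≤ max l.height r.height + 1 := by
  cases r with
  | nil =>
    simp only [glue_nil, height_nil] at *
    exact ⟨hl, by omega, by omega⟩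
  | node h rl y rr =>
    obtain ⟨e, a, b, hrl, hrr⟩ := hr
    obtain ⟨h₃, h₄, h₅⟩ := isAvl_popMin y hrl hrr a b
    rw [val_glue_node]
    simp only [height_node] at *
    obtain ⟨h₆, h₇, h₈, h₉⟩ :=
      isAvl_balance (popMin rl y rr).val.1 hl h₃ (by omega) (by omega)
    exact ⟨h₆, by omega, by omega⟩

theorem time_glue_le (l : Tree α) {r : Tree α} (hr : r.IsAvl) :
    (glue l r).time ≤ r.height + 1 := by
  cases r with
  | nil => simp [glue_nil]
  | node h rl y rr =>
    obtain ⟨e, a, b, hrl, hrr⟩ := hr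
    have := time_popMin_le hrl y rr
    rw [time_glue_node, height_node]
    omega

theorem findPop_nil (c : ℝ) : findPop key c (nil : Tree α) = ⟨none, 1⟩ := rfl

theorem val_findPop_node (c : ℝ) (h : ℕ) (l : Tree α) (x : α) (r : Tree α) :
    (findPop key c (node h l x r)).val =
      if c ≤ key x then some (x, (glue l r).val)
      else (findPop key c r).val.map fun p => (p.1, balance l x p.2) := by
  rw [findPop]
  split_ifs with hc
  · simp
  · simp only [Timed.val_bind]
    rcases (findPop key c r).val with _ | ⟨y, r'⟩ <;> rfl

theorem time_findPop_node (c : ℝ) (h : ℕ) (l : Tree α) (x : α) (r : Tree α) :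
    (findPop key c (node h l x r)).time =
      if c ≤ key x then 1 + (glue l r).time else 1 + (findPop key c r).time := by
  rw [findPop]
  split_ifs with hc
  · simp
  · simp only [Timed.time_bind]
    rcases (findPop key c r).val with _ | ⟨y, r'⟩ <;> simp

/-- What remains is described twice: the permutation tracks the contents, while the sublist relation
shows that the remaining keys are still sorted. The height bounds feed `isAvl_balance` one level up.
-/
theorem findPop_eq_some {c : ℝ} {t : Tree α} (ht : t.IsAvl) {x : α} {t' : Tree α}
    (h : (findPop key c t).val = some (x, t')) :
    c ≤ key x ∧ t.toList.Perm (x :: t'.toList) ∧ t'.toList.Sublist t.toList ∧ t'.IsAvl ∧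
      t'.height ≤ t.height ∧ t.height ≤ t'.height + 1 := by
  induction t generalizing x t' with
  | nil => simp [findPop_nil] at h
  | node n l y r ihl ihr =>
    obtain ⟨e, a, b, hl, hr⟩ := ht
    rw [val_findPop_node] at h
    split_ifs at h with hc
    · simp only [Option.some.injEq, Prod.mk.injEq] at h
      obtain ⟨rfl, rfl⟩ := h
      obtain ⟨h₃, h₄, h₅⟩ := isAvl_glue hl hr a b
      refine ⟨hc, ?_, ?_, h₃, ?_, ?_⟩
      · simp
      · simp
      · simp only [height_node]; omega
      · simp only [height_node]; omega
    · simp only [Option.map_eq_some_iff, Prod.mk.injEq, Prod.exists] at h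
      obtain ⟨x', r', h', rfl, rfl⟩ := h
      obtain ⟨h₁, h₂, h₂', h₃, h₄, h₅⟩ := ihr hr h'
      obtain ⟨h₆, h₇, h₈, h₉⟩ := isAvl_balance y hl h₃ (by omega) (by omega)
      refine ⟨h₁, ?_, ?_, h₆, ?_, ?_⟩
      · simp only [toList_node, toList_balance]
        refine ((h₂.cons y).append_left _).trans ?_
        exact ((List.Perm.swap x' y _).append_left _).trans List.perm_middle
      · simpa using h₂'
      · simp only [height_node]; omega
      · simp only [height_node]; omega

/-- The search goes right only when the root's key is too small, and by sortedness everything on the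
left is then too small as well. -/
theorem findPop_eq_none {c : ℝ} {t : Tree α} (ht : t.Sorted key)
    (h : (findPop key c t).val = none) : ∀ x ∈ t.toList, key x < c := by
  induction t with
  | nil => simp
  | node n l y r ihl ihr =>
    rw [val_findPop_node] at h
    simp only [Sorted, toList_node, List.pairwise_append, List.pairwise_cons] at ht
    obtain ⟨hl, ⟨hy, hr⟩, hlr⟩ := ht
    split_ifs at h with hc
    simp only [Option.map_eq_none_iff] at h
    intro x hx
    simp only [toList_node, List.mem_append, List.mem_cons] at hx
    rcases hx with hx | rfl | hx
    · exact (hlr x hx y (by simp)).trans_lt (not_le.1 hc)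
    · exact not_le.1 hc
    · exact ihr hr h x hx

theorem time_findPop_le (c : ℝ) {t : Tree α} (ht : t.IsAvl) :
    (findPop key c t).time ≤ t.height + 1 := by
  induction t with
  | nil => simp [findPop_nil]
  | node n l y r ihl ihr =>
    obtain ⟨e, a, b, hl, hr⟩ := ht
    have := time_glue_le l hr
    have := ihr hr
    rw [time_findPop_node, height_node]
    split_ifs <;> omega

/-! ### Traversal and sorting -/

@[simp] theorem val_toListAcc (t : Tree α) (acc : List α) :
    (t.toListAcc acc).val = t.toList ++ acc := by
  induction t generalizing acc with
  | nil => rfl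
  | node h l x r ihl ihr => rw [toListAcc]; simp [ihl, ihr]

@[simp] theorem time_toListAcc (t : Tree α) (acc : List α) :
    (t.toListAcc acc).time = 2 * t.toList.length + 1 := by
  induction t generalizing acc with
  | nil => rfl
  | node h l x r ihl ihr => rw [toListAcc]; simp [ihl, ihr]; ring

theorem val_insertAll_cons (x : α) (xs : List α) (t : Tree α) :
    (insertAll key (x :: xs) t).val = (insertAll key xs (insert key x t).val).val := rfl

theorem time_insertAll_cons (x : α) (xs : List α) (t : Tree α) :
    (insertAll key (x :: xs) t).time =
      1 + ((insert key x t).time + (insertAll key xs (insert key x t).val).time) := rfl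

/-- The number `H` stands for `2 log₂ (N + 1)`. It stays abstract throughout the counting, and real
logarithms enter only in `log_bound`. -/
theorem height_le_of_length {t : Tree α} (ht : t.IsAvl) {N H : ℕ} (hN : t.toList.length ≤ N)
    (hH : ∀ k, 2 ^ k ≤ (N + 1) ^ 2 → k ≤ H) : t.height ≤ H :=
  hH _ ((two_pow_height_le ht).trans (Nat.pow_le_pow_left (by omega) 2))

theorem insertAll_spec (xs : List α) {t : Tree α} (ht : t.IsAvl) (hs : t.Sorted key) :
    (insertAll key xs t).val.toList.Perm (xs ++ t.toList) ∧
      (insertAll key xs t).val.Sorted key := by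
  induction xs generalizing t with
  | nil => exact ⟨List.Perm.refl _, hs⟩
  | cons x xs ih =>
    obtain ⟨h₁, h₂⟩ := ih (isAvl_insert key ht x).1 (hs.insert key x)
    rw [val_insertAll_cons]
    exact ⟨h₁.trans (((perm_insert key x t).append_left xs).trans List.perm_middle), h₂⟩

theorem time_insertAll_le {N H : ℕ} (hH : ∀ k, 2 ^ k ≤ (N + 1) ^ 2 → k ≤ H)
    (xs : List α) {t : Tree α} (ht : t.IsAvl) (hN : t.toList.length + xs.length ≤ N) :
    (insertAll key xs t).time ≤ xs.length * (H + 2) + 1 := by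
  induction xs generalizing t with
  | nil => simp [insertAll]
  | cons x xs ih =>
    have h₁ := time_insert_le key ht x
    have h₂ := height_le_of_length ht (by omega) hH
    have h₃ := (perm_insert key x t).length_eq
    simp only [List.length_cons] at h₃ hN
    have h₄ := ih (isAvl_insert key ht x).1 (by omega)
    rw [time_insertAll_cons, List.length_cons, Nat.succ_mul]
    omega

end Tree

theorem sortBy_spec {α : Type} (key : α → ℝ) (xs : List α) :
    (sortBy key xs).val.Perm xs ∧ (sortBy key xs).val.Pairwise fun a b => key a ≤ key b := by
  have h := Tree.insertAll_spec key xs (t := .nil) trivial (by simp [Tree.Sorted])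
  simpa [sortBy, Tree.Sorted] using h

theorem time_sortBy_le {α : Type} (key : α → ℝ) {N H : ℕ}
    (hH : ∀ k, 2 ^ k ≤ (N + 1) ^ 2 → k ≤ H) (xs : List α) (hN : xs.length ≤ N) :
    (sortBy key xs).time ≤ xs.length * (H + 4) + 2 := by
  have h := Tree.time_insertAll_le key hH xs (t := .nil) trivial (by simpa using hN)
  have h' := (Tree.insertAll_spec key xs (t := .nil) trivial (by simp [Tree.Sorted])).1.length_eq
  simp only [Tree.toList_nil, List.append_nil] at h'
  simp only [sortBy, Timed.time_bind, Tree.time_toListAcc, h']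
  nlinarith

/-! ### Lists -/

section lists

variable {α β : Type}

@[simp] theorem val_lengthT (xs : List α) : (lengthT xs).val = xs.length := by
  induction xs with
  | nil => rfl
  | cons x xs ih => simp [lengthT, ih]

@[simp] theorem time_lengthT (xs : List α) : (lengthT xs).time = xs.length + 1 := by
  induction xs with
  | nil => rfl
  | cons x xs ih => simp [lengthT, ih]; ring

@[simp] theorem val_appendT (xs ys : List α) : (appendT xs ys).val = xs ++ ys := by
  induction xs with
  | nil => rfl
  | cons x xs ih => simp [appendT, ih]

@[simp] theorem time_appendT (xs ys : List α) : (appendT xs ys).time = xs.length + 1 := by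
  induction xs with
  | nil => rfl
  | cons x xs ih => simp [appendT, ih]; ring

@[simp] theorem val_sndsT (ps : List (α × β)) : (sndsT ps).val = ps.map Prod.snd := by
  induction ps with
  | nil => rfl
  | cons x xs ih => simp [sndsT, ih]

@[simp] theorem time_sndsT (ps : List (α × β)) : (sndsT ps).time = ps.length + 1 := by
  induction ps with
  | nil => rfl
  | cons x xs ih => simp [sndsT, ih]; ring

theorem val_maxLengthT (xss : List (List α)) :
    (maxLengthT xss).val = (Finset.range xss.length).sup fun l => (xss.getD l []).length := by
  induction xss with
  | nil => rfl
  | cons xs xss ih =>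
    rw [List.length_cons, Finset.range_add_one', Finset.sup_insert, Finset.sup_map]
    simp only [maxLengthT, Timed.val_bind, Timed.val_pure, val_lengthT, ih]
    rfl

theorem time_maxLengthT (xss : List (List α)) :
    (maxLengthT xss).time = xss.flatten.length + 2 * xss.length + 1 := by
  induction xss with
  | nil => rfl
  | cons xs xss ih => simp [maxLengthT, ih]; ring

@[simp] theorem val_countFrom (i m : ℕ) : (countFrom i m).val = List.range' i m := by
  induction m generalizing i with
  | zero => rfl
  | succ m ih => simp [countFrom, ih, List.range'_succ]

@[simp] theorem time_countFrom (i m : ℕ) : (countFrom i m).time = m + 1 := by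
  induction m generalizing i with
  | zero => rfl
  | succ m ih => simp [countFrom, ih]; ring

@[simp] theorem val_readT (m : ℕ) (f : Fin m → α) : (readT m f).val = List.ofFn f := by
  induction m with
  | zero => rfl
  | succ m ih => simp [readT, ih, List.ofFn_succ]

@[simp] theorem time_readT (m : ℕ) (f : Fin m → α) : (readT m f).time = m + 1 := by
  induction m with
  | zero => rfl
  | succ m ih => simp [readT, ih]; ring

end lists

namespace Instance

variable (I : Instance)

/-! ### Conflicts -/

/-- Both intervals are nonempty, so two of the four endpoint inequalities for a nonempty
intersection are automatic. -/
theorem conflictGraph_adj {i j : Fin I.n} : I.conflictGraph.Adj i j ↔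
    i ≠ j ∧ I.launch i ≤ I.rendez j ∧ I.launch j ≤ I.rendez i := by
  have hi := I.launch_le_rendez i
  have hj := I.launch_le_rendez j
  simp only [conflictGraph, Set.Icc_inter_Icc, Set.nonempty_Icc, sup_le_iff, le_inf_iff]
  tauto

theorem card_le_omegaOn {s K : Finset (Fin I.n)} (hKs : K ⊆ s)
    (hK : I.conflictGraph.IsClique K) : K.card ≤ I.omegaOn s := by
  classical
  have h : (I.conflictGraph.induce (s : Set (Fin I.n))).IsClique
      ((K.subtype (· ∈ (s : Set (Fin I.n))) : Finset (s : Set (Fin I.n))) :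
        Set (s : Set (Fin I.n))) := by
    intro a ha b hb hab
    simp only [Finset.mem_coe, Finset.mem_subtype] at ha hb
    exact hK (Finset.mem_coe.2 ha) (Finset.mem_coe.2 hb) (fun h => hab (Subtype.ext h))
  have h' := h.card_le_cliqueNum
  rw [Finset.card_subtype, Finset.filter_true_of_mem (fun x hx => Finset.mem_coe.2 (hKs hx))] at h'
  exact h'

theorem exists_card_eq_omegaOn (s : Finset (Fin I.n)) :
    ∃ K ⊆ s, I.conflictGraph.IsClique K ∧ K.card = I.omegaOn s := by
  obtain ⟨K, hK⟩ := (I.conflictGraph.induce (s : Set (Fin I.n))).exists_isNClique_cliqueNum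
  refine ⟨K.map (Function.Embedding.subtype _), ?_, ?_, ?_⟩
  · intro x hx
    simp only [Finset.mem_map, Function.Embedding.coe_subtype] at hx
    obtain ⟨y, -, rfl⟩ := hx
    exact y.2
  · intro a ha b hb hab
    simp only [Finset.coe_map, Set.mem_image, Function.Embedding.coe_subtype] at ha hb
    obtain ⟨x, hx, rfl⟩ := ha
    obtain ⟨y, hy, rfl⟩ := hb
    exact hK.isClique hx hy (fun h => hab (by rw [h]))
  · rw [Finset.card_map]
    exact hK.card_eq

theorem omegaOn_univ : I.omegaOn Finset.univ = I.omega := by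
  apply le_antisymm
  · exact SimpleGraph.cliqueNum_induce_le _
  · obtain ⟨K, hK⟩ := I.conflictGraph.exists_isNClique_cliqueNum
    rw [omega, ← hK.card_eq]
    exact I.card_le_omegaOn (Finset.subset_univ K) hK.isClique

theorem length_le_omegaOn {s : Finset (Fin I.n)} {K : List (Fin I.n)} (hKs : ∀ i ∈ K, i ∈ s)
    (hK : K.Pairwise I.conflictGraph.Adj) : K.length ≤ I.omegaOn s := by
  classical
  have hd : K.Nodup := hK.imp fun h => h.ne
  rw [← List.toFinset_card_of_nodup hd]
  refine I.card_le_omegaOn (fun i hi => hKs i (List.mem_toFinset.1 hi)) ?_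
  intro a ha b hb hab
  simp only [List.coe_toFinset, Set.mem_ofPred_eq] at ha hb
  have := I.conflictGraph.symm
  exact hK.forall ha hb hab

open Classical in
/-- The number of conflicts between the deliveries of a list. -/
def listConflicts : List (Fin I.n) → ℕ
  | [] => 0
  | j :: l => l.countP (fun i => I.conflictGraph.Adj j i) + listConflicts l

theorem listConflicts_perm {l l' : List (Fin I.n)} (h : l.Perm l') :
    I.listConflicts l = I.listConflicts l' := by
  induction h with
  | nil => rfl
  | cons x h ih => simp only [listConflicts, ih, h.countP_eq]
  | swap x y l =>
    have h := I.conflictGraph.adj_comm x y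
    simp only [listConflicts, List.countP_cons]
    by_cases hxy : I.conflictGraph.Adj x y
    · simp only [hxy, h.1 hxy, decide_true, if_true]; omega
    · simp only [hxy, mt h.2 hxy, decide_false]; omega
  | trans _ _ h₁ h₂ => exact h₁.trans h₂

/-- Conflicts across the two lists are dropped. This superadditivity lets the costs of the separate
segments add up to one copy of the number of conflicts. -/
theorem listConflicts_append (l l' : List (Fin I.n)) :
    I.listConflicts l + I.listConflicts l' ≤ I.listConflicts (l ++ l') := by
  induction l with
  | nil => simp [listConflicts]
  | cons j l ih => simp only [listConflicts, List.cons_append, List.countP_append]; omega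

/-- Each conflict is recorded at whichever endpoint stands earlier in the list. As that endpoint
does not recur in the tail, the recorded edges are distinct. -/
theorem exists_edges {l : List (Fin I.n)} (hl : l.Nodup) :
    ∃ E : List (Sym2 (Fin I.n)), E.Nodup ∧
      (∀ e ∈ E, e ∈ I.conflictGraph.edgeSet ∧ ∀ v ∈ e, v ∈ l) ∧
      E.length = I.listConflicts l := by
  classical
  induction l with
  | nil => exact ⟨[], by simp, by simp, rfl⟩
  | cons j l ih =>
    obtain ⟨hj, hl⟩ := List.nodup_cons.1 hl
    obtain ⟨E, h₁, h₂, h₃⟩ := ih hl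
    refine ⟨(l.filter fun i => I.conflictGraph.Adj j i).map (fun i => s(j, i)) ++ E, ?_, ?_, ?_⟩
    · rw [List.nodup_append]
      refine ⟨(hl.filter _).map (fun a b h => Sym2.congr_right.1 h), h₁, ?_⟩
      rintro e he e' he' rfl
      obtain ⟨i, -, rfl⟩ := List.mem_map.1 he
      exact hj ((h₂ _ he').2 j (Sym2.mem_mk_left j i))
    · intro e he
      rcases List.mem_append.1 he with he | he
      · obtain ⟨i, hi, rfl⟩ := List.mem_map.1 he
        simp only [List.mem_filter, decide_eq_true_eq] at hi
        refine ⟨hi.2, fun v hv => ?_⟩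
        rcases Sym2.mem_iff.1 hv with rfl | rfl
        · simp
        · simp [hi.1]
      · exact ⟨(h₂ e he).1, fun v hv => List.mem_cons_of_mem _ ((h₂ e he).2 v hv)⟩
    · rw [List.length_append, List.length_map, h₃, listConflicts, List.countP_eq_length_filter]

theorem listConflicts_le_numConflicts {l : List (Fin I.n)} (hl : l.Nodup) :
    I.listConflicts l ≤ I.numConflicts := by
  classical
  obtain ⟨E, h₁, h₂, h₃⟩ := I.exists_edges hl
  rw [← h₃, ← List.toFinset_card_of_nodup h₁, numConflicts, ← Set.ncard_coe_finset]
  refine Set.ncard_le_ncard ?_ (Set.toFinite _)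
  intro e he
  exact (h₂ e (by simpa using he)).1

/-! ### Colouring -/

theorem val_splitActive (t : ℝ) (cs : List (ℝ × List (Fin I.n))) :
    (I.splitActive t cs).val =
      (cs.filter (fun c => c.1 < t), cs.filter (fun c => ¬ c.1 < t)) := by
  induction cs with
  | nil => rfl
  | cons c cs ih =>
    simp only [splitActive, Timed.val_bind, ih]
    by_cases h : c.1 < t
    · simp [h]
    · simp [h, not_lt.1 h]

theorem time_splitActive (t : ℝ) (cs : List (ℝ × List (Fin I.n))) :
    (I.splitActive t cs).time = cs.length + 1 := by
  induction cs with
  | nil => rfl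
  | cons c cs ih =>
    simp only [splitActive, Timed.time_bind, ih]
    by_cases h : c.1 < t <;> simp [h] <;> omega

/-- The classes that are busy at time `t`. -/
def stillActive (t : ℝ) (active : List (ℝ × List (Fin I.n))) : List (ℝ × List (Fin I.n)) :=
  active.filter fun c => ¬ c.1 < t

/-- The classes that are free at time `t`. -/
def nowFree (t : ℝ) (active free : List (ℝ × List (Fin I.n))) : List (ℝ × List (Fin I.n)) :=
  active.filter (fun c => c.1 < t) ++ free

theorem nowFree_append_stillActive_perm (t : ℝ) (active free : List (ℝ × List (Fin I.n))) :
    (I.nowFree t active free ++ I.stillActive t active).Perm (active ++ free) := by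
  have h := List.filter_append_perm (fun c : ℝ × List (Fin I.n) => decide (c.1 < t)) active
  simp only [← decide_not] at h
  refine List.Perm.trans ?_ (h.append_right free)
  simp only [nowFree, stillActive, List.append_assoc]
  exact List.perm_append_comm.append_left _

theorem val_sweep_nil (active free : List (ℝ × List (Fin I.n))) :
    (I.sweep [] active free).val = (active ++ free).map Prod.snd := by
  simp [sweep]

theorem time_sweep_nil (active free : List (ℝ × List (Fin I.n))) :
    (I.sweep [] active free).time = 2 * active.length + free.length + 3 := by
  simp [sweep]; ring

theorem sweep_cons_of_nil {j : Fin I.n} {js : List (Fin I.n)}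
    {active free : List (ℝ × List (Fin I.n))} (h : I.nowFree (I.launch j) active free = []) :
    (I.sweep (j :: js) active free).val =
        (I.sweep js ((I.rendez j, [j]) :: I.stillActive (I.launch j) active) []).val ∧
      (I.sweep (j :: js) active free).time = active.length + 3 +
        (active.filter (fun c => c.1 < I.launch j)).length +
        (I.sweep js ((I.rendez j, [j]) :: I.stillActive (I.launch j) active) []).time := by
  simp only [nowFree, stillActive] at h ⊢
  simp only [sweep, Timed.time_bind, Timed.val_bind, val_splitActive, time_splitActive,
    val_appendT, time_appendT, h, Timed.time_tick, true_and]
  omega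

theorem sweep_cons_of_cons {j : Fin I.n} {js : List (Fin I.n)}
    {active free f : List (ℝ × List (Fin I.n))} {c : ℝ × List (Fin I.n)}
    (h : I.nowFree (I.launch j) active free = c :: f) :
    (I.sweep (j :: js) active free).val =
        (I.sweep js ((I.rendez j, j :: c.2) :: I.stillActive (I.launch j) active) f).val ∧
      (I.sweep (j :: js) active free).time = active.length + 3 +
        (active.filter (fun c => c.1 < I.launch j)).length +
        (I.sweep js ((I.rendez j, j :: c.2) :: I.stillActive (I.launch j) active) f).time := by
  simp only [nowFree, stillActive] at h ⊢
  simp only [sweep, Timed.time_bind, Timed.val_bind, val_splitActive, time_splitActive,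
    val_appendT, time_appendT, h, Timed.time_tick, true_and]
  omega

/-- The state of the sweep after the deliveries in `past`, with those in `js` still ahead. -/
structure SweepState (js past : List (Fin I.n)) (active free : List (ℝ × List (Fin I.n))) :
    Prop where
  nodup : (js ++ past).Nodup
  sorted : js.Pairwise fun i j => I.launch i ≤ I.launch j
  launch_le : ∀ i ∈ past, ∀ j ∈ js, I.launch i ≤ I.launch j
  perm : ((active ++ free).map Prod.snd).flatten.Perm past
  indep : ∀ c ∈ active ++ free, ∀ i ∈ c.2, ∀ j ∈ c.2, ¬ I.conflictGraph.Adj i j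
  rendez_le : ∀ c ∈ active ++ free, ∀ i ∈ c.2, I.rendez i ≤ c.1
  exists_rendez : ∀ c ∈ active ++ free, ∃ i ∈ c.2, I.rendez i = c.1
  free_lt : ∀ c ∈ free, ∀ j ∈ js, c.1 < I.launch j
  -- The certificate that no colour is wasted: a clique among the past deliveries with one member
  -- per class opened so far.
  clique : ∃ K : List (Fin I.n), (∀ i ∈ K, i ∈ past) ∧ K.Pairwise I.conflictGraph.Adj ∧
    K.length = (active ++ free).length

namespace SweepState

variable {I} {j : Fin I.n} {js past : List (Fin I.n)} {active free : List (ℝ × List (Fin I.n))}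

theorem nodup_classes (h : I.SweepState js past active free) :
    ((active ++ free).map Prod.snd).flatten.Nodup :=
  h.perm.nodup_iff.2 (List.nodup_append.1 h.nodup).2.1

/-- The latest deliveries of the classes that are still active. -/
theorem exists_witnesses (h : I.SweepState (j :: js) past active free) :
    ∃ K : List (Fin I.n), K.length = (I.stillActive (I.launch j) active).length ∧
      (∀ i ∈ K, i ∈ past ∧ I.conflictGraph.Adj j i) ∧ K.Pairwise I.conflictGraph.Adj := by
  have hmem : ∀ c ∈ I.stillActive (I.launch j) active, c ∈ active ++ free ∧ ¬ c.1 < I.launch j := by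
    intro c hc
    simp only [stillActive, List.mem_filter, decide_eq_true_eq] at hc
    exact ⟨List.mem_append_left _ hc.1, hc.2⟩
  -- The choice is made total so that it can be mapped over a list; `j` is a dummy value for pairs
  -- that are not classes.
  have hw : ∀ c : ℝ × List (Fin I.n), ∃ i, c ∈ active ++ free → i ∈ c.2 ∧ I.rendez i = c.1 := by
    intro c
    by_cases hc : c ∈ active ++ free
    · obtain ⟨i, hi⟩ := h.exists_rendez c hc
      exact ⟨i, fun _ => hi⟩
    · exact ⟨j, fun h => absurd h hc⟩
  choose w hw using hw
  have hpast : ∀ c ∈ active ++ free, w c ∈ past := by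
    intro c hc
    rw [← h.perm.mem_iff, List.mem_flatten]
    exact ⟨c.2, List.mem_map_of_mem hc, (hw c hc).1⟩
  have hj : j ∉ past := fun hj => (List.nodup_cons.1 h.nodup).1 (List.mem_append_right _ hj)
  -- All witnesses contain the time `I.launch j`. This common point makes them conflict with each
  -- other and with `j`.
  have hle : ∀ c ∈ I.stillActive (I.launch j) active,
      I.launch (w c) ≤ I.launch j ∧ I.launch j ≤ I.rendez (w c) := by
    intro c hc
    obtain ⟨h₁, h₂⟩ := hmem c hc
    exact ⟨h.launch_le _ (hpast c h₁) j (by simp), by rw [(hw c h₁).2]; exact not_lt.1 h₂⟩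
  refine ⟨(I.stillActive (I.launch j) active).map w, by simp, ?_, ?_⟩
  · intro i hi
    obtain ⟨c, hc, rfl⟩ := List.mem_map.1 hi
    have hp := hpast c (hmem c hc).1
    refine ⟨hp, I.conflictGraph_adj.2 ⟨?_, (hle c hc).2, ?_⟩⟩
    · intro h; exact hj (h ▸ hp)
    · exact (hle c hc).1.trans (I.launch_le_rendez j)
  · rw [List.pairwise_map]
    have hd := (List.nodup_flatten.1 h.nodup_classes).2
    rw [List.pairwise_map] at hd
    have hsub : (I.stillActive (I.launch j) active).Sublist (active ++ free) :=
      List.filter_sublist.trans (List.sublist_append_left _ _)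
    refine (hd.sublist hsub).imp_of_mem ?_
    intro c c' hc hc' hcc
    refine I.conflictGraph_adj.2 ⟨?_, ?_, ?_⟩
    · intro he
      exact hcc (hw c (hmem c hc).1).1 (he ▸ (hw c' (hmem c' hc').1).1)
    · exact (hle c hc).1.trans (hle c' hc').2
    · exact (hle c' hc').1.trans (hle c hc).2

theorem nowFree_lt (h : I.SweepState (j :: js) past active free) :
    ∀ c ∈ I.nowFree (I.launch j) active free, c.1 < I.launch j := by
  intro c hc
  rcases List.mem_append.1 hc with hc | hc
  · simpa using (List.mem_filter.1 hc).2
  · exact h.free_lt c hc j (by simp)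

/-- The witnesses are distinct past deliveries in conflict with `j`, so each class found busy can be
charged to a conflict of its own. This is where the term `n_e` of the running time originates. -/
theorem length_stillActive_le (h : I.SweepState (j :: js) past active free) :
    I.listConflicts past + (I.stillActive (I.launch j) active).length ≤
      I.listConflicts (j :: past) := by
  classical
  obtain ⟨K, h₁, h₂, h₃⟩ := h.exists_witnesses
  have hd : K.Nodup := h₃.imp fun h => h.ne
  have := (List.subperm_of_subset hd (l₂ := past.filter fun i => I.conflictGraph.Adj j i)
    (fun i hi => by simpa using h₂ i hi)).length_le
  rw [listConflicts, List.countP_eq_length_filter]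
  omega

/-- Adding a delivery to a free class, or to a new class if none is free. -/
theorem step (h : I.SweepState (j :: js) past active free) {b : List (Fin I.n)}
    {f : List (ℝ × List (Fin I.n))}
    (hb : I.nowFree (I.launch j) active free = [] ∧ b = [] ∧ f = [] ∨
      ∃ t, I.nowFree (I.launch j) active free = (t, b) :: f) :
    I.SweepState js (j :: past) ((I.rendez j, j :: b) :: I.stillActive (I.launch j) active) f := by
  have hperm := I.nowFree_append_stillActive_perm (I.launch j) active free
  have hpm : ((I.nowFree (I.launch j) active free).map Prod.snd).flatten = b ++
      (f.map Prod.snd).flatten := by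
    rcases hb with ⟨h₁, rfl, rfl⟩ | ⟨t, h₁⟩ <;> rw [h₁] <;> simp
  have hfree : ∀ c ∈ f, c ∈ I.nowFree (I.launch j) active free := by
    rcases hb with ⟨h₁, rfl, rfl⟩ | ⟨t, h₁⟩
    · simp
    · intro c hc; rw [h₁]; exact List.mem_cons_of_mem _ hc
  have hold : ∀ c ∈ I.stillActive (I.launch j) active ++ f, c ∈ active ++ free := by
    intro c hc
    rw [← hperm.mem_iff]
    rcases List.mem_append.1 hc with hc | hc
    · exact List.mem_append_right _ hc
    · exact List.mem_append_left _ (hfree c hc)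
  -- The class that receives `j` is free, so all its deliveries end before `j` starts. This gives
  -- both properness and the new latest end.
  have hblt : ∀ i ∈ b, I.rendez i < I.launch j := by
    rcases hb with ⟨h₁, rfl, rfl⟩ | ⟨t, h₁⟩
    · simp
    · intro i hi
      have hm : (t, b) ∈ I.nowFree (I.launch j) active free := by rw [h₁]; simp
      exact (h.rendez_le _ (hperm.mem_iff.1 (List.mem_append_left _ hm)) i hi).trans_lt
        (h.nowFree_lt _ hm)
  have hbind : ∀ i ∈ b, ∀ k ∈ b, ¬ I.conflictGraph.Adj i k := by
    rcases hb with ⟨h₁, rfl, rfl⟩ | ⟨t, h₁⟩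
    · simp
    · have hm : (t, b) ∈ I.nowFree (I.launch j) active free := by rw [h₁]; simp
      exact h.indep _ (hperm.mem_iff.1 (List.mem_append_left _ hm))
  have hsj := List.pairwise_cons.1 h.sorted
  refine ⟨?_, hsj.2, ?_, ?_, ?_, ?_, ?_, ?_, ?_⟩
  · exact (List.perm_middle.nodup_iff).2 h.nodup
  · intro i hi k hk
    rcases List.mem_cons.1 hi with rfl | hi
    · exact hsj.1 k hk
    · exact h.launch_le i hi k (List.mem_cons_of_mem _ hk)
  · refine List.Perm.trans ?_ (h.perm.cons j)
    simp only [List.cons_append, List.map_cons, List.flatten_cons, List.cons_append]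
    refine List.Perm.cons j ?_
    refine List.Perm.trans ?_ ((hperm.map Prod.snd).flatten)
    rw [List.map_append, List.flatten_append, List.map_append, List.flatten_append, hpm,
      List.append_assoc]
    exact List.perm_append_comm.append_left b
  · intro c hc
    rcases List.mem_cons.1 hc with rfl | hc
    · intro i hi k hk hadj
      rw [I.conflictGraph_adj] at hadj
      rcases List.mem_cons.1 hi with hi' | hi' <;> rcases List.mem_cons.1 hk with hk' | hk'
      · exact hadj.1 (hi'.trans hk'.symm)
      · exact absurd hadj.2.1 (not_le.2 (hi' ▸ hblt k hk'))
      · exact absurd hadj.2.2 (not_le.2 (hk' ▸ hblt i hi'))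
      · exact hbind i hi' k hk' (I.conflictGraph_adj.2 hadj)
    · exact h.indep c (hold c hc)
  · intro c hc
    rcases List.mem_cons.1 hc with rfl | hc
    · intro i hi
      rcases List.mem_cons.1 hi with rfl | hi
      · exact le_rfl
      · exact (hblt i hi).le.trans (I.launch_le_rendez j)
    · exact h.rendez_le c (hold c hc)
  · intro c hc
    rcases List.mem_cons.1 hc with rfl | hc
    · exact ⟨j, by simp, rfl⟩
    · exact h.exists_rendez c (hold c hc)
  · intro c hc k hk
    exact (h.nowFree_lt c (hfree c hc)).trans_le (hsj.1 k hk)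
  -- If a class is opened, all others are busy, and `j` with their witnesses is a clique of the new
  -- size. Otherwise the number of classes is unchanged and the old clique still serves.
  · have hlen := hperm.length_eq
    rcases hb with ⟨h₁, rfl, rfl⟩ | ⟨t, h₁⟩
    · obtain ⟨K, k₁, k₂, k₃⟩ := h.exists_witnesses
      refine ⟨j :: K, ?_, ?_, by simp [k₁]⟩
      · intro i hi
        rcases List.mem_cons.1 hi with rfl | hi
        · simp
        · exact List.mem_cons_of_mem _ (k₂ i hi).1
      · exact List.pairwise_cons.2 ⟨fun i hi => (k₂ i hi).2, k₃⟩
    · obtain ⟨K, k₁, k₂, k₃⟩ := h.clique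
      refine ⟨K, fun i hi => List.mem_cons_of_mem _ (k₁ i hi), k₂, ?_⟩
      rw [k₃, ← hlen, h₁]
      simp; omega

end SweepState

/-- Amortised analysis with potential `3 * active.length + free.length`. Busy classes met in a scan
are paid by conflicts. An expired class costs two steps, one to scan and one to move, and its
passage from active to free releases two. A delivery pays six: three fixed steps and three for the
class it makes active. -/
theorem sweep_spec {js past : List (Fin I.n)} {active free : List (ℝ × List (Fin I.n))}
    (h : I.SweepState js past active free) :
    (I.sweep js active free).val.flatten.Perm (js ++ past) ∧
      (∀ c ∈ (I.sweep js active free).val, c ≠ [] ∧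
        ∀ i ∈ c, ∀ j ∈ c, ¬ I.conflictGraph.Adj i j) ∧
      (∃ K : List (Fin I.n), (∀ i ∈ K, i ∈ js ++ past) ∧ K.Pairwise I.conflictGraph.Adj ∧
        K.length = (I.sweep js active free).val.length) ∧
      (I.sweep js active free).time + I.listConflicts past ≤
        I.listConflicts (js ++ past) + 6 * js.length + 3 * active.length + free.length + 3 := by
  induction js generalizing past active free with
  | nil =>
    rw [val_sweep_nil, time_sweep_nil]
    refine ⟨h.perm, ?_, ?_, ?_⟩
    · intro c hc
      obtain ⟨c, hc', rfl⟩ := List.mem_map.1 hc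
      refine ⟨?_, h.indep c hc'⟩
      obtain ⟨i, hi, -⟩ := h.exists_rendez c hc'
      exact List.ne_nil_of_mem hi
    · obtain ⟨K, k₁, k₂, k₃⟩ := h.clique
      exact ⟨K, k₁, k₂, by simpa using k₃⟩
    · simp only [List.nil_append, List.length_nil]; omega
  | cons j js ih =>
    have hm : (js ++ j :: past).Perm (j :: js ++ past) := List.perm_middle
    have hlen := (I.nowFree_append_stillActive_perm (I.launch j) active free).length_eq
    have hlen' : (active.filter (fun c => c.1 < I.launch j)).length + free.length =
      (I.nowFree (I.launch j) active free).length := by simp [nowFree]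
    have hst := h.length_stillActive_le
    obtain ⟨b, f, hb, hval, htime, hf⟩ : ∃ b f, (I.nowFree (I.launch j) active free = [] ∧ b = [] ∧
        f = [] ∨ ∃ t, I.nowFree (I.launch j) active free = (t, b) :: f) ∧
        (I.sweep (j :: js) active free).val =
          (I.sweep js ((I.rendez j, j :: b) :: I.stillActive (I.launch j) active) f).val ∧
        (I.sweep (j :: js) active free).time = active.length + 3 +
          (active.filter (fun c => c.1 < I.launch j)).length +
          (I.sweep js ((I.rendez j, j :: b) :: I.stillActive (I.launch j) active) f).time ∧
        f.length ≤ (I.nowFree (I.launch j) active free).length := by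
      rcases hc : I.nowFree (I.launch j) active free with _ | ⟨⟨t, b⟩, f⟩
      · exact ⟨[], [], Or.inl ⟨rfl, rfl, rfl⟩, (I.sweep_cons_of_nil hc).1,
          (I.sweep_cons_of_nil hc).2, by simp⟩
      · exact ⟨b, f, Or.inr ⟨t, rfl⟩, (I.sweep_cons_of_cons hc).1, (I.sweep_cons_of_cons hc).2,
          by simp⟩
    obtain ⟨i₁, i₂, i₃, i₄⟩ := ih (h.step hb)
    rw [hval, htime]
    refine ⟨i₁.trans hm, i₂, ?_, ?_⟩
    · obtain ⟨K, k₁, k₂, k₃⟩ := i₃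
      exact ⟨K, fun i hi => hm.mem_iff.1 (k₁ i hi), k₂, k₃⟩
    · rw [I.listConflicts_perm hm] at i₄
      simp only [List.length_cons, List.length_append] at *
      omega

/-- The clique carried by the sweep bounds the number of classes from above. Conversely, a clique
with more members than there are classes would put two conflicting deliveries into one class, by the
pigeonhole principle. -/
theorem colour_spec {js : List (Fin I.n)} (hjs : js.Nodup) :
    (I.colour js).val.flatten.Perm js ∧
      (∀ c ∈ (I.colour js).val, c ≠ [] ∧ ∀ i ∈ c, ∀ j ∈ c, ¬ I.conflictGraph.Adj i j) ∧
      ∀ s : Finset (Fin I.n), (∀ j, j ∈ s ↔ j ∈ js) →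
        (I.colour js).val.length = I.omegaOn s := by
  obtain ⟨hp, hs⟩ := sortBy_spec I.launch js
  have hst : I.SweepState (sortBy I.launch js).val [] [] [] :=
    ⟨by simpa using hp.nodup_iff.2 hjs, hs, by simp, by simp, by simp, by simp, by simp, by simp,
      ⟨[], by simp⟩⟩
  obtain ⟨h₁, h₂, ⟨K, k₁, k₂, k₃⟩, -⟩ := I.sweep_spec hst
  rw [List.append_nil] at h₁ k₁
  have h₁' : (I.colour js).val.flatten.Perm js := h₁.trans hp
  refine ⟨h₁', h₂, fun s hs => le_antisymm ?_ ?_⟩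
  · change (I.sweep (sortBy I.launch js).val [] []).val.length ≤ _
    rw [← k₃]
    exact I.length_le_omegaOn (fun i hi => (hs i).2 (hp.mem_iff.1 (k₁ i hi))) k₂
  · obtain ⟨K, hKs, hK, hcard⟩ := I.exists_card_eq_omegaOn s
    rw [← hcard]
    by_contra hlt
    push Not at hlt
    have hex : ∀ i : Fin I.n, ∃ k, i ∈ K → k < (I.colour js).val.length ∧
        i ∈ (I.colour js).val.getD k [] := by
      intro i
      by_cases hi : i ∈ K
      · have := h₁'.mem_iff.2 ((hs i).1 (hKs hi))
        obtain ⟨c, hc, hic⟩ := List.mem_flatten.1 this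
        obtain ⟨k, hk, rfl⟩ := List.mem_iff_getElem.1 hc
        exact ⟨k, fun _ => ⟨hk, by simpa [List.getD_eq_getElem, hk] using hic⟩⟩
      · exact ⟨0, fun h => absurd h hi⟩
    choose k hk using hex
    obtain ⟨a, ha, b, hb, hab, he⟩ := Finset.exists_ne_map_eq_of_card_lt_of_maps_to
      (s := K) (t := Finset.range (I.colour js).val.length) (by simpa using hlt) (f := k)
      (fun i hi => by simpa using (hk i hi).1)
    have ha' := hk a ha
    have hb' := hk b hb
    rw [← he] at hb'
    rw [List.getD_eq_getElem _ _ ha'.1] at ha' hb'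
    exact (h₂ _ (List.getElem_mem _)).2 a ha'.2 b hb'.2 (hK ha hb hab)

theorem time_colour_le {N H : ℕ} (hH : ∀ k, 2 ^ k ≤ (N + 1) ^ 2 → k ≤ H)
    {js : List (Fin I.n)} (hjs : js.Nodup) (hN : js.length ≤ N) :
    (I.colour js).time ≤ js.length * (H + 10) + I.listConflicts js + 5 := by
  obtain ⟨hp, hs⟩ := sortBy_spec I.launch js
  have hst : I.SweepState (sortBy I.launch js).val [] [] [] :=
    ⟨by simpa using hp.nodup_iff.2 hjs, hs, by simp, by simp, by simp, by simp, by simp, by simp,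
      ⟨[], by simp⟩⟩
  obtain ⟨-, -, -, h⟩ := I.sweep_spec hst
  have ht := time_sortBy_le I.launch hH js hN
  rw [List.append_nil, I.listConflicts_perm hp, hp.length_eq] at h
  simp only [listConflicts, List.length_nil] at h
  simp only [colour, Timed.time_bind]
  nlinarith

end Instance

namespace Instance

variable (I : Instance)

/-! ### The greedy rule -/

@[simp] theorem load_cons (j : Fin I.n) (b : List (Fin I.n)) :
    I.load (j :: b) = I.cost j + I.load b := by simp [load]

@[simp] theorem load_nil : I.load [] = 0 := rfl

theorem load_append (a b : List (Fin I.n)) : I.load (a ++ b) = I.load a + I.load b := by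
  simp [load]

theorem load_nonneg (b : List (Fin I.n)) : 0 ≤ I.load b :=
  List.sum_nonneg (by
    intro x hx
    obtain ⟨j, -, rfl⟩ := List.mem_map.1 hx
    exact (I.cost_pos j).le)

theorem load_pos {b : List (Fin I.n)} (hb : b ≠ []) : 0 < I.load b := by
  cases b with
  | nil => exact absurd rfl hb
  | cons j b =>
    have := I.cost_pos j
    have := I.load_nonneg b
    rw [load_cons]
    linarith

theorem load_perm {a b : List (Fin I.n)} (h : a.Perm b) : I.load a = I.load b :=
  (h.map _).sum_eq

/-- The deliveries in a collection of blocks. -/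
def contents (bins : Multiset (List (Fin I.n))) : Multiset (Fin I.n) :=
  (bins.map fun b => (b : Multiset (Fin I.n))).sum

@[simp] theorem contents_zero : I.contents 0 = 0 := rfl

@[simp] theorem contents_cons (b : List (Fin I.n)) (bins : Multiset (List (Fin I.n))) :
    I.contents (b ::ₘ bins) = (b : Multiset (Fin I.n)) + I.contents bins := by simp [contents]

theorem contents_add (s t : Multiset (List (Fin I.n))) :
    I.contents (s + t) = I.contents s + I.contents t := by simp [contents]

theorem contents_coe (l : List (List (Fin I.n))) : I.contents l = (l.flatten : List (Fin I.n)) := by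
  induction l with
  | nil => rfl
  | cons b l ih => rw [← Multiset.cons_coe, contents_cons, ih, List.flatten_cons, Multiset.coe_add]

theorem mem_contents {j : Fin I.n} {bins : Multiset (List (Fin I.n))} :
    j ∈ I.contents bins ↔ ∃ b ∈ bins, j ∈ b := by
  induction bins using Quotient.inductionOn with
  | h l =>
    rw [Multiset.quot_mk_to_coe, contents_coe]
    simp

namespace GreedyRun

variable {I} {js : List (Fin I.n)} {bins out : Multiset (List (Fin I.n))}

theorem contents_eq (h : I.GreedyRun js bins out) :
    I.contents out = (js : Multiset (Fin I.n)) + I.contents bins := by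
  induction h with
  | done => simp
  | fit j js b rest out _ _ ih =>
    rw [ih]
    simp only [contents_cons, ← Multiset.cons_coe, Multiset.cons_add, Multiset.add_cons]
  | fresh j js bins out _ _ ih =>
    rw [ih]
    simp only [contents_cons, ← Multiset.cons_coe, Multiset.cons_add, Multiset.add_cons,
      Multiset.coe_nil, zero_add]

theorem card_le (h : I.GreedyRun js bins out) :
    Multiset.card out ≤ js.length + Multiset.card bins := by
  induction h with
  | done => simp
  | fit j js b rest out _ _ ih => simp only [Multiset.card_cons, List.length_cons] at *; omega
  | fresh j js bins out _ _ ih => simp only [Multiset.card_cons, List.length_cons] at *; omega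

theorem load_le (h : I.GreedyRun js bins out) (hb : ∀ b ∈ bins, I.load b ≤ I.B) :
    ∀ b ∈ out, I.load b ≤ I.B := by
  induction h with
  | done => exact hb
  | fit j js b rest out hc _ ih =>
    refine ih fun b' hb' => ?_
    rcases Multiset.mem_cons.1 hb' with rfl | hb'
    · rw [load_cons]; linarith
    · exact hb b' (Multiset.mem_cons_of_mem hb')
  | fresh j js bins out _ _ ih =>
    refine ih fun b' hb' => ?_
    rcases Multiset.mem_cons.1 hb' with rfl | hb'
    · simpa using I.cost_le j
    · exact hb b' hb'

theorem ne_nil (h : I.GreedyRun js bins out) (hb : ∀ b ∈ bins, b ≠ []) :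
    ∀ b ∈ out, b ≠ [] := by
  induction h with
  | done => exact hb
  | fit j js b rest out hc _ ih =>
    refine ih fun b' hb' => ?_
    rcases Multiset.mem_cons.1 hb' with rfl | hb'
    · simp
    · exact hb b' (Multiset.mem_cons_of_mem hb')
  | fresh j js bins out _ _ ih =>
    refine ih fun b' hb' => ?_
    rcases Multiset.mem_cons.1 hb' with rfl | hb'
    · simp
    · exact hb b' hb'

end GreedyRun

/-- The blocks of a run partition the deliveries. -/
theorem NSRun.contents_eq {I : Instance} {s : Finset (Fin I.n)} {blocks : Multiset (List (Fin I.n))}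
    (h : I.NSRun s blocks) : I.contents blocks = s.val := by
  classical
  obtain ⟨c, J, out, h₁, h₂, h₃, h₄, rfl⟩ := h
  have hsum : ∀ m ≤ I.omegaOn s, I.contents (∑ k ∈ Finset.range m, out k) =
      ∑ k ∈ Finset.range m, (J k : Multiset (Fin I.n)) := by
    intro m hm
    induction m with
    | zero => simp
    | succ m ih =>
      rw [Finset.sum_range_succ, Finset.sum_range_succ, contents_add, ih (by omega),
        (h₄ m (by omega)).contents_eq]
      simp
  rw [hsum _ le_rfl]
  ext j
  rw [Multiset.count_sum']
  -- A delivery occurs once, in the class of its own colour; since that colour is below `omegaOn s`,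
  -- the sum over the classes counts it exactly once.
  have : ∀ k, Multiset.count j (J k : Multiset (Fin I.n)) = if j ∈ s ∧ c j = k then 1 else 0 := by
    intro k
    rw [Multiset.coe_count, (h₃ k).1.count]
    simp only [(h₃ k).2 j]
  simp only [this]
  rw [Multiset.count_eq_of_nodup s.nodup]
  by_cases hj : j ∈ s
  · simp [hj, h₁ j hj]
  · simp [hj]

/-- Every block of a run consists of compatible deliveries for which one battery suffices. -/
theorem NSRun.block {I : Instance} {s : Finset (Fin I.n)} {blocks : Multiset (List (Fin I.n))}
    (h : I.NSRun s blocks) {b : List (Fin I.n)} (hb : b ∈ blocks) :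
    I.load b ≤ I.B ∧ b ≠ [] ∧ ∀ i ∈ b, ∀ j ∈ b, ¬ I.conflictGraph.Adj i j := by
  obtain ⟨c, J, out, h₁, h₂, h₃, h₄, rfl⟩ := h
  obtain ⟨k, hk, hbk⟩ := Multiset.mem_sum.1 hb
  have hr := h₄ k (Finset.mem_range.1 hk)
  have hmem : ∀ i ∈ b, i ∈ s ∧ c i = k := by
    intro i hi
    rw [← (h₃ k).2 i]
    have := I.mem_contents.2 ⟨b, hbk, hi⟩
    rw [hr.contents_eq] at this
    simpa using this
  refine ⟨hr.load_le (by simp) b hbk, hr.ne_nil (by simp) b hbk, fun i hi j hj hadj => ?_⟩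
  exact h₂ i (hmem i hi).1 j (hmem j hj).1 hadj ((hmem i hi).2.trans (hmem j hj).2.symm)

/-! ### The implementation of the greedy rule -/

theorem greedy_cons_of_some {j : Fin I.n} {js : List (Fin I.n)} {t t' : Tree (ℝ × List (Fin I.n))}
    {p : ℝ × List (Fin I.n)} (h : (t.findPop Prod.fst (I.cost j)).val = some (p, t')) :
    (I.greedy (j :: js) t).val =
        (I.greedy js (t'.insert Prod.fst (p.1 - I.cost j, j :: p.2)).val).val ∧
      (I.greedy (j :: js) t).time = 1 + (t.findPop Prod.fst (I.cost j)).time +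
        (t'.insert Prod.fst (p.1 - I.cost j, j :: p.2)).time +
        (I.greedy js (t'.insert Prod.fst (p.1 - I.cost j, j :: p.2)).val).time := by
  simp only [greedy, Timed.val_bind, Timed.time_bind, h, Timed.time_tick, true_and]
  omega

theorem greedy_cons_of_none {j : Fin I.n} {js : List (Fin I.n)} {t : Tree (ℝ × List (Fin I.n))}
    (h : (t.findPop Prod.fst (I.cost j)).val = none) :
    (I.greedy (j :: js) t).val =
        (I.greedy js (t.insert Prod.fst (I.B - I.cost j, [j])).val).val ∧
      (I.greedy (j :: js) t).time = 1 + (t.findPop Prod.fst (I.cost j)).time +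
        (t.insert Prod.fst (I.B - I.cost j, [j])).time +
        (I.greedy js (t.insert Prod.fst (I.B - I.cost j, [j])).val).time := by
  simp only [greedy, Timed.val_bind, Timed.time_bind, h, Timed.time_tick, true_and]
  omega

/-- The blocks stored in a tree. -/
def treeBlocks (t : Tree (ℝ × List (Fin I.n))) : List (List (Fin I.n)) := t.toList.map Prod.snd

/-- The invariant is that a key equals the remaining battery of its drone. A successful search is
then the condition of `fit`, and a failed one, by sortedness, that of `fresh`. Per delivery, search
and insertion cost at most `H + 1` each, and there is one further step. -/
theorem greedy_spec {N H : ℕ} (hH : ∀ k, 2 ^ k ≤ (N + 1) ^ 2 → k ≤ H) (js : List (Fin I.n))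
    {t : Tree (ℝ × List (Fin I.n))} (ht : t.IsAvl) (hs : t.Sorted Prod.fst)
    (hl : ∀ p ∈ t.toList, p.1 = I.B - I.load p.2) (hN : t.toList.length + js.length ≤ N) :
    I.GreedyRun js (I.treeBlocks t) (I.treeBlocks (I.greedy js t).val) ∧
      (I.greedy js t).time ≤ js.length * (2 * H + 3) + 1 := by
  induction js generalizing t with
  | nil => exact ⟨.done _, by simp [greedy]⟩
  | cons j js ih =>
    simp only [List.length_cons] at hN
    have hh := Tree.height_le_of_length ht (by omega) hH
    have hf := Tree.time_findPop_le Prod.fst (I.cost j) ht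
    rcases h : (t.findPop Prod.fst (I.cost j)).val with _ | ⟨p, t'⟩
    · obtain ⟨e₁, e₂⟩ := I.greedy_cons_of_none (js := js) h
      have hp := Tree.perm_insert Prod.fst (I.B - I.cost j, [j]) t
      have hi := Tree.time_insert_le Prod.fst ht (I.B - I.cost j, [j])
      have hlen := hp.length_eq
      rw [List.length_cons] at hlen
      obtain ⟨r₁, r₂⟩ := ih (Tree.isAvl_insert Prod.fst ht (I.B - I.cost j, [j])).1
        (hs.insert Prod.fst _) (by
          intro q hq
          rcases List.mem_cons.1 (hp.mem_iff.1 hq) with rfl | hq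
          · simp
          · exact hl q hq) (by omega)
      rw [e₁, e₂]
      refine ⟨.fresh _ _ _ _ ?_ ?_, ?_⟩
      · intro b hb
        obtain ⟨q, hq, rfl⟩ := List.mem_map.1 (Multiset.mem_coe.1 hb)
        rw [← hl q hq]
        exact Tree.findPop_eq_none Prod.fst hs h q hq
      · have : (I.treeBlocks (t.insert Prod.fst (I.B - I.cost j, [j])).val :
            Multiset (List (Fin I.n))) = [j] ::ₘ (I.treeBlocks t : Multiset _) := by
          rw [Multiset.cons_coe, Multiset.coe_eq_coe]
          exact hp.map Prod.snd
        rwa [← this]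
      · rw [List.length_cons, Nat.succ_mul]; omega
    · obtain ⟨e₁, e₂⟩ := I.greedy_cons_of_some (js := js) h
      obtain ⟨f₁, f₂, f₃, f₄, f₅, f₆⟩ := Tree.findPop_eq_some Prod.fst ht h
      have hp := Tree.perm_insert Prod.fst (p.1 - I.cost j, j :: p.2) t'
      have hi := Tree.time_insert_le Prod.fst f₄ (p.1 - I.cost j, j :: p.2)
      have hlen := hp.length_eq
      have hlen' := f₂.length_eq
      rw [List.length_cons] at hlen hlen'
      have hpl := hl p (f₂.mem_iff.2 (by simp))
      obtain ⟨r₁, r₂⟩ := ih (Tree.isAvl_insert Prod.fst f₄ (p.1 - I.cost j, j :: p.2)).1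
        (Tree.Sorted.insert Prod.fst (List.Pairwise.sublist f₃ hs) _) (by
          intro q hq
          rcases List.mem_cons.1 (hp.mem_iff.1 hq) with rfl | hq
          · simp only [load_cons, hpl]; ring
          · exact hl q (f₃.subset hq)) (by omega)
      rw [e₁, e₂]
      refine ⟨?_, ?_⟩
      · have h₁ : (I.treeBlocks t : Multiset (List (Fin I.n))) =
            p.2 ::ₘ (I.treeBlocks t' : Multiset _) := by
          rw [Multiset.cons_coe, Multiset.coe_eq_coe]
          exact f₂.map Prod.snd
        have h₂ : (I.treeBlocks (t'.insert Prod.fst (p.1 - I.cost j, j :: p.2)).val :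
            Multiset (List (Fin I.n))) = (j :: p.2) ::ₘ (I.treeBlocks t' : Multiset _) := by
          rw [Multiset.cons_coe, Multiset.coe_eq_coe]
          exact hp.map Prod.snd
        rw [h₁]
        refine .fit _ _ _ _ _ (by rw [← hpl]; exact f₁) ?_
        rwa [← h₂]
      · rw [List.length_cons, Nat.succ_mul]; omega

theorem greedy_nil_spec {N H : ℕ} (hH : ∀ k, 2 ^ k ≤ (N + 1) ^ 2 → k ≤ H) {js : List (Fin I.n)}
    (hN : js.length ≤ N) :
    I.GreedyRun js 0 (I.treeBlocks (I.greedy js .nil).val) ∧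
      (I.greedy js .nil).time ≤ js.length * (2 * H + 3) + 1 :=
  I.greedy_spec hH js (t := .nil) trivial (by simp [Tree.Sorted]) (by simp) (by simpa using hN)

theorem val_greedyAll (jss : List (List (Fin I.n))) :
    (I.greedyAll jss).val = jss.flatMap fun js => I.treeBlocks (I.greedy js .nil).val := by
  induction jss with
  | nil => rfl
  | cons js jss ih => simp [greedyAll, ih, treeBlocks]

theorem time_greedyAll_cons (js : List (Fin I.n)) (jss : List (List (Fin I.n))) :
    (I.greedyAll (js :: jss)).time = (I.greedy js .nil).time +
      4 * (I.treeBlocks (I.greedy js .nil).val).length + (I.greedyAll jss).time + 4 := by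
  simp [greedyAll, treeBlocks]
  ring

/-- Since no class is empty, the constant overhead per class can be charged to its deliveries. The
number of blocks of a class is bounded by its number of deliveries. -/
theorem time_greedyAll_le {N H : ℕ} (hH : ∀ k, 2 ^ k ≤ (N + 1) ^ 2 → k ≤ H)
    {jss : List (List (Fin I.n))} (hne : ∀ js ∈ jss, js ≠ []) (hN : jss.flatten.length ≤ N) :
    (I.greedyAll jss).time ≤ jss.flatten.length * (2 * H + 12) + 1 := by
  induction jss with
  | nil => simp [greedyAll]
  | cons js jss ih =>
    simp only [List.flatten_cons, List.length_append] at hN ⊢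
    obtain ⟨h₁, h₂⟩ := I.greedy_nil_spec hH (js := js) (by omega)
    have h₃ := h₁.card_le
    simp only [Multiset.coe_card, Multiset.card_zero, add_zero] at h₃
    have h₄ := ih (fun l hl => hne l (List.mem_cons_of_mem _ hl)) (by omega)
    have h₅ : 0 < js.length := List.length_pos_iff.2 (hne js (by simp))
    rw [time_greedyAll_cons]
    nlinarith

theorem coe_flatMap_eq_sum {α β : Type} (L : List (List α)) (g : List α → List β) :
    ((L.flatMap g : List β) : Multiset β) =
      ∑ k ∈ Finset.range L.length, (g (L.getD k []) : Multiset β) := by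
  induction L with
  | nil => simp
  | cons l L ih =>
    rw [List.length_cons, Finset.sum_range_succ', List.flatMap_cons, ← Multiset.coe_add, ih,
      add_comm]
    rfl

/-- A deliberately crude value: correctness is proved together with the time bound in `greedy_spec`,
so some `H` is needed even where time plays no role. -/
theorem exists_log_bound (N : ℕ) : ∃ H, ∀ k, 2 ^ k ≤ (N + 1) ^ 2 → k ≤ H :=
  ⟨(N + 1) ^ 2, fun k hk => k.lt_two_pow_self.le.trans hk⟩

/-- The implementation of the algorithm for the problem without stations is correct. -/
theorem algoNS_spec {js : List (Fin I.n)} (hjs : js.Nodup) {s : Finset (Fin I.n)}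
    (hs : ∀ j, j ∈ s ↔ j ∈ js) : I.NSRun s (I.algoNS js).val := by
  obtain ⟨h₁, h₂, h₃⟩ := I.colour_spec hjs
  have h₃ := h₃ s hs
  change I.NSRun s (I.greedyAll (I.colour js).val).val
  set cs := (I.colour js).val
  have hnd : cs.flatten.Nodup := h₁.nodup_iff.2 hjs
  have hnd' := List.nodup_flatten.1 hnd
  -- The colour of a delivery is the index of its class in the list; deliveries outside `s` get the
  -- irrelevant colour `0`.
  have hex : ∀ j : Fin I.n, ∃ k, j ∈ s → k < cs.length ∧ j ∈ cs.getD k [] := by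
    intro j
    by_cases hj : j ∈ s
    · obtain ⟨c, hc, hjc⟩ := List.mem_flatten.1 (h₁.mem_iff.2 ((hs j).1 hj))
      obtain ⟨k, hk, rfl⟩ := List.mem_iff_getElem.1 hc
      exact ⟨k, fun _ => ⟨hk, by rwa [List.getD_eq_getElem _ _ hk]⟩⟩
    · exact ⟨0, fun h => absurd h hj⟩
  choose c hc using hex
  have hmem : ∀ k j, j ∈ cs.getD k [] → k < cs.length ∧ j ∈ s := by
    intro k j hj
    by_cases hk : k < cs.length
    · refine ⟨hk, ?_⟩
      rw [List.getD_eq_getElem _ _ hk] at hj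
      exact (hs j).2 (h₁.mem_iff.1 (List.mem_flatten.2 ⟨_, List.getElem_mem hk, hj⟩))
    · rw [List.getD_eq_default _ _ (not_lt.1 hk)] at hj
      simp at hj
  have huniq : ∀ j k l, j ∈ cs.getD k [] → j ∈ cs.getD l [] → k = l := by
    intro j k l hk hl
    have hk' := (hmem k j hk).1
    have hl' := (hmem l j hl).1
    rw [List.getD_eq_getElem _ _ hk'] at hk
    rw [List.getD_eq_getElem _ _ hl'] at hl
    have hp := List.pairwise_iff_getElem.1 hnd'.2
    rcases lt_trichotomy k l with h | h | h
    · exact absurd hl (hp k l hk' hl' h hk)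
    · exact h
    · exact absurd hk (hp l k hl' hk' h hl)
  obtain ⟨H, hH⟩ := exists_log_bound js.length
  refine ⟨c, fun k => cs.getD k [],
    fun k => I.treeBlocks (I.greedy (cs.getD k []) .nil).val, ?_, ?_, ?_, ?_, ?_⟩
  · intro j hj
    rw [← h₃]
    exact (hc j hj).1
  · intro i hi j hj hadj he
    have hi' := hc i hi
    have hj' := hc j hj
    rw [← he] at hj'
    rw [List.getD_eq_getElem _ _ hi'.1] at hi' hj'
    exact (h₂ _ (List.getElem_mem _)).2 i hi'.2 j hj'.2 hadj
  · intro k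
    refine ⟨?_, fun j => ⟨fun hj => ?_, ?_⟩⟩
    · dsimp only
      by_cases hk : k < cs.length
      · rw [List.getD_eq_getElem _ _ hk]
        exact hnd'.1 _ (List.getElem_mem hk)
      · rw [List.getD_eq_default _ _ (not_lt.1 hk)]
        simp
    · have := (hmem k j hj).2
      exact ⟨this, huniq j _ _ (hc j this).2 hj⟩
    · rintro ⟨hj, rfl⟩
      exact (hc j hj).2
  · intro k hk
    refine (I.greedy_nil_spec hH ?_).1
    rw [← h₃] at hk
    dsimp only
    rw [List.getD_eq_getElem _ _ hk, ← h₁.length_eq]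
    exact (List.sublist_flatten_of_mem (List.getElem_mem hk)).length_le
  · rw [val_greedyAll, coe_flatMap_eq_sum, h₃]

theorem time_algoNS_le {N H : ℕ} (hH : ∀ k, 2 ^ k ≤ (N + 1) ^ 2 → k ≤ H)
    {js : List (Fin I.n)} (hjs : js.Nodup) (hN : js.length ≤ N) :
    (I.algoNS js).time ≤ js.length * (3 * H + 22) + I.listConflicts js + 6 := by
  obtain ⟨h₁, h₂, -⟩ := I.colour_spec hjs
  have h₃ := I.time_colour_le hH hjs hN
  have h₄ := I.time_greedyAll_le hH (fun c hc => (h₂ c hc).1) (by rwa [h₁.length_eq])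
  rw [h₁.length_eq] at h₄
  simp only [algoNS, Timed.time_bind]
  nlinarith

theorem val_algoNSAll (jss : List (List (Fin I.n))) :
    (I.algoNSAll jss).val = jss.map fun js => (I.algoNS js).val := by
  induction jss with
  | nil => rfl
  | cons js jss ih => simp [algoNSAll, ih]

theorem time_algoNSAll_le {N H : ℕ} (hH : ∀ k, 2 ^ k ≤ (N + 1) ^ 2 → k ≤ H)
    {jss : List (List (Fin I.n))} (hjs : jss.flatten.Nodup) (hN : jss.flatten.length ≤ N) :
    (I.algoNSAll jss).time ≤ jss.flatten.length * (3 * H + 22) +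
      I.listConflicts jss.flatten + 7 * jss.length + 1 := by
  induction jss with
  | nil => simp [algoNSAll]
  | cons js jss ih =>
    simp only [List.flatten_cons, List.length_append, List.length_cons] at hN ⊢
    rw [List.flatten_cons, List.nodup_append] at hjs
    have h₁ := ih hjs.2.1 (by omega)
    have h₂ := I.time_algoNS_le hH hjs.1 (by omega)
    have h₃ := I.listConflicts_append js jss.flatten
    simp only [algoNSAll, Timed.time_bind, Timed.time_tick, Timed.time_pure]
    nlinarith

end Instance

namespace Instance

variable (I : Instance)

/-! ### Segments and waiting intervals -/

theorem mem_segment {l : ℕ} {j : Fin I.n} : j ∈ I.segment l ↔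
    (∀ k : Fin I.r, k.val < l → I.arr k ≤ I.launch j) ∧
      ∀ k : Fin I.r, l ≤ k.val → I.launch j < I.arr k := by
  simp [segment]

theorem arr_lt_arr {k l : Fin I.r} (h : k < l) : I.arr k < I.arr l :=
  (I.arr_lt_dep k).trans (I.dep_lt_arr k l h)

theorem arr_le_arr {k l : Fin I.r} (h : k ≤ l) : I.arr k ≤ I.arr l := by
  rcases h.eq_or_lt with rfl | h
  · exact le_rfl
  · exact (I.arr_lt_arr h).le

theorem exists_mem_segment (j : Fin I.n) : ∃ l ≤ I.r, j ∈ I.segment l := by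
  classical
  -- The segment index is the least `l` from which on all stations lie ahead; `I.r` always
  -- qualifies.
  have hex : ∃ l, ∀ k : Fin I.r, l ≤ k.val → I.launch j < I.arr k :=
    ⟨I.r, fun k hk => absurd k.2 (not_lt.2 hk)⟩
  refine ⟨Nat.find hex, Nat.find_le fun k hk => absurd k.2 (not_lt.2 hk), ?_⟩
  refine I.mem_segment.2 ⟨fun k hk => ?_, Nat.find_spec hex⟩
  have := Nat.find_min hex hk
  push Not at this
  obtain ⟨k', h₁, h₂⟩ := this
  exact (I.arr_le_arr h₁).trans h₂

theorem segment_unique {j : Fin I.n} {l l' : ℕ} (hl : l ≤ I.r) (hl' : l' ≤ I.r)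
    (h : j ∈ I.segment l) (h' : j ∈ I.segment l') : l = l' := by
  rw [mem_segment] at h h'
  rcases lt_trichotomy l l' with hlt | heq | hlt
  · exact absurd (h'.1 ⟨l, by omega⟩ hlt) (not_le.2 (h.2 ⟨l, by omega⟩ le_rfl))
  · exact heq
  · exact absurd (h.1 ⟨l', by omega⟩ hlt) (not_le.2 (h'.2 ⟨l', by omega⟩ le_rfl))

/-- Otherwise the delivery would lie inside the waiting interval. Hence a delivery after arrival
either contains the departure time, which makes its block first, or starts after it. -/
theorem dep_lt_rendez {j : Fin I.n} {k : Fin I.r} (h : I.arr k ≤ I.launch j) :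
    I.dep k < I.rendez j := by
  by_contra hc
  exact I.not_contained j k (Set.Icc_subset_Icc h (not_lt.1 hc))

/-- A longer delivery would contain the arrival times of two stations and thus meet two waiting
intervals. So a delivery can reach only the next station. -/
theorem rendez_lt_arr {j : Fin I.n} {l : ℕ} {k : Fin I.r} (hj : j ∈ I.segment l)
    (hk : l < k.val) : I.rendez j < I.arr k := by
  by_contra hc
  have hl : l < I.r := hk.trans k.2
  have h₁ := (I.mem_segment.1 hj).2 ⟨l, hl⟩ le_rfl
  have h₂ : I.arr ⟨l, hl⟩ < I.arr k := I.arr_lt_arr (Fin.lt_def.2 hk)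
  have h₃ := not_lt.1 hc
  have := I.meets_one j ⟨l, hl⟩ k
    ⟨I.arr ⟨l, hl⟩, ⟨h₁.le, h₂.le.trans h₃⟩, ⟨le_rfl, (I.arr_lt_dep _).le⟩⟩
    ⟨I.arr k, ⟨(h₁.trans h₂).le, h₃⟩, ⟨le_rfl, (I.arr_lt_dep _).le⟩⟩
  rw [← this] at hk
  exact lt_irrefl _ hk

theorem dep_lt_launch_of_not_isFirst {l : ℕ} {b : List (Fin I.n)} (hb : ∀ j ∈ b, j ∈ I.segment l)
    (h : ¬ I.IsFirst l b) {k : Fin I.r} (hk : k.val + 1 = l) {j : Fin I.n} (hj : j ∈ b) :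
    I.dep k < I.launch j := by
  by_contra hc
  have := (I.mem_segment.1 (hb j hj)).1 k (by omega)
  exact h ⟨k, hk, j, hj, not_lt.1 hc, (I.dep_lt_rendez this).le⟩

theorem rendez_lt_arr_of_not_isLast {l : ℕ} {b : List (Fin I.n)} (hb : ∀ j ∈ b, j ∈ I.segment l)
    (h : ¬ I.IsLast l b) {k : Fin I.r} (hk : k.val = l) {j : Fin I.n} (hj : j ∈ b) :
    I.rendez j < I.arr k := by
  by_contra hc
  have := (I.mem_segment.1 (hb j hj)).2 k (by omega)
  exact h ⟨k, hk, j, hj, this.le, not_lt.1 hc⟩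

/-- As costs are positive, a bound on the total implies the budget condition at every intermediate
delivery. -/
theorem withinBudget_append {js : List (Fin I.n)} {x : ℝ} {L : List I.Event}
    (hx : I.load js ≤ x) (hL : I.WithinBudget (x - I.load js) L) :
    I.WithinBudget x (js.map Event.deliver ++ L) := by
  induction js generalizing x with
  | nil => simpa using hL
  | cons j js ih =>
    have := I.load_nonneg js
    rw [load_cons] at hx hL
    refine ⟨by linarith, ih (by linarith) ?_⟩
    rwa [sub_sub]

theorem levelAfter_full (k : Fin I.r) {x : ℝ} (h₀ : 0 ≤ x) (h₁ : x ≤ I.B) :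
    I.levelAfter k (I.arr k) (I.dep k) x = I.B := by
  unfold levelAfter
  split
  · rfl
  · next Ch h => exact I.charge_full k Ch h x h₀ h₁

end Instance

namespace Instance.Outcome

variable {I : Instance} (o : I.Outcome)

/-! ### Results of the algorithm are solutions -/

/-- The deliveries of drone `i` in segment `l`. -/
def work (i l : ℕ) : List (Fin I.n) :=
  (((o.assignedAt l).filter fun p => p.1 = i).map Prod.snd).flatten

theorem mem_work {i l : ℕ} {j : Fin I.n} :
    j ∈ o.work i l ↔ ∃ p ∈ o.assignedAt l, p.1 = i ∧ j ∈ p.2 := by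
  simp only [work, List.mem_flatten, List.mem_map, List.mem_filter, decide_eq_true_eq]
  constructor
  · rintro ⟨_, ⟨p, ⟨h₁, h₂⟩, rfl⟩, h₃⟩
    exact ⟨p, h₁, h₂, h₃⟩
  · rintro ⟨p, h₁, h₂, h₃⟩
    exact ⟨p.2, ⟨p, ⟨h₁, h₂⟩, rfl⟩, h₃⟩

theorem spent_eq_load (i l : ℕ) : o.spent i l = I.load (o.work i l) := by
  unfold spent work
  induction (o.assignedAt l).filter fun p => p.1 = i with
  | nil => simp
  | cons p ps ih => simp [I.load_append, ih]

theorem filter_fst_eq {α : Type} {ps : List (ℕ × α)} (h : (ps.map Prod.fst).Nodup) (i : ℕ) :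
    ps.filter (fun p => p.1 = i) = [] ∨
      ∃ p ∈ ps, p.1 = i ∧ ps.filter (fun p => p.1 = i) = [p] := by
  induction ps with
  | nil => simp
  | cons q ps ih =>
    rw [List.map_cons, List.nodup_cons] at h
    by_cases hq : q.1 = i
    · right
      refine ⟨q, by simp, hq, ?_⟩
      have : ps.filter (fun p => p.1 = i) = [] := by
        rw [List.filter_eq_nil_iff]
        intro p hp hpi
        simp only [decide_eq_true_eq] at hpi
        exact h.1 (List.mem_map.2 ⟨p, hp, hpi.trans hq.symm⟩)
      simp [hq, this]
    · rcases ih h.2 with h' | ⟨p, h₁, h₂, h₃⟩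
      · left; simp [hq, h']
      · right; exact ⟨p, by simp [h₁], h₂, by simp [hq, h₃]⟩

variable {o}

theorem IsRun.work_cases (h : o.IsRun) (i l : ℕ) :
    i ∉ o.busy l ∧ o.work i l = [] ∨ ∃ p ∈ o.assignedAt l, p.1 = i ∧ o.work i l = p.2 := by
  rcases filter_fst_eq (h.unique l) i with h' | ⟨p, h₁, h₂, h₃⟩
  · refine Or.inl ⟨?_, by simp [work, h']⟩
    rintro ⟨p, hp, hpi⟩
    rw [List.filter_eq_nil_iff] at h'
    exact h' p hp (by simpa using hpi)
  · exact Or.inr ⟨p, h₁, h₂, by simp [work, h₃]⟩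

theorem IsRun.block (h : o.IsRun) {l : ℕ} (hl : l ≤ I.r) {p : ℕ × List (Fin I.n)}
    (hp : p ∈ o.assignedAt l) :
    I.load p.2 ≤ I.B ∧ p.2.Nodup ∧ (∀ j ∈ p.2, j ∈ I.segment l) ∧
      ∀ i ∈ p.2, ∀ j ∈ p.2, ¬ I.conflictGraph.Adj i j := by
  have hp' : p.2 ∈ (((o.assignedAt l).map Prod.snd : List _) : Multiset (List (Fin I.n))) :=
    Multiset.mem_coe.2 (List.mem_map_of_mem hp)
  have hr := h.packed l hl
  obtain ⟨h₁, -, h₃⟩ := hr.block hp'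
  have hc := hr.contents_eq
  refine ⟨h₁, ?_, ?_, h₃⟩
  · rw [I.contents_coe] at hc
    have hnd : ((o.assignedAt l).map Prod.snd).flatten.Nodup := by
      rw [← Multiset.coe_nodup, hc]
      exact (I.segment l).nodup
    exact (List.nodup_flatten.1 hnd).1 _ (List.mem_map_of_mem hp)
  · intro j hj
    have := I.mem_contents.2 ⟨p.2, hp', hj⟩
    rwa [hc] at this

theorem IsRun.spent_nonneg (i l : ℕ) : 0 ≤ o.spent i l := by
  rw [spent_eq_load]; exact I.load_nonneg _

theorem IsRun.spent_eq_zero (h : o.IsRun) {i l : ℕ} (hi : i ∉ o.busy l) : o.spent i l = 0 := by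
  rw [spent_eq_load]
  rcases h.work_cases i l with ⟨-, h'⟩ | ⟨p, h₁, h₂, -⟩
  · simp [h']
  · exact absurd ⟨p, h₁, h₂⟩ hi

theorem battery_le (i l : ℕ) : o.battery i l ≤ I.B := by
  induction l with
  | zero => exact le_rfl
  | succ l ih =>
    rw [battery]
    split_ifs
    · exact le_rfl
    · have := IsRun.spent_nonneg (o := o) i l
      linarith

theorem lastDrones_subset_busy (l : ℕ) : o.lastDrones l ⊆ o.busy l := by
  rintro i ⟨p, hp, hpi, -⟩
  exact ⟨p, hp, hpi⟩

/-- A drone that is not a last drone is either refilled at the station or left alone because it is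
already full. -/
theorem IsRun.battery_succ_eq (h : o.IsRun) {i k : ℕ} (hk : k < I.r) (hi : i < o.drones)
    (hl : i ∉ o.lastDrones k) : o.battery i (k + 1) = I.B := by
  have hs := h.service_rule k hk i
  apply le_antisymm (battery_le _ _)
  rw [battery]
  split_ifs with hc
  · exact le_rfl
  · by_contra hlt
    exact hc (hs.2 ⟨hi, hl, not_le.1 hlt⟩)

/-- Both assignment rules exclude the last drones of the preceding segment: the rule for first
blocks excludes all its drones, the other rule names the last ones explicitly. -/
theorem IsRun.battery_eq_of_busy (h : o.IsRun) {i l : ℕ} (hl : l ≤ I.r) (hi : i ∈ o.busy l) :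
    o.battery i l = I.B := by
  cases l with
  | zero => rfl
  | succ k =>
    refine h.battery_succ_eq (by omega) (h.lt_drones _ i hi) ?_
    obtain ⟨p, hp, rfl⟩ := hi
    by_cases hf : I.IsFirst (k + 1) p.2
    · exact fun hlast => (h.first_rule _ hl p hp hf).1 k rfl (lastDrones_subset_busy k hlast)
    · exact (h.other_rule _ hl p hp hf).1 k rfl

/-- Such a drone was no last drone two segments earlier, so it was full before the preceding
segment, and it did not work there. The service rule therefore passes over it, and it is free to
start during the waiting interval. -/
theorem IsRun.not_serviced_of_first (h : o.IsRun) {k : ℕ} (hk : k < I.r)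
    {p : ℕ × List (Fin I.n)} (hp : p ∈ o.assignedAt (k + 1)) (hf : I.IsFirst (k + 1) p.2) :
    p.1 ∉ o.servicedAt k := by
  obtain ⟨h₁, h₂⟩ := h.first_rule (k + 1) hk p hp hf
  intro hs
  obtain ⟨h₃, -, h₄⟩ := (h.service_rule k hk p.1).1 hs
  rw [h.spent_eq_zero (h₁ k rfl)] at h₄
  have : o.battery p.1 k = I.B := by
    cases k with
    | zero => rfl
    | succ k => exact h.battery_succ_eq (by omega) h₃ (h₂ k rfl)
  linarith

theorem IsRun.load_work_le (h : o.IsRun) (i : ℕ) {l : ℕ} (hl : l ≤ I.r) :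
    0 ≤ o.battery i l ∧ I.load (o.work i l) ≤ o.battery i l := by
  -- A working drone starts full and its block costs at most `B`; nonnegativity matters only for
  -- drones without work. It follows by induction from this implication.
  have key : ∀ l ≤ I.r, 0 ≤ o.battery i l → I.load (o.work i l) ≤ o.battery i l := by
    intro l hl h0
    rcases h.work_cases i l with ⟨-, h'⟩ | ⟨p, h₁, h₂, h₃⟩
    · simpa [h'] using h0
    · rw [h.battery_eq_of_busy hl ⟨p, h₁, h₂⟩, h₃]
      exact (h.block hl h₁).1
  have h0 : 0 ≤ o.battery i l := by
    induction l with
    | zero => exact I.B_pos.le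
    | succ l ih =>
      have := key l (by omega) (ih (by omega))
      rw [battery, spent_eq_load]
      split_ifs
      · exact I.B_pos.le
      · linarith
  exact ⟨h0, key l hl h0⟩

variable (o)

open Classical in
/-- The stay of drone `i` at station `l`, if it is serviced there. -/
def stay (i l : ℕ) : List I.Event :=
  if h : l < I.r then
    if i ∈ o.servicedAt l then [.service ⟨l, h⟩ (I.arr ⟨l, h⟩) (I.dep ⟨l, h⟩)] else []
  else []

theorem mem_stay {i l : ℕ} {e : I.Event} : e ∈ o.stay i l ↔
    ∃ h : l < I.r, i ∈ o.servicedAt l ∧ e = .service ⟨l, h⟩ (I.arr ⟨l, h⟩) (I.dep ⟨l, h⟩) := by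
  unfold stay
  split_ifs <;> simp [*]

/-- The deliveries of drone `i` in segment `l` in chronological order. -/
def sortedWork (i l : ℕ) : List (Fin I.n) :=
  (o.work i l).insertionSort fun a b => I.launch a ≤ I.launch b

theorem sortedWork_perm (i l : ℕ) : (o.sortedWork i l).Perm (o.work i l) :=
  List.perm_insertionSort _ _

theorem sortedWork_pairwise (i l : ℕ) :
    (o.sortedWork i l).Pairwise fun a b => I.launch a ≤ I.launch b :=
  have : Std.Total fun a b : Fin I.n => I.launch a ≤ I.launch b := ⟨fun _ _ => le_total _ _⟩
  have : IsTrans (Fin I.n) fun a b => I.launch a ≤ I.launch b := ⟨fun _ _ _ => le_trans⟩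
  List.pairwise_insertionSort _ _

/-- The events of drone `i` between the arrivals at stations `l - 1` and `l`, and at station `l`. -/
def stage (i l : ℕ) : List I.Event := (o.sortedWork i l).map Event.deliver ++ o.stay i l

theorem mem_stage {i l : ℕ} {e : I.Event} : e ∈ o.stage i l ↔
    (∃ j ∈ o.work i l, e = .deliver j) ∨
    ∃ h : l < I.r, i ∈ o.servicedAt l ∧ e = .service ⟨l, h⟩ (I.arr ⟨l, h⟩) (I.dep ⟨l, h⟩) := by
  rw [stage, List.mem_append, mem_stay, List.mem_map]
  simp only [(o.sortedWork_perm i l).mem_iff, eq_comm]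

/-- The events of drone `i` in chronological order. -/
def schedule (i : ℕ) : List I.Event := (List.range (I.r + 1)).flatMap (o.stage i)

theorem mem_schedule {i : ℕ} {e : I.Event} : e ∈ o.schedule i ↔ e ∈ o.assignment i := by
  simp only [schedule, List.mem_flatMap, List.mem_range, mem_stage, assignment, Set.mem_ofPred_eq,
    mem_work]
  constructor
  · rintro ⟨l, hl, ⟨j, ⟨p, hp, hpi, hj⟩, rfl⟩ | ⟨hlr, hs, rfl⟩⟩
    · exact Or.inl ⟨l, by omega, p, hp, hpi, j, hj, rfl⟩
    · exact Or.inr ⟨⟨l, hlr⟩, hs, rfl⟩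
  · rintro (⟨l, hl, p, hp, hpi, j, hj, rfl⟩ | ⟨k, hs, rfl⟩)
    · exact ⟨l, by omega, Or.inl ⟨j, ⟨p, hp, hpi, hj⟩, rfl⟩⟩
    · exact ⟨k, by omega, Or.inr ⟨k.2, hs, rfl⟩⟩

variable {o}

theorem IsRun.mem_work_block (h : o.IsRun) {i l : ℕ} (hl : l ≤ I.r) {j : Fin I.n}
    (hj : j ∈ o.work i l) : ∃ p ∈ o.assignedAt l, p.1 = i ∧ j ∈ p.2 ∧
      ∀ j ∈ p.2, j ∈ I.segment l := by
  obtain ⟨p, hp, hpi, hjp⟩ := o.mem_work.1 hj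
  exact ⟨p, hp, hpi, hjp, (h.block hl hp).2.2.1⟩

theorem IsRun.rendez_lt_of_not_last (h : o.IsRun) {i l : ℕ} (hl : l < I.r)
    (hi : i ∉ o.lastDrones l) {j : Fin I.n} (hj : j ∈ o.work i l) :
    I.rendez j < I.arr ⟨l, hl⟩ := by
  obtain ⟨p, hp, hpi, hjp, hseg⟩ := h.mem_work_block hl.le hj
  exact I.rendez_lt_arr_of_not_isLast hseg (fun hlast => hi ⟨p, hp, hpi, hlast⟩) rfl hjp

theorem IsRun.arr_le_launch (h : o.IsRun) {i l : ℕ} (hl : l ≤ I.r) {j : Fin I.n}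
    (hj : j ∈ o.work i l) {k : Fin I.r} (hk : k.val < l) : I.arr k ≤ I.launch j := by
  obtain ⟨p, hp, hpi, hjp, hseg⟩ := h.mem_work_block hl hj
  exact (I.mem_segment.1 (hseg j hjp)).1 k hk

theorem IsRun.rendez_lt_arr (h : o.IsRun) {i l : ℕ} (hl : l ≤ I.r) {j : Fin I.n}
    (hj : j ∈ o.work i l) {k : Fin I.r} (hk : l < k.val) : I.rendez j < I.arr k := by
  obtain ⟨p, hp, hpi, hjp, hseg⟩ := h.mem_work_block hl hj
  exact I.rendez_lt_arr (hseg j hjp) hk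

theorem before_deliver_iff {j j' : Fin I.n} :
    Event.Before (.deliver j) (.deliver j' : I.Event) ↔ I.rendez j < I.launch j' := by
  simp [Event.Before, Event.finish, Event.start]

theorem before_deliver_service_iff {j : Fin I.n} {k : Fin I.r} {s t : ℝ} :
    Event.Before (.deliver j) (.service k s t : I.Event) ↔ I.rendez j < s := by
  simp [Event.Before, Event.finish, Event.start]

theorem before_service_deliver_iff {j : Fin I.n} {k : Fin I.r} {s t : ℝ} :
    Event.Before (.service k s t : I.Event) (.deliver j) ↔ t < I.launch j := by
  simp [Event.Before, Event.finish, Event.start]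

theorem before_service_iff {k k' : Fin I.r} {s t s' t' : ℝ} :
    Event.Before (.service k s t : I.Event) (.service k' s' t') ↔ t < s' ∧ k ≠ k' := by
  constructor
  · rintro ⟨h₁, h₂⟩
    exact ⟨h₁, h₂ _ _ _ _ _ _ rfl rfl⟩
  · rintro ⟨h₁, h₂⟩
    refine ⟨h₁, ?_⟩
    rintro _ _ _ _ _ _ ⟨⟩ ⟨⟩
    exact h₂

theorem IsRun.pairwise_stage (h : o.IsRun) {i l : ℕ} (hl : l ≤ I.r) :
    (o.stage i l).Pairwise Event.Before := by
  rw [stage, List.pairwise_append]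
  refine ⟨?_, ?_, ?_⟩
  · rw [List.pairwise_map]
    have hnd : (o.sortedWork i l).Nodup := by
      rw [(o.sortedWork_perm i l).nodup_iff]
      rcases h.work_cases i l with ⟨-, h'⟩ | ⟨p, h₁, h₂, h₃⟩
      · simp [h']
      · rw [h₃]; exact (h.block hl h₁).2.1
    refine ((o.sortedWork_pairwise i l).and hnd).imp_of_mem ?_
    rintro a b ha hb ⟨hab, hne⟩
    rw [(o.sortedWork_perm i l).mem_iff] at ha hb
    rw [before_deliver_iff]
    by_contra hc
    rcases h.work_cases i l with ⟨-, h'⟩ | ⟨p, h₁, h₂, h₃⟩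
    · simp [h'] at ha
    · rw [h₃] at ha hb
      exact (h.block hl h₁).2.2.2 a ha b hb
        (I.conflictGraph_adj.2 ⟨hne, hab.trans (I.launch_le_rendez b), not_lt.1 hc⟩)
  · unfold stay
    split_ifs <;> simp
  · intro e he f hf
    obtain ⟨j, hj, rfl⟩ := List.mem_map.1 he
    obtain ⟨hlr, hs, rfl⟩ := o.mem_stay.1 hf
    rw [(o.sortedWork_perm i l).mem_iff] at hj
    rw [before_deliver_service_iff]
    exact h.rendez_lt_of_not_last hlr ((h.service_rule l hlr i).1 hs).2.1 hj

/-- Only neighbouring segments are delicate. A last drone gets no block of the next segment, and a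
drone serviced at a station gets no first block right after it. Events further apart are separated
by the order of the stations. -/
theorem IsRun.before_of_lt (h : o.IsRun) {i l l' : ℕ} (hl' : l' ≤ I.r) (hll : l < l')
    {e f : I.Event} (he : e ∈ o.stage i l) (hf : f ∈ o.stage i l') : Event.Before e f := by
  have hl : l < I.r := by omega
  rcases o.mem_stage.1 he with ⟨j, hj, rfl⟩ | ⟨_, hs, rfl⟩ <;>
    rcases o.mem_stage.1 hf with ⟨j', hj', rfl⟩ | ⟨hlr', hs', rfl⟩
  · rw [before_deliver_iff]
    by_cases hlast : i ∈ o.lastDrones l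
    · rcases (show l + 1 ≤ l' from hll).eq_or_lt with rfl | hlt
      · exfalso
        obtain ⟨p, hp, hpi, -, -⟩ := h.mem_work_block hl' hj'
        by_cases hf : I.IsFirst (l + 1) p.2
        · exact (h.first_rule _ hl' p hp hf).1 l rfl (hpi ▸ lastDrones_subset_busy l hlast)
        · exact (h.other_rule _ hl' p hp hf).1 l rfl (hpi ▸ hlast)
      · exact (h.rendez_lt_arr hl.le hj (k := ⟨l + 1, by omega⟩) (Nat.lt_succ_self l)).trans_le
          (h.arr_le_launch hl' hj' hlt)
    · exact (h.rendez_lt_of_not_last hl hlast hj).trans_le (h.arr_le_launch hl' hj' hll)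
  · rw [before_deliver_service_iff]
    exact h.rendez_lt_arr hl.le hj hll
  · rw [before_service_deliver_iff]
    rcases (show l + 1 ≤ l' from hll).eq_or_lt with rfl | hlt
    · obtain ⟨p, hp, hpi, hjp, hseg⟩ := h.mem_work_block hl' hj'
      refine I.dep_lt_launch_of_not_isFirst hseg (fun hf => ?_) rfl hjp
      exact h.not_serviced_of_first hl hp hf (hpi ▸ hs)
    · exact (I.dep_lt_arr ⟨l, hl⟩ ⟨l + 1, by omega⟩ (Nat.lt_succ_self l)).trans_le
        (h.arr_le_launch hl' hj' hlt)
  · rw [before_service_iff]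
    refine ⟨I.dep_lt_arr _ _ hll, fun he => ?_⟩
    have := congrArg Fin.val he
    simp only at this
    omega

theorem IsRun.withinBudget (h : o.IsRun) (i m : ℕ) {l : ℕ} (hl : l + m = I.r + 1) :
    I.WithinBudget (o.battery i l) ((List.range' l m).flatMap (o.stage i)) := by
  induction m generalizing l with
  | zero => exact trivial
  | succ m ih =>
    obtain ⟨h₁, h₂⟩ := h.load_work_le i (l := l) (by omega)
    have h₃ := o.battery_le i l
    have h₄ := I.load_nonneg (o.work i l)
    have hload := I.load_perm (o.sortedWork_perm i l)
    have ih := ih (l := l + 1) (by omega)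
    rw [List.range'_succ, List.flatMap_cons, stage, List.append_assoc]
    refine I.withinBudget_append (by rwa [hload]) ?_
    rw [battery, spent_eq_load] at ih
    rw [hload]
    unfold stay
    by_cases hlr : l < I.r
    · by_cases hs : i ∈ o.servicedAt l
      · rw [if_pos hs] at ih
        rw [dif_pos hlr, if_pos hs]
        change I.WithinBudget (I.levelAfter _ _ _ _) _
        rw [I.levelAfter_full _ (by linarith) (by linarith)]
        exact ih
      · rw [if_neg hs] at ih
        rw [dif_pos hlr, if_neg hs]
        exact ih
    · obtain rfl : m = 0 := by omega
      rw [dif_neg hlr]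
      exact trivial

theorem IsRun.feasible (h : o.IsRun) (i : ℕ) : I.Feasible (o.assignment i) := by
  refine ⟨o.schedule i, fun e => o.mem_schedule, ?_, ?_, ?_⟩
  · rw [schedule, List.pairwise_flatMap]
    refine ⟨fun l hl => h.pairwise_stage (by simpa [Nat.lt_succ_iff] using hl), ?_⟩
    refine List.pairwise_lt_range.imp_of_mem ?_
    intro l l' _ hl' hlt e he f hf
    exact h.before_of_lt (by simpa [Nat.lt_succ_iff] using hl') hlt he hf
  · intro e he
    rw [mem_schedule] at he
    rcases he with ⟨_, _, _, _, _, _, _, rfl⟩ | ⟨k, _, rfl⟩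
    · exact trivial
    · have := I.arr_lt_dep k
      unfold Event.Allowed
      dsimp only
      split
      · exact ⟨rfl, rfl⟩
      · exact ⟨le_rfl, this.le, le_rfl⟩
  · rw [schedule, List.range_eq_range']
    exact h.withinBudget i (I.r + 1) (l := 0) (by omega)

/-- The result of the algorithm is a solution. -/
theorem IsRun.isSolution (h : o.IsRun) : I.IsSolution o.drones fun i => o.assignment i := by
  refine ⟨fun i => h.feasible i, fun j => ?_⟩
  obtain ⟨l, hl, hj⟩ := I.exists_mem_segment j
  have hc := (h.packed l hl).contents_eq
  have hj' : j ∈ (I.segment l).val := hj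
  rw [← hc] at hj'
  obtain ⟨b, hb, hjb⟩ := I.mem_contents.1 hj'
  obtain ⟨p, hp, rfl⟩ := List.mem_map.1 (Multiset.mem_coe.1 hb)
  refine ⟨⟨p.1, h.lt_drones l _ ⟨p, hp, rfl⟩⟩, Or.inl ⟨l, hl, p, hp, rfl, j, hjb, rfl⟩, ?_⟩
  rintro ⟨i, hi⟩ (⟨l', hl', q, hq, hqi, j', hj', he⟩ | ⟨k, -, he⟩)
  · cases he
    obtain rfl := I.segment_unique hl hl' hj ((h.block hl' hq).2.2.1 j hj')
    have hnd : ((o.assignedAt l).map Prod.snd).flatten.Nodup := by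
      rw [← Multiset.coe_nodup, ← I.contents_coe, hc]
      exact (I.segment l).nodup
    have hd := (List.nodup_flatten.1 hnd).2
    rw [List.pairwise_map] at hd
    by_cases hpq : p = q
    · subst hpq
      exact Fin.ext hqi.symm
    · have : Std.Symm fun a b : ℕ × List (Fin I.n) => List.Disjoint a.2 b.2 :=
        ⟨fun _ _ h => h.symm⟩
      exact absurd hj' (hd.forall hp hq hpq hjb)
  · cases he

end Instance.Outcome

namespace Instance

variable (I : Instance)

/-! ### Lower bounds for the minimum number of drones -/

theorem Event.allowed_service {I : Instance} {k : Fin I.r} {s t : ℝ}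
    (h : (Event.service k s t : I.Event).Allowed) : I.arr k ≤ s ∧ s ≤ t ∧ t ≤ I.dep k := by
  unfold Event.Allowed at h
  dsimp only at h
  split at h
  · obtain ⟨rfl, rfl⟩ := h
    exact ⟨le_rfl, (I.arr_lt_dep k).le, le_rfl⟩
  · exact h

theorem levelAfter_mem {k : Fin I.r} {s t x : ℝ} (h : (Event.service k s t : I.Event).Allowed)
    (h₀ : 0 ≤ x) (h₁ : x ≤ I.B) : 0 ≤ I.levelAfter k s t x ∧ I.levelAfter k s t x ≤ I.B := by
  obtain ⟨a₁, a₂, a₃⟩ := Event.allowed_service h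
  unfold levelAfter
  split
  · exact ⟨I.B_pos.le, le_rfl⟩
  · next Ch hC => exact I.charge_mem k Ch hC s t x a₁ a₂ a₃ h₀ h₁

open Classical in
/-- The deliveries of segment `l` in a list of events. -/
def segmentDeliveries (l : ℕ) : List I.Event → List (Fin I.n)
  | [] => []
  | .deliver j :: L => if j ∈ I.segment l then j :: segmentDeliveries l L else segmentDeliveries l L
  | .service _ _ _ :: L => segmentDeliveries l L

theorem mem_segmentDeliveries {l : ℕ} {L : List I.Event} {j : Fin I.n} :
    j ∈ I.segmentDeliveries l L ↔ j ∈ I.segment l ∧ Event.deliver j ∈ L := by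
  induction L with
  | nil => simp [segmentDeliveries]
  | cons e L ih =>
    rcases e with i | ⟨k, s, t⟩
    · simp only [segmentDeliveries, List.mem_cons, Event.deliver.injEq]
      split_ifs with hi
      · rw [List.mem_cons, ih]
        constructor
        · rintro (rfl | ⟨h₁, h₂⟩)
          · exact ⟨hi, Or.inl rfl⟩
          · exact ⟨h₁, Or.inr h₂⟩
        · rintro ⟨h₁, rfl | h₂⟩
          · exact Or.inl rfl
          · exact Or.inr ⟨h₁, h₂⟩
      · rw [ih]
        constructor
        · rintro ⟨h₁, h₂⟩
          exact ⟨h₁, Or.inr h₂⟩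
        · rintro ⟨h₁, rfl | h₂⟩
          · exact absurd h₁ hi
          · exact ⟨h₁, h₂⟩
    · simp [segmentDeliveries, ih]

theorem nodup_segmentDeliveries {l : ℕ} {L : List I.Event} (hL : L.Pairwise Event.Before) :
    (I.segmentDeliveries l L).Nodup := by
  induction L with
  | nil => simp [segmentDeliveries]
  | cons e L ih =>
    rw [List.pairwise_cons] at hL
    rcases e with i | ⟨k, s, t⟩
    · simp only [segmentDeliveries]
      split_ifs with hi
      · refine List.nodup_cons.2 ⟨fun hm => ?_, ih hL.2⟩
        have := (hL.1 _ (I.mem_segmentDeliveries.1 hm).2).1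
        exact absurd (I.launch_le_rendez i) (not_le.2 this)
      · exact ih hL.2
    · exact ih hL.2

/-- No station is visited between two deliveries of the same segment. -/
theorem load_segmentDeliveries_le_of_after {l : ℕ} {L : List I.Event} {i : Fin I.n}
    (hi : i ∈ I.segment l) (hL : L.Pairwise Event.Before) (hall : ∀ e ∈ L, e.Allowed)
    (hafter : ∀ e ∈ L, Event.Before (.deliver i) e) {x : ℝ} (hx : 0 ≤ x)
    (hb : I.WithinBudget x L) : I.load (I.segmentDeliveries l L) ≤ x := by
  induction L generalizing x with
  | nil => simpa [segmentDeliveries] using hx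
  | cons e L ih =>
    rw [List.pairwise_cons] at hL
    have ih := fun x hx hb => ih hL.2 (fun e he => hall e (by simp [he]))
      (fun e he => hafter e (by simp [he])) (x := x) hx hb
    rcases e with j | ⟨k, s, t⟩
    · obtain ⟨h₁, h₂⟩ := hb
      have h₃ := ih _ (by linarith) h₂
      have h₄ := I.cost_pos j
      simp only [segmentDeliveries]
      split_ifs
      · rw [load_cons]; linarith
      · linarith
    · simp only [segmentDeliveries]
      -- After a stay no delivery of the segment remains. A station from `l` on is reached only
      -- after all launches of the segment, while an earlier station has been left before the
      -- delivery `i` ended.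
      suffices h : I.segmentDeliveries l L = [] by rw [h]; exact hx
      rw [List.eq_nil_iff_forall_not_mem]
      intro j hj
      obtain ⟨hj, hjL⟩ := I.mem_segmentDeliveries.1 hj
      obtain ⟨a₁, a₂, a₃⟩ := Event.allowed_service (hall _ List.mem_cons_self)
      have h₁ : t < I.launch j := (hL.1 _ hjL).1
      have h₂ : I.rendez i < s := (hafter _ List.mem_cons_self).1
      rw [mem_segment] at hi hj
      have hk : k.val < l := by
        by_contra hc
        have := hj.2 k (not_lt.1 hc)
        linarith
      have := I.dep_lt_rendez (hi.1 k hk)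
      linarith

/-- The first delivery of the segment finds a level of at most `B`, and from there on the level only
falls until the segment is finished. Only the bounds `0` and `B` on charged levels are used, so
partial charging gives no advantage here. -/
theorem load_segmentDeliveries_le (l : ℕ) {L : List I.Event} (hL : L.Pairwise Event.Before)
    (hall : ∀ e ∈ L, e.Allowed) {x : ℝ} (hx : 0 ≤ x) (hxB : x ≤ I.B) (hb : I.WithinBudget x L) :
    I.load (I.segmentDeliveries l L) ≤ I.B := by
  induction L generalizing x with
  | nil => simpa [segmentDeliveries] using I.B_pos.le
  | cons e L ih =>
    rw [List.pairwise_cons] at hL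
    have hall' : ∀ e ∈ L, e.Allowed := fun e he => hall e (by simp [he])
    rcases e with j | ⟨k, s, t⟩
    · obtain ⟨h₁, h₂⟩ := hb
      have h₄ := I.cost_pos j
      simp only [segmentDeliveries]
      split_ifs with hj
      · have := I.load_segmentDeliveries_le_of_after hj hL.2 hall' hL.1 (by linarith) h₂
        rw [load_cons]; linarith
      · exact ih hL.2 hall' (by linarith) (by linarith) h₂
    · obtain ⟨h₁, h₂⟩ := I.levelAfter_mem (hall _ List.mem_cons_self) hx hxB
      exact ih hL.2 hall' h₁ h₂ hb

theorem Feasible.not_adj {I : Instance} {A : Set I.Event} (hA : I.Feasible A) {i j : Fin I.n}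
    (hi : .deliver i ∈ A) (hj : .deliver j ∈ A) : ¬ I.conflictGraph.Adj i j := by
  obtain ⟨L, h₁, h₂, -, -⟩ := hA
  intro hadj
  rw [I.conflictGraph_adj] at hadj
  have : Std.Symm fun e f : I.Event => e.Before f ∨ f.Before e := ⟨fun _ _ h => h.symm⟩
  have h := (h₂.imp (S := fun e f : I.Event => e.Before f ∨ f.Before e) Or.inl).forall
    ((h₁ _).2 hi) ((h₁ _).2 hj) (fun h => hadj.1 (Event.deliver.inj h))
  rw [Outcome.before_deliver_iff, Outcome.before_deliver_iff] at h
  rcases h with h | h <;> linarith [hadj.2.1, hadj.2.2]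

open Classical in
/-- The deliveries of one drone in one segment form a block. -/
theorem Feasible.isBlock {I : Instance} {A : Set I.Event} (hA : I.Feasible A) (l : ℕ) :
    I.IsBlock ((I.segment l).filter fun j => .deliver j ∈ A) := by
  refine ⟨fun i hi j hj => ?_, ?_⟩
  · rw [Finset.mem_filter] at hi hj
    exact hA.not_adj hi.2 hj.2
  · obtain ⟨L, h₁, h₂, h₃, h₄⟩ := hA
    have h := I.load_segmentDeliveries_le l h₂ h₃ I.B_pos.le le_rfl h₄
    rw [load, ← List.sum_toFinset _ (I.nodup_segmentDeliveries h₂)] at h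
    refine le_trans (le_of_eq (Finset.sum_congr ?_ fun _ _ => rfl)) h
    ext j
    rw [List.mem_toFinset, mem_segmentDeliveries, Finset.mem_filter, h₁]

/-- Restricting the drones of the solution to one segment partitions it into blocks, some possibly
empty. Each segment thus gives its own lower bound for the number of drones. -/
theorem IsSolution.optNS_segment_le {I : Instance} {m : ℕ} {A : Fin m → Set I.Event}
    (h : I.IsSolution m A) (l : ℕ) : I.optNS (I.segment l) ≤ m := by
  classical
  refine Nat.sInf_le ⟨fun i => (I.segment l).filter fun j => .deliver j ∈ A i,
    fun i => (h.1 i).isBlock l, ?_, ?_⟩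
  · intro i i' hii
    rw [Finset.disjoint_left]
    intro j hj hj'
    rw [Finset.mem_filter] at hj hj'
    exact hii ((h.2 j).unique hj.2 hj'.2)
  · intro j
    obtain ⟨i, hi, -⟩ := h.2 j
    simp only [Finset.mem_filter]
    exact ⟨fun hj => ⟨i, hj, hi⟩, fun ⟨_, hj, _⟩ => hj⟩

/-- A drone never performs two conflicting deliveries, so the map from a largest clique to its
drones is injective. -/
theorem IsSolution.omega_le {I : Instance} {m : ℕ} {A : Fin m → Set I.Event}
    (h : I.IsSolution m A) : I.omega ≤ m := by
  obtain ⟨K, hK⟩ := I.conflictGraph.exists_isNClique_cliqueNum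
  choose d hd _ using h.2
  rw [omega, ← hK.card_eq, ← Fintype.card_fin m]
  refine Finset.card_le_card_of_injOn d (fun _ _ => Finset.mem_coe.2 (Finset.mem_univ _)) ?_
  intro i hi j hj hij
  by_contra hne
  exact (h.1 (d i)).not_adj (hd i) (by rw [hij]; exact hd j) (hK.isClique hi hj hne)

/-- The partition into singletons, padded with empty blocks, shows that the infimum defining `optNS`
is taken over a nonempty set and hence attained. -/
theorem exists_partition (s : Finset (Fin I.n)) :
    ∃ P : Fin (I.optNS s) → Finset (Fin I.n), (∀ i, I.IsBlock (P i)) ∧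
      (∀ i i', i ≠ i' → Disjoint (P i) (P i')) ∧ ∀ j, j ∈ s ↔ ∃ i, j ∈ P i := by
  classical
  refine Nat.sInf_mem (s := {m | ∃ P : Fin m → Finset (Fin I.n), (∀ i, I.IsBlock (P i)) ∧
    (∀ i i', i ≠ i' → Disjoint (P i) (P i')) ∧ ∀ j, j ∈ s ↔ ∃ i, j ∈ P i})
    ⟨I.n, fun i => s.filter (· = i), ?_, ?_, ?_⟩
  · intro i
    refine ⟨?_, ?_⟩
    · intro a ha b hb hab
      rw [Finset.mem_filter] at ha hb
      exact hab.ne (ha.2.trans hb.2.symm)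
    · dsimp only
      rw [Finset.filter_eq']
      split_ifs
      · simpa using I.cost_le i
      · simpa using I.B_pos.le
  · intro i i' hii
    rw [Finset.disjoint_left]
    intro j hj hj'
    rw [Finset.mem_filter] at hj hj'
    exact hii (hj.2.symm.trans hj'.2)
  · intro j
    simp

theorem omegaOn_le_optNS (s : Finset (Fin I.n)) : I.omegaOn s ≤ I.optNS s := by
  obtain ⟨P, h₁, -, h₃⟩ := I.exists_partition s
  obtain ⟨K, hKs, hK, hcard⟩ := I.exists_card_eq_omegaOn s
  have hex : ∀ j ∈ K, ∃ i, j ∈ P i := fun j hj => (h₃ j).1 (hKs hj)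
  -- `Option` supplies a default value, since `Fin (I.optNS s)` may be empty.
  choose! d hd using fun j => (by
    by_cases hj : j ∈ K
    · obtain ⟨i, hi⟩ := hex j hj
      exact ⟨some i, fun _ => ⟨i, rfl, hi⟩⟩
    · exact ⟨none, fun h => absurd h hj⟩ :
      ∃ o : Option (Fin (I.optNS s)), j ∈ K → ∃ i, o = some i ∧ j ∈ P i)
  rw [← hcard]
  calc K.card ≤ (Finset.univ.map (Function.Embedding.some : Fin (I.optNS s) ↪ _)).card := by
        refine Finset.card_le_card_of_injOn d ?_ ?_
        · intro j hj
          obtain ⟨i, hi, -⟩ := hd j hj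
          rw [hi]
          simp
        · intro a ha b hb hab
          obtain ⟨i, hi, hai⟩ := hd a ha
          obtain ⟨i', hi', hbi⟩ := hd b hb
          obtain rfl : i = i' := Option.some.inj (by rw [← hi, ← hi', hab])
          by_contra hne
          exact (h₁ i).1 a hai b hbi (hK ha hb hne)
    _ = I.optNS s := by simp

theorem sum_cost_le_optNS_mul (s : Finset (Fin I.n)) :
    ∑ j ∈ s, I.cost j ≤ I.optNS s * I.B := by
  classical
  obtain ⟨P, h₁, h₂, h₃⟩ := I.exists_partition s
  have hs : s = Finset.univ.biUnion P := by
    ext j; simp [h₃]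
  calc ∑ j ∈ s, I.cost j = ∑ j ∈ Finset.univ.biUnion P, I.cost j := by rw [← hs]
    _ = ∑ i, ∑ j ∈ P i, I.cost j := Finset.sum_biUnion fun i _ i' _ h => h₂ i i' h
    _ ≤ ∑ _i : Fin (I.optNS s), I.B := Finset.sum_le_sum fun i _ => (h₁ i).2
    _ = I.optNS s * I.B := by simp

/-- If all deliveries need more than half a battery, no two of them share a block. -/
theorem card_le_optNS_of_large (hlarge : ∀ j, I.B / 2 < I.cost j) (s : Finset (Fin I.n)) :
    s.card ≤ I.optNS s := by
  classical
  obtain ⟨P, h₁, h₂, h₃⟩ := I.exists_partition s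
  have hs : s = Finset.univ.biUnion P := by
    ext j; simp [h₃]
  have hP : ∀ i, (P i).card ≤ 1 := by
    intro i
    rw [Finset.card_le_one]
    intro a ha b hb
    by_contra hne
    have hsub : ({a, b} : Finset _) ⊆ P i := by
      intro x hx
      rcases Finset.mem_insert.1 hx with rfl | hx
      · exact ha
      · rwa [Finset.mem_singleton.1 hx]
    have := Finset.sum_le_sum_of_subset_of_nonneg hsub
      (fun j _ _ => (I.cost_pos j).le)
    rw [Finset.sum_pair hne] at this
    linarith [(h₁ i).2, hlarge a, hlarge b]
  calc s.card = (Finset.univ.biUnion P).card := by rw [← hs]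
    _ ≤ ∑ i, (P i).card := Finset.card_biUnion_le
    _ ≤ ∑ _i : Fin (I.optNS s), 1 := Finset.sum_le_sum fun i _ => hP i
    _ = I.optNS s := by simp

/-! ### The approximation factor of the greedy rule -/

/-- The total energy of a collection of blocks. -/
def totalLoad (bins : Multiset (List (Fin I.n))) : ℝ := (bins.map I.load).sum

theorem sum_cost_contents (bins : Multiset (List (Fin I.n))) :
    ((I.contents bins).map I.cost).sum = I.totalLoad bins := by
  induction bins using Multiset.induction_on with
  | empty => simp [totalLoad]
  | cons b bins ih => simp [totalLoad, load] at ih ⊢; rw [ih]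

theorem NSRun.totalLoad_eq {I : Instance} {s : Finset (Fin I.n)} {blocks : Multiset (List (Fin I.n))}
    (h : I.NSRun s blocks) : I.totalLoad blocks = ∑ j ∈ s, I.cost j := by
  rw [← sum_cost_contents, h.contents_eq]
  rfl

open Classical in
/-- At most one block of a greedy run is lighter than the threshold `θ`. -/
theorem GreedyRun.countP_le {I : Instance} {js : List (Fin I.n)}
    {bins out : Multiset (List (Fin I.n))} (h : I.GreedyRun js bins out) {θ : ℝ}
    (hθ : ∀ j, I.cost j ≤ I.B - θ ∨ θ < I.cost j)
    (hb : bins.countP (fun b => I.load b ≤ θ) ≤ 1) :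
    out.countP (fun b => I.load b ≤ θ) ≤ 1 := by
  induction h with
  | done => exact hb
  | fit j js b rest out hc _ ih =>
    apply ih
    refine le_trans ?_ hb
    rw [Multiset.countP_cons, Multiset.countP_cons, load_cons]
    have := I.cost_pos j
    gcongr
    split_ifs with h₁ h₂
    · exact le_rfl
    · exact absurd (by linarith) h₂
    · omega
    · exact le_rfl
  | fresh j js bins out hc _ ih =>
    apply ih
    rw [Multiset.countP_cons]
    -- A small delivery opens a drone only if every open load already exceeds `θ`; a large delivery
    -- exceeds `θ` by itself. In neither case does a second light block arise.
    rcases hθ j with h₁ | h₁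
    · have h0 : bins.countP (fun b => I.load b ≤ θ) = 0 := by
        rw [Multiset.countP_eq_zero]
        intro b hb
        have := hc b hb
        linarith
      rw [h0]
      split_ifs <;> omega
    · rw [if_neg (by simpa using h₁)]
      exact hb

/-- Every block above the threshold pays `θ` itself. The single possible light block pays at least
`μ`, leaving a deficit of at most `θ - μ`. -/
theorem card_mul_le_totalLoad_add {bins : Multiset (List (Fin I.n))} {θ μ : ℝ} (hμθ : μ ≤ θ)
    (hμ : ∀ b ∈ bins, μ ≤ I.load b)
    (hθ : open Classical in bins.countP (fun b => I.load b ≤ θ) ≤ 1) :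
    Multiset.card bins * θ ≤ I.totalLoad bins + (θ - μ) := by
  classical
  have key : Multiset.card bins * θ ≤
      I.totalLoad bins + bins.countP (fun b => I.load b ≤ θ) * (θ - μ) := by
    clear hθ
    induction bins using Multiset.induction_on with
    | empty => simp [totalLoad]
    | cons b bins ih =>
      have ih := ih fun b hb => hμ b (Multiset.mem_cons_of_mem hb)
      have hb := hμ b (Multiset.mem_cons_self b bins)
      have ht : I.totalLoad (b ::ₘ bins) = I.load b + I.totalLoad bins := by simp [totalLoad]
      rw [Multiset.countP_cons, ht, Multiset.card_cons]
      push_cast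
      split_ifs with h
      · linarith
      · linarith
  have h1 : (bins.countP (fun b => I.load b ≤ θ) : ℝ) ≤ 1 := by
    exact_mod_cast hθ
  nlinarith

theorem totalLoad_add (a b : Multiset (List (Fin I.n))) :
    I.totalLoad (a + b) = I.totalLoad a + I.totalLoad b := by simp [totalLoad]

/-- Greedy runs separately on each colour class, so the deficit occurs at most once per colour. -/
theorem NSRun.card_mul_le {I : Instance} {s : Finset (Fin I.n)} {blocks : Multiset (List (Fin I.n))}
    (h : I.NSRun s blocks) {θ μ : ℝ} (hμθ : μ ≤ θ) (hμ : ∀ j, μ ≤ I.cost j)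
    (hθ : ∀ j, I.cost j ≤ I.B - θ ∨ θ < I.cost j) :
    Multiset.card blocks * θ ≤ I.totalLoad blocks + I.omegaOn s * (θ - μ) := by
  obtain ⟨c, J, out, -, -, -, h₄, rfl⟩ := h
  have key : ∀ m ≤ I.omegaOn s, Multiset.card (∑ k ∈ Finset.range m, out k) * θ ≤
      I.totalLoad (∑ k ∈ Finset.range m, out k) + m * (θ - μ) := by
    intro m hm
    induction m with
    | zero => simp [totalLoad]
    | succ m ih =>
      have ih := ih (by omega)
      have hr := h₄ m (by omega)
      have := I.card_mul_le_totalLoad_add (bins := out m) hμθ (fun b hb => by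
        have hne := hr.ne_nil (by simp) b hb
        cases b with
        | nil => exact absurd rfl hne
        | cons j b =>
          have := hμ j
          have := I.load_nonneg b
          rw [load_cons]; linarith) (hr.countP_le hθ (by simp))
      rw [Finset.sum_range_succ, totalLoad_add, Multiset.card_add]
      push_cast
      linarith
  exact key _ le_rfl

theorem NSRun.card_le_card {I : Instance} {s : Finset (Fin I.n)}
    {blocks : Multiset (List (Fin I.n))} (h : I.NSRun s blocks) :
    Multiset.card blocks ≤ s.card := by
  rw [Finset.card_def, ← h.contents_eq]
  have hne := fun b hb => (h.block (b := b) hb).2.1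
  clear h
  induction blocks using Multiset.induction_on with
  | empty => simp
  | cons b bins ih =>
    have ih := ih fun b hb => hne b (Multiset.mem_cons_of_mem hb)
    have := List.length_pos_iff.2 (hne b (Multiset.mem_cons_self b bins))
    rw [contents_cons, Multiset.card_cons, Multiset.card_add, Multiset.coe_card]
    omega

theorem epsMin_mul_le_cost (j : Fin I.n) : I.epsMin * I.B ≤ I.cost j := by
  rw [epsMin, div_mul_cancel₀ _ I.B_pos.ne']
  exact ciInf_le (Set.finite_range I.cost).bddBelow j

/-- This is the dichotomy required by `GreedyRun.countP_le` for `θ = (1 - epsMax) * B`. It explains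
the cap at `1 / 2`: below the cap all deliveries are small, and at the cap the two alternatives meet
at `B / 2`. -/
theorem cost_le_or_lt (j : Fin I.n) :
    I.cost j ≤ I.epsMax * I.B ∨ (1 - I.epsMax) * I.B < I.cost j := by
  have hB := I.B_pos
  rcases le_total (1 / 2) ((⨆ j, I.cost j) / I.B) with h | h
  · rw [epsMax, min_eq_left h]
    rcases le_or_gt (I.cost j) (1 / 2 * I.B) with h' | h'
    · exact Or.inl h'
    · right; linarith
  · left
    rw [epsMax, min_eq_right h, div_mul_cancel₀ _ I.B_pos.ne']
    exact le_ciSup (Set.finite_range I.cost).bddAbove j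

theorem epsMax_le_half : I.epsMax ≤ 1 / 2 := min_le_left _ _

theorem epsMin_le_one : I.epsMin ≤ 1 := by
  rw [epsMin, div_le_one I.B_pos]
  by_cases h : Nonempty (Fin I.n)
  · obtain ⟨j⟩ := h
    exact (ciInf_le (Set.finite_range I.cost).bddBelow j).trans (I.cost_le j)
  · have : IsEmpty (Fin I.n) := not_nonempty_iff.1 h
    rw [Real.iInf_of_isEmpty]
    exact I.B_pos.le

/-- Because of the cap in `epsMax`, `psi` can be negative. The bound ensures that the factor is
still at least one. -/
theorem neg_one_le_psi : -1 ≤ I.psi := by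
  have h₁ := I.epsMax_le_half
  have h₂ := I.epsMin_le_one
  rw [psi, le_div_iff₀ (by linarith)]
  linarith

/-- Bounding total cost by `optNS * B` and the number of colours by `optNS` turns the deficit
estimate into `optNS * (2 - epsMax - epsMin) * B`, and `2 - epsMax - epsMin` is `(2 + psi) * (1 -
epsMax)`. -/
theorem isFactorNS_psi : I.IsFactorNS (2 + I.psi) := by
  intro s blocks h
  have h₁ := I.epsMax_le_half
  have hB := I.B_pos
  have hopt : (0 : ℝ) ≤ I.optNS s := Nat.cast_nonneg _
  rcases le_or_gt I.epsMin (1 - I.epsMax) with hc | hc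
  · have hω : (I.omegaOn s : ℝ) ≤ I.optNS s := by exact_mod_cast I.omegaOn_le_optNS s
    have hS := I.sum_cost_le_optNS_mul s
    have hcard := h.card_mul_le (θ := (1 - I.epsMax) * I.B) (μ := I.epsMin * I.B)
      (by gcongr) I.epsMin_mul_le_cost (fun j => by
        refine (I.cost_le_or_lt j).imp (fun h => ?_) id
        linarith)
    rw [h.totalLoad_eq] at hcard
    have h₂ : (I.omegaOn s : ℝ) * ((1 - I.epsMax) * I.B - I.epsMin * I.B) ≤
        I.optNS s * ((1 - I.epsMax) * I.B - I.epsMin * I.B) :=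
      mul_le_mul_of_nonneg_right hω (by nlinarith)
    have h₃ : (2 + I.psi) * (1 - I.epsMax) = 2 - I.epsMax - I.epsMin := by
      have : 1 - I.epsMax ≠ 0 := by linarith
      rw [psi]
      field_simp
      ring
    have h₄ : (0 : ℝ) < (1 - I.epsMax) * I.B := mul_pos (by linarith) hB
    refine le_of_mul_le_mul_right ?_ h₄
    calc (Multiset.card blocks : ℝ) * ((1 - I.epsMax) * I.B) ≤
          I.optNS s * ((2 - I.epsMax - I.epsMin) * I.B) := by linarith
      _ = (2 + I.psi) * I.optNS s * ((1 - I.epsMax) * I.B) := by rw [← h₃]; ring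
  -- Here the deficit `θ - μ` would be negative, so the estimate does not apply. But now every
  -- delivery needs more than half a battery, and even one block per delivery is optimal.
  · have hlarge : ∀ j, I.B / 2 < I.cost j := fun j => by
      have := I.epsMin_mul_le_cost j
      nlinarith
    have h₂ : (Multiset.card blocks : ℝ) ≤ I.optNS s := by
      exact_mod_cast h.card_le_card.trans (I.card_le_optNS_of_large hlarge s)
    have := I.neg_one_le_psi
    nlinarith

end Instance

namespace Instance.Outcome

variable {I : Instance} {o : I.Outcome}

/-- An infimum over the empty set of naturals would be `0`. The output of the run itself shows that
solutions exist, so `optSC` is attained. -/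
theorem IsRun.exists_solution_optSC (h : o.IsRun) :
    ∃ A : Fin I.optSC → Set I.Event, I.IsSolution I.optSC A :=
  Nat.sInf_mem (s := {m | ∃ A : Fin m → Set I.Event, I.IsSolution m A})
    ⟨o.drones, _, h.isSolution⟩

theorem IsRun.omega_le_optSC (h : o.IsRun) : I.omega ≤ I.optSC :=
  h.exists_solution_optSC.choose_spec.omega_le

theorem IsRun.length_le (h : o.IsRun) {β : ℝ} (hβ : I.IsFactorNS β) {l : ℕ} (hl : l ≤ I.r) :
    ((o.assignedAt l).length : ℝ) ≤ β * I.optNS (I.segment l) := by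
  simpa using hβ _ _ (h.packed l hl)

/-- For a segment with the most blocks, the factor compares their number with `optNS` of that
segment, which is at most `optSC`. -/
theorem IsRun.mMax_le (h : o.IsRun) {β : ℝ} (hβ : I.IsFactorNS β) :
    (o.mMax : ℝ) ≤ β * I.optSC := by
  obtain ⟨l, hl, he⟩ := Finset.exists_mem_eq_sup (Finset.range (I.r + 1)) (by simp)
    fun l => (o.assignedAt l).length
  have hl : l ≤ I.r := by simpa [Nat.lt_succ_iff] using hl
  have hm : o.mMax = (o.assignedAt l).length := he
  rw [hm]
  rcases le_or_gt 0 β with h0 | h0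
  · refine (h.length_le hβ hl).trans (mul_le_mul_of_nonneg_left ?_ h0)
    exact_mod_cast h.exists_solution_optSC.choose_spec.optNS_segment_le l
  -- A negative factor forces every packing to be empty, so there are no deliveries and `optSC`
  -- vanishes.
  · have hzero : ∀ l ≤ I.r, (o.assignedAt l).length = 0 := by
      intro l hl
      have h₁ := h.length_le hβ hl
      have h₂ : (0 : ℝ) ≤ I.optNS (I.segment l) := Nat.cast_nonneg _
      have h₃ : ((o.assignedAt l).length : ℝ) ≤ 0 := h₁.trans (by nlinarith)
      exact Nat.le_zero.1 (by exact_mod_cast h₃)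
    have hempty : ∀ _ : Fin I.n, False := by
      intro j
      obtain ⟨i, hi⟩ := h.isSolution.2 j
      rcases hi.1 with ⟨l, hl, p, hp, -⟩ | ⟨k, -, he⟩
      · rw [List.length_eq_zero_iff.1 (hzero l hl)] at hp
        simp at hp
      · cases he
    have hopt : I.optSC = 0 := Nat.le_zero.1 (Nat.sInf_le
      ⟨fun _ => ∅, fun i => i.elim0, fun j => (hempty j).elim⟩)
    rw [hzero l hl, hopt]
    simp

theorem IsRun.drones_le (h : o.IsRun) {β : ℝ} (hβ : I.IsFactorNS β) :
    (o.drones : ℝ) ≤ β * I.optSC + 2 * I.omega := by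
  have := h.mMax_le hβ
  rw [h.drones_eq]
  push_cast
  linarith

end Instance.Outcome

namespace Instance

variable (I : Instance)

/-! ### Cutting into segments -/

theorem val_cutAt (t : ℝ) (js : List (Fin I.n)) : (I.cutAt t js).val =
    (js.takeWhile (fun j => I.launch j < t), js.dropWhile (fun j => I.launch j < t)) := by
  induction js with
  | nil => rfl
  | cons j js ih => by_cases h : I.launch j < t <;> simp [cutAt, h, ih]

theorem time_cutAt (t : ℝ) (js : List (Fin I.n)) :
    (I.cutAt t js).time = (I.cutAt t js).val.1.length + 1 := by
  induction js with
  | nil => rfl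
  | cons j js ih =>
    by_cases h : I.launch j < t
    · simp [cutAt, h, ih]; ring
    · simp [cutAt, h]

theorem cutAt_append (t : ℝ) (js : List (Fin I.n)) :
    (I.cutAt t js).val.1 ++ (I.cutAt t js).val.2 = js := by
  rw [val_cutAt]; exact List.takeWhile_append_dropWhile

theorem launch_lt_of_mem_cutAt {t : ℝ} {js : List (Fin I.n)} {j : Fin I.n}
    (hj : j ∈ (I.cutAt t js).val.1) : I.launch j < t := by
  rw [val_cutAt] at hj
  simpa using List.mem_takeWhile_imp hj

theorem le_launch_of_mem_cutAt {t : ℝ} {js : List (Fin I.n)}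
    (hs : js.Pairwise fun i j => I.launch i ≤ I.launch j) {j : Fin I.n}
    (hj : j ∈ (I.cutAt t js).val.2) : t ≤ I.launch j := by
  rw [val_cutAt] at hj
  dsimp only at hj
  induction js with
  | nil => simp at hj
  | cons i js ih =>
    rw [List.pairwise_cons] at hs
    rw [List.dropWhile_cons] at hj
    split_ifs at hj with hi
    · exact ih hs.2 hj
    · simp only [decide_eq_true_eq, not_lt] at hi
      rcases List.mem_cons.1 hj with rfl | hj
      · exact hi
      · exact hi.trans (hs.1 j hj)

theorem val_cutAll_cons (k : Fin I.r) (ks : List (Fin I.r)) (js : List (Fin I.n)) :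
    (I.cutAll (k :: ks) js).val =
      (I.cutAt (I.arr k) js).val.1 :: (I.cutAll ks (I.cutAt (I.arr k) js).val.2).val := rfl

theorem time_cutAll (ks : List (Fin I.r)) (js : List (Fin I.n)) :
    (I.cutAll ks js).time ≤ js.length + 2 * ks.length + 1 := by
  induction ks generalizing js with
  | nil => simp [cutAll]
  | cons k ks ih =>
    have h₁ := I.time_cutAt (I.arr k) js
    have h₂ := congrArg List.length (I.cutAt_append (I.arr k) js)
    have h₃ := ih (I.cutAt (I.arr k) js).val.2
    rw [List.length_append] at h₂
    simp only [cutAll, Timed.time_bind, Timed.time_tick, Timed.time_pure, List.length_cons]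
    omega

theorem length_cutAll (ks : List (Fin I.r)) (js : List (Fin I.n)) :
    (I.cutAll ks js).val.length = ks.length + 1 := by
  induction ks generalizing js with
  | nil => rfl
  | cons k ks ih => simp [val_cutAll_cons, ih]

theorem flatten_cutAll (ks : List (Fin I.r)) (js : List (Fin I.n)) :
    (I.cutAll ks js).val.flatten = js := by
  induction ks generalizing js with
  | nil => simp [cutAll]
  | cons k ks ih => rw [val_cutAll_cons, List.flatten_cons, ih, cutAt_append]

theorem mem_cutAll {ks : List (Fin I.r)} (hk : ks.Pairwise (· < ·)) {js : List (Fin I.n)}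
    (hs : js.Pairwise fun i j => I.launch i ≤ I.launch j) {l : ℕ} {j : Fin I.n}
    (hj : j ∈ (I.cutAll ks js).val.getD l []) (i : ℕ) (hi : i < ks.length) :
    (i < l → I.arr ks[i] ≤ I.launch j) ∧ (l ≤ i → I.launch j < I.arr ks[i]) := by
  induction ks generalizing js l i with
  | nil => simp at hi
  | cons k ks ih =>
    rw [List.pairwise_cons] at hk
    have hap := I.cutAt_append (I.arr k) js
    have hs' : (I.cutAt (I.arr k) js).val.2.Pairwise fun i j => I.launch i ≤ I.launch j :=
      hs.sublist (by conv_rhs => rw [← hap]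
                     exact List.sublist_append_right _ _)
    rw [val_cutAll_cons] at hj
    cases l with
    | zero =>
      rw [List.getD_cons_zero] at hj
      have hlt := I.launch_lt_of_mem_cutAt hj
      refine ⟨fun h => absurd h (by omega), fun _ => hlt.trans_le ?_⟩
      cases i with
      | zero => exact le_rfl
      | succ i => exact (I.arr_lt_arr (hk.1 _ (List.getElem_mem _))).le
    | succ l =>
      rw [List.getD_cons_succ] at hj
      cases i with
      | zero =>
        refine ⟨fun _ => ?_, fun h => absurd h (by omega)⟩
        refine I.le_launch_of_mem_cutAt hs ?_
        change j ∈ (I.cutAt (I.arr k) js).val.2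
        rw [← I.flatten_cutAll ks (I.cutAt (I.arr k) js).val.2]
        by_cases hl : l < (I.cutAll ks (I.cutAt (I.arr k) js).val.2).val.length
        · rw [List.getD_eq_getElem _ _ hl] at hj
          exact List.mem_flatten.2 ⟨_, List.getElem_mem hl, hj⟩
        · rw [List.getD_eq_default _ _ (not_lt.1 hl)] at hj
          simp at hj
      | succ i =>
        have := ih hk.2 hs' hj i (by simpa using hi)
        simpa using this

/-- The implementation cuts a sorted list of all deliveries into the segments. -/
theorem mem_cutAll_iff {xs : List (Fin I.n)} (hall : ∀ j, j ∈ xs)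
    (hs : xs.Pairwise fun i j => I.launch i ≤ I.launch j) {l : ℕ} (hl : l ≤ I.r) (j : Fin I.n) :
    j ∈ I.segment l ↔ j ∈ (I.cutAll (List.finRange I.r) xs).val.getD l [] := by
  have key : ∀ l, j ∈ (I.cutAll (List.finRange I.r) xs).val.getD l [] → j ∈ I.segment l := by
    intro l hj
    have h := I.mem_cutAll (List.pairwise_lt_finRange I.r) hs hj
    rw [mem_segment]
    refine ⟨fun k hk => ?_, fun k hk => ?_⟩
    · simpa using (h k.val (by simp)).1 hk
    · simpa using (h k.val (by simp)).2 hk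
  -- The lists together contain every delivery and the segments are disjoint, so the inclusion
  -- already proved is an equality.
  refine ⟨fun hj => ?_, key l⟩
  have hm := hall j
  rw [← I.flatten_cutAll (List.finRange I.r) xs] at hm
  obtain ⟨c, hc, hjc⟩ := List.mem_flatten.1 hm
  obtain ⟨l', hl', rfl⟩ := List.mem_iff_getElem.1 hc
  have hlen := I.length_cutAll (List.finRange I.r) xs
  rw [List.length_finRange] at hlen
  have hjc' : j ∈ (I.cutAll (List.finRange I.r) xs).val.getD l' [] := by
    rwa [List.getD_eq_getElem _ _ hl']
  rwa [I.segment_unique hl (by omega) hj (key l' hjc')]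

/-! ### Distributing the blocks -/

/-- Some interval of the block contains the given time. -/
def Hit (t : Option ℝ) (b : List (Fin I.n)) : Prop :=
  ∃ u, t = some u ∧ ∃ j ∈ b, I.launch j ≤ u ∧ u ≤ I.rendez j

open Classical in
theorem val_hits (t : ℝ) (b : List (Fin I.n)) :
    (I.hits t b).val = decide (∃ j ∈ b, I.launch j ≤ t ∧ t ≤ I.rendez j) := by
  induction b with
  | nil => simp [hits]
  | cons j b ih => by_cases h : I.launch j ≤ t ∧ t ≤ I.rendez j <;> simp [hits, h, ih]

theorem time_hits_le (t : ℝ) (b : List (Fin I.n)) : (I.hits t b).time ≤ b.length + 1 := by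
  induction b with
  | nil => simp [hits]
  | cons j b ih =>
    by_cases h : I.launch j ≤ t ∧ t ≤ I.rendez j
    · simp [hits, h]
    · simp [hits, h]; omega

open Classical in
theorem val_hitsOpt (t : Option ℝ) (b : List (Fin I.n)) :
    (I.hitsOpt t b).val = decide (I.Hit t b) := by
  cases t <;> simp [hitsOpt, Hit, val_hits]

theorem time_hitsOpt_le (t : Option ℝ) (b : List (Fin I.n)) :
    (I.hitsOpt t b).time ≤ b.length + 2 := by
  cases t with
  | none => simp [hitsOpt]
  | some t =>
    have := I.time_hits_le t b
    simp [hitsOpt]; omega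

open Classical in
theorem val_splitBlocks (t : Option ℝ) (bs : List (List (Fin I.n))) :
    (I.splitBlocks t bs).val = (bs.filter (I.Hit t ·), bs.filter (¬ I.Hit t ·)) := by
  induction bs with
  | nil => rfl
  | cons b bs ih =>
    by_cases h : I.Hit t b <;> simp [splitBlocks, val_hitsOpt, h, ih]

theorem time_splitBlocks_le (t : Option ℝ) (bs : List (List (Fin I.n))) :
    (I.splitBlocks t bs).time ≤ bs.flatten.length + 3 * bs.length + 1 := by
  classical
  induction bs with
  | nil => simp [splitBlocks]
  | cons b bs ih =>
    have := I.time_hitsOpt_le t b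
    by_cases h : I.Hit t b <;> simp [splitBlocks, val_hitsOpt, h] at ih ⊢ <;> omega

theorem val_deal (bs : List (List (Fin I.n))) (ds : List ℕ) :
    (I.deal bs ds).val = (ds.zip bs, ds.drop bs.length) := by
  induction bs generalizing ds with
  | nil => simp [deal]
  | cons b bs ih =>
    cases ds with
    | nil => simp [deal]
    | cons d ds => simp [deal, ih]

theorem time_deal_le (bs : List (List (Fin I.n))) (ds : List ℕ) :
    (I.deal bs ds).time ≤ bs.length + 1 := by
  induction bs generalizing ds with
  | nil => simp [deal]
  | cons b bs ih =>
    cases ds with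
    | nil => simp [deal]
    | cons d ds =>
      have := ih ds
      simp [deal]; omega

open Classical in
theorem val_splitDrones (t : Option ℝ) (ps : List (ℕ × List (Fin I.n))) :
    (I.splitDrones t ps).val = ((ps.filter (I.Hit t ·.2)).map Prod.fst,
      (ps.filter (¬ I.Hit t ·.2)).map Prod.fst) := by
  induction ps with
  | nil => rfl
  | cons p ps ih =>
    by_cases h : I.Hit t p.2 <;> simp [splitDrones, val_hitsOpt, h, ih]

theorem time_splitDrones_le (t : Option ℝ) (ps : List (ℕ × List (Fin I.n))) :
    (I.splitDrones t ps).time ≤ (ps.map Prod.snd).flatten.length + 3 * ps.length + 1 := by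
  classical
  induction ps with
  | nil => simp [splitDrones]
  | cons p ps ih =>
    have := I.time_hitsOpt_le t p.2
    by_cases h : I.Hit t p.2 <;> simp [splitDrones, val_hitsOpt, h] at ih ⊢ <;> omega

open Classical in
/-- The blocks that contain the given time. -/
def hitting (t : Option ℝ) (bs : List (List (Fin I.n))) : List (List (Fin I.n)) :=
  bs.filter (I.Hit t ·)

open Classical in
/-- The blocks that do not contain the given time. -/
def missing (t : Option ℝ) (bs : List (List (Fin I.n))) : List (List (Fin I.n)) :=
  bs.filter (¬ I.Hit t ·)

open Classical in
/-- The drones of the blocks that contain the given time. -/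
def hittingDrones (t : Option ℝ) (ps : List (ℕ × List (Fin I.n))) : List ℕ :=
  (ps.filter (I.Hit t ·.2)).map Prod.fst

open Classical in
/-- The drones of the blocks that do not contain the given time. -/
def missingDrones (t : Option ℝ) (ps : List (ℕ × List (Fin I.n))) : List ℕ :=
  (ps.filter (¬ I.Hit t ·.2)).map Prod.fst

/-- The drones for the blocks other than the first ones. -/
def pool (t : Option ℝ) (bs : List (List (Fin I.n))) (served idle : List ℕ) : List ℕ :=
  served ++ idle.drop (I.hitting t bs).length

/-- The blocks with their drones. -/
def pairs (t : Option ℝ) (bs : List (List (Fin I.n))) (served idle : List ℕ) :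
    List (ℕ × List (Fin I.n)) :=
  idle.zip (I.hitting t bs) ++ (I.pool t bs served idle).zip (I.missing t bs)

/-- The drones that are neither used nor last drones of the preceding segment. -/
def leftover (t : Option ℝ) (bs : List (List (Fin I.n))) (served idle : List ℕ) : List ℕ :=
  (I.pool t bs served idle).drop (I.missing t bs).length

theorem assignAll_cons_nil (prev : Option (Fin I.r)) (bs : List (List (Fin I.n)))
    (bss : List (List (List (Fin I.n)))) (last served idle : List ℕ) :
    (I.assignAll prev [] (bs :: bss) last served idle).val =
      ([I.pairs (prev.map I.dep) bs served idle], []) := by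
  simp only [assignAll, Timed.val_bind, val_splitBlocks, val_deal, val_appendT, Timed.val_pure]
  rfl

theorem assignAll_cons_cons (prev : Option (Fin I.r)) (k : Fin I.r) (ks : List (Fin I.r))
    (bs : List (List (Fin I.n))) (bss : List (List (List (Fin I.n)))) (last served idle : List ℕ) :
    (I.assignAll prev (k :: ks) (bs :: bss) last served idle).val =
      (I.pairs (prev.map I.dep) bs served idle ::
        (I.assignAll (some k) ks bss
          (I.hittingDrones (some (I.arr k)) (I.pairs (prev.map I.dep) bs served idle))
          (last ++ I.missingDrones (some (I.arr k)) (I.pairs (prev.map I.dep) bs served idle))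
          (I.leftover (prev.map I.dep) bs served idle)).val.1,
      (last ++ I.missingDrones (some (I.arr k)) (I.pairs (prev.map I.dep) bs served idle)) ::
        (I.assignAll (some k) ks bss
          (I.hittingDrones (some (I.arr k)) (I.pairs (prev.map I.dep) bs served idle))
          (last ++ I.missingDrones (some (I.arr k)) (I.pairs (prev.map I.dep) bs served idle))
          (I.leftover (prev.map I.dep) bs served idle)).val.2) := by
  simp only [assignAll, Timed.val_bind, val_splitBlocks, val_deal, val_appendT, Timed.val_pure,
    val_splitDrones]
  rfl

theorem length_hitting_add_length_missing (t : Option ℝ) (bs : List (List (Fin I.n))) :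
    (I.hitting t bs).length + (I.missing t bs).length = bs.length := by
  classical
  have := (List.filter_append_perm (fun b => decide (I.Hit t b)) bs).length_eq
  simp only [← decide_not, List.length_append] at this
  exact this

theorem hitting_append_missing_perm (t : Option ℝ) (bs : List (List (Fin I.n))) :
    (I.hitting t bs ++ I.missing t bs).Perm bs := by
  classical
  have := List.filter_append_perm (fun b => decide (I.Hit t b)) bs
  simp only [← decide_not] at this
  exact this

theorem hittingDrones_append_missingDrones_perm (t : Option ℝ) (ps : List (ℕ × List (Fin I.n))) :
    (I.hittingDrones t ps ++ I.missingDrones t ps).Perm (ps.map Prod.fst) := by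
  classical
  have := (List.filter_append_perm (fun p => decide (I.Hit t p.2)) ps).map Prod.fst
  simp only [← decide_not, List.map_append] at this
  exact this

theorem map_snd_zip_sublist {α β : Type} (as : List α) (bs : List β) :
    ((as.zip bs).map Prod.snd).Sublist bs := by
  induction as generalizing bs with
  | nil => simp
  | cons a as ih =>
    cases bs with
    | nil => simp
    | cons b bs => simpa using ih bs

/-- `zip` can only drop blocks, so this needs no assumption on the supply of drones. The time bound
therefore holds independently of correctness. -/
theorem map_snd_pairs_subperm (t : Option ℝ) (bs : List (List (Fin I.n))) (served idle : List ℕ) :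
    List.Subperm ((I.pairs t bs served idle).map Prod.snd) bs := by
  refine List.Subperm.trans ?_ (I.hitting_append_missing_perm t bs).subperm
  rw [pairs, List.map_append]
  exact ((map_snd_zip_sublist _ _).append (map_snd_zip_sublist _ _)).subperm

/-- The potential is `served.length + 2 * last.length`. It pays for copying both lists and leaves
one unit per member of `last`, who moves to `served`; the other members of the new lists are drones
just used and are charged to blocks. The idle list is only consumed at its head, so its length does
not appear. -/
theorem time_assignAll_le (prev : Option (Fin I.r)) (ks : List (Fin I.r))
    (bss : List (List (List (Fin I.n)))) (last served idle : List ℕ) :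
    (I.assignAll prev ks bss last served idle).time ≤ served.length + 2 * last.length +
      2 * bss.flatten.flatten.length + 11 * bss.flatten.length + 8 * bss.length + 1 := by
  induction bss generalizing prev ks last served idle with
  | nil => simp [assignAll]
  | cons bs bss ih =>
    set ps := I.pairs (prev.map I.dep) bs served idle with hps
    have t₁ := I.time_splitBlocks_le (prev.map I.dep) bs
    have t₂ := I.time_deal_le (I.hitting (prev.map I.dep) bs) idle
    have t₃ := I.time_deal_le (I.missing (prev.map I.dep) bs)
      (I.pool (prev.map I.dep) bs served idle)
    have l₁ := I.length_hitting_add_length_missing (prev.map I.dep) bs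
    have hsub := I.map_snd_pairs_subperm (prev.map I.dep) bs served idle
    have l₂ := hsub.length_le
    rw [List.length_map, ← hps] at l₂
    have l₃ : (ps.map Prod.snd).flatten.length ≤ bs.flatten.length := by
      obtain ⟨l, hl, hl'⟩ := hsub
      rw [← hl.flatten.length_eq]
      exact hl'.flatten.length_le
    have l₄ : (idle.zip (I.hitting (prev.map I.dep) bs)).length ≤ bs.length := by
      rw [List.length_zip]; omega
    simp only [List.flatten_cons, List.flatten_append, List.length_append, List.length_cons]
    cases ks with
    | nil =>
      have e : (I.assignAll prev [] (bs :: bss) last served idle).time =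
          1 + ((I.splitBlocks (prev.map I.dep) bs).time +
          ((I.deal (I.hitting (prev.map I.dep) bs) idle).time + (served.length + 1 +
          ((I.deal (I.missing (prev.map I.dep) bs) (I.pool (prev.map I.dep) bs served idle)).time +
          ((idle.zip (I.hitting (prev.map I.dep) bs)).length + 1))))) := by
        simp only [assignAll, Timed.time_bind, val_splitBlocks, val_deal,
          val_appendT, time_appendT, Timed.time_pure, Timed.time_tick]
        rfl
      rw [e]
      omega
    | cons k ks =>
      have t₄ := I.time_splitDrones_le (some (I.arr k)) ps
      have l₅ := (I.hittingDrones_append_missingDrones_perm (some (I.arr k)) ps).length_eq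
      rw [List.length_append, List.length_map] at l₅
      have ih := ih (some k) ks (I.hittingDrones (some (I.arr k)) ps)
        (last ++ I.missingDrones (some (I.arr k)) ps) (I.leftover (prev.map I.dep) bs served idle)
      have e : (I.assignAll prev (k :: ks) (bs :: bss) last served idle).time =
          1 + ((I.splitBlocks (prev.map I.dep) bs).time +
          ((I.deal (I.hitting (prev.map I.dep) bs) idle).time + (served.length + 1 +
          ((I.deal (I.missing (prev.map I.dep) bs) (I.pool (prev.map I.dep) bs served idle)).time +
          ((idle.zip (I.hitting (prev.map I.dep) bs)).length + 1 +
          ((I.splitDrones (some (I.arr k)) ps).time + (last.length + 1 +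
          (I.assignAll (some k) ks bss (I.hittingDrones (some (I.arr k)) ps)
            (last ++ I.missingDrones (some (I.arr k)) ps)
            (I.leftover (prev.map I.dep) bs served idle)).time))))))) := by
        simp only [assignAll, Timed.time_bind, val_splitBlocks, val_deal,
          val_appendT, time_appendT, Timed.time_pure, Timed.time_tick, val_splitDrones]
        rfl
      rw [e]
      rw [List.length_append] at ih
      omega

end Instance

namespace Instance

variable (I : Instance)

/-! ### The supply of drones -/

theorem map_fst_zip_eq_take {α β : Type} (as : List α) (bs : List β) :
    (as.zip bs).map Prod.fst = as.take bs.length := by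
  induction as generalizing bs with
  | nil => simp
  | cons a as ih =>
    cases bs with
    | nil => simp
    | cons b bs => simpa using ih bs

theorem map_fst_pairs_append_leftover_perm (t : Option ℝ) (bs : List (List (Fin I.n)))
    (served idle : List ℕ) : ((I.pairs t bs served idle).map Prod.fst ++
      I.leftover t bs served idle).Perm (served ++ idle) := by
  rw [pairs, List.map_append, map_fst_zip_eq_take, map_fst_zip_eq_take, leftover,
    List.append_assoc, List.take_append_drop, pool]
  refine (List.perm_append_comm_assoc _ _ _).trans ?_
  rw [List.take_append_drop]

theorem map_snd_pairs_perm {t : Option ℝ} {bs : List (List (Fin I.n))} {served idle : List ℕ}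
    (h₁ : (I.hitting t bs).length ≤ idle.length)
    (h₂ : bs.length ≤ served.length + idle.length) :
    ((I.pairs t bs served idle).map Prod.snd).Perm bs := by
  have hlen := I.length_hitting_add_length_missing t bs
  rw [pairs, List.map_append, List.map_snd_zip h₁, List.map_snd_zip]
  · exact I.hitting_append_missing_perm t bs
  · rw [pool, List.length_append, List.length_drop]
    omega

/-- One interval chosen from each block contains the given time, so the chosen ones pairwise
conflict. They are distinct because the blocks are disjoint. -/
theorem length_le_omega_of_hit {t : Option ℝ} {bs : List (List (Fin I.n))}
    (hnd : bs.flatten.Nodup) (h : ∀ b ∈ bs, I.Hit t b) : bs.length ≤ I.omega := by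
  cases t with
  | none =>
    cases bs with
    | nil => simp
    | cons b bs =>
      obtain ⟨u, hu, -⟩ := h b (by simp)
      cases hu
  | some u =>
    have hex : ∀ b ∈ bs, ∃ j, j ∈ b ∧ I.launch j ≤ u ∧ u ≤ I.rendez j := by
      intro b hb
      obtain ⟨u', hu', j, hj, h'⟩ := h b hb
      cases hu'
      exact ⟨j, hj, h'⟩
    have hd := (List.nodup_flatten.1 hnd).2
    clear hnd h
    have : ∃ K : List (Fin I.n), K.length = bs.length ∧ K.Pairwise I.conflictGraph.Adj ∧
        ∀ j ∈ K, (I.launch j ≤ u ∧ u ≤ I.rendez j) ∧ ∃ b ∈ bs, j ∈ b := by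
      induction bs with
      | nil => exact ⟨[], by simp⟩
      | cons b bs ih =>
        rw [List.pairwise_cons] at hd
        obtain ⟨K, k₁, k₂, k₃⟩ := ih (fun b hb => hex b (by simp [hb])) hd.2
        obtain ⟨j, hj, hju⟩ := hex b (by simp)
        refine ⟨j :: K, by simp [k₁], List.pairwise_cons.2 ⟨fun i hi => ?_, k₂⟩, fun i hi => ?_⟩
        · obtain ⟨hiu, b', hb', hib'⟩ := k₃ i hi
          refine I.conflictGraph_adj.2 ⟨?_, hju.1.trans hiu.2, hiu.1.trans hju.2⟩
          rintro rfl
          exact hd.1 b' hb' hj hib'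
        · rcases List.mem_cons.1 hi with rfl | hi
          · exact ⟨hju, b, by simp, hj⟩
          · obtain ⟨hiu, b', hb', hib'⟩ := k₃ i hi
            exact ⟨hiu, b', by simp [hb'], hib'⟩
    obtain ⟨K, k₁, k₂, -⟩ := this
    rw [← k₁, ← I.omegaOn_univ]
    exact I.length_le_omegaOn (fun _ _ => Finset.mem_univ _) k₂

theorem length_hitting_le {t : Option ℝ} {bs : List (List (Fin I.n))}
    (hnd : bs.flatten.Nodup) : (I.hitting t bs).length ≤ I.omega := by
  classical
  unfold hitting
  refine I.length_le_omega_of_hit (t := t) (hnd.sublist List.filter_sublist.flatten) ?_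
  intro b hb
  simpa using (List.mem_filter.1 hb).2

theorem length_hittingDrones_le {t : Option ℝ} {ps : List (ℕ × List (Fin I.n))}
    (hnd : (ps.map Prod.snd).flatten.Nodup) : (I.hittingDrones t ps).length ≤ I.omega := by
  classical
  have := I.length_le_omega_of_hit (t := t) (bs := (ps.filter (I.Hit t ·.2)).map Prod.snd)
    (hnd.sublist (List.filter_sublist.map _).flatten) (by
      intro b hb
      obtain ⟨p, hp, rfl⟩ := List.mem_map.1 hb
      simpa using (List.mem_filter.1 hp).2)
  simpa [hittingDrones] using this

theorem mem_hittingDrones {t : Option ℝ} {ps : List (ℕ × List (Fin I.n))} {i : ℕ} :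
    i ∈ I.hittingDrones t ps ↔ ∃ p ∈ ps, p.1 = i ∧ I.Hit t p.2 := by
  classical
  simp only [hittingDrones, List.mem_map, List.mem_filter, decide_eq_true_eq]
  constructor
  · rintro ⟨p, ⟨h₁, h₂⟩, h₃⟩
    exact ⟨p, h₁, h₃, h₂⟩
  · rintro ⟨p, h₁, h₃, h₂⟩
    exact ⟨p, ⟨h₁, h₂⟩, h₃⟩

/-- The departure time from the station before segment `l`. -/
def depBefore : ℕ → Option ℝ
  | 0 => none
  | l + 1 => if h : l < I.r then some (I.dep ⟨l, h⟩) else none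

/-- The arrival time at the station after segment `l`. -/
def arrAfter (l : ℕ) : Option ℝ := if h : l < I.r then some (I.arr ⟨l, h⟩) else none

theorem isFirst_iff {l : ℕ} {b : List (Fin I.n)} : I.IsFirst l b ↔ I.Hit (I.depBefore l) b := by
  cases l with
  | zero => simp [IsFirst, Hit, depBefore]
  | succ l =>
    by_cases h : l < I.r
    · simp only [IsFirst, Hit, depBefore, dif_pos h, Option.some.injEq, exists_eq_left']
      constructor
      · rintro ⟨k, hk, hj⟩
        obtain rfl : k = ⟨l, h⟩ := Fin.ext (by simpa using hk)
        exact hj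
      · intro hj
        exact ⟨⟨l, h⟩, rfl, hj⟩
    · simp only [IsFirst, Hit, depBefore, dif_neg h, reduceCtorEq, false_and, exists_false,
        iff_false]
      rintro ⟨k, hk, -⟩
      omega

theorem isLast_iff {l : ℕ} {b : List (Fin I.n)} : I.IsLast l b ↔ I.Hit (I.arrAfter l) b := by
  by_cases h : l < I.r
  · simp only [IsLast, Hit, arrAfter, dif_pos h, Option.some.injEq, exists_eq_left']
    constructor
    · rintro ⟨k, hk, hj⟩
      obtain rfl : k = ⟨l, h⟩ := Fin.ext hk
      exact hj
    · intro hj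
      exact ⟨⟨l, h⟩, rfl, hj⟩
  · simp only [IsLast, Hit, arrAfter, dif_neg h, reduceCtorEq, false_and, exists_false,
      iff_false]
    rintro ⟨k, hk, -⟩
    omega

/-! ### Evolution of the three lists of drones -/

variable (blocks : ℕ → List (List (Fin I.n))) (D : ℕ)

/-- The lists `last`, `served`, `idle` of the implementation before segment `l`. -/
def droneLists : ℕ → List ℕ × List ℕ × List ℕ
  | 0 => ([], [], List.range D)
  | l + 1 =>
    let s := droneLists l
    let ps := I.pairs (I.depBefore l) (blocks l) s.2.1 s.2.2
    (I.hittingDrones (I.arrAfter l) ps, s.1 ++ I.missingDrones (I.arrAfter l) ps,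
      I.leftover (I.depBefore l) (blocks l) s.2.1 s.2.2)

/-- The blocks of segment `l` with their drones, as assigned by the implementation. -/
def pairsAt (l : ℕ) : List (ℕ × List (Fin I.n)) :=
  I.pairs (I.depBefore l) (blocks l) (I.droneLists blocks D l).2.1 (I.droneLists blocks D l).2.2

theorem droneLists_succ (l : ℕ) : I.droneLists blocks D (l + 1) =
    (I.hittingDrones (I.arrAfter l) (I.pairsAt blocks D l),
      (I.droneLists blocks D l).1 ++ I.missingDrones (I.arrAfter l) (I.pairsAt blocks D l),
      I.leftover (I.depBefore l) (blocks l) (I.droneLists blocks D l).2.1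
        (I.droneLists blocks D l).2.2) := rfl

/-- This replaces the recursion by a sequence indexed by segments. There is one station fewer than
segments, whence the shorter list of services. -/
theorem val_assignAll {l : ℕ} (hl : l ≤ I.r) {bss : List (List (List (Fin I.n)))}
    (hlen : l + bss.length = I.r + 1) (hb : ∀ i, blocks (l + i) = bss.getD i [])
    {prev : Option (Fin I.r)} (hp : prev.map I.dep = I.depBefore l) :
    (I.assignAll prev ((List.finRange I.r).drop l) bss (I.droneLists blocks D l).1
      (I.droneLists blocks D l).2.1 (I.droneLists blocks D l).2.2).val =
      ((List.range' l bss.length).map (I.pairsAt blocks D),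
        (List.range' l (bss.length - 1)).map fun l => (I.droneLists blocks D (l + 1)).2.1) := by
  induction bss generalizing l prev with
  | nil => simp at hlen; omega
  | cons bs bss ih =>
    have hbs : blocks l = bs := by simpa using hb 0
    rw [List.length_cons] at hlen
    rcases hl.eq_or_lt with rfl | hlr
    · obtain rfl : bss = [] := List.length_eq_zero_iff.1 (by omega)
      rw [List.drop_eq_nil_of_le (by simp), assignAll_cons_nil, hp]
      simp [pairsAt, hbs]
    · have hd : (List.finRange I.r).drop l = ⟨l, hlr⟩ :: (List.finRange I.r).drop (l + 1) := by
        rw [List.drop_eq_getElem_cons (by simpa using hlr)]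
        simp
      have hpa : I.pairs (I.depBefore l) bs (I.droneLists blocks D l).2.1
          (I.droneLists blocks D l).2.2 = I.pairsAt blocks D l := by rw [pairsAt, hbs]
      have harr : some (I.arr ⟨l, hlr⟩) = I.arrAfter l := by rw [arrAfter, dif_pos hlr]
      have ih := ih (l := l + 1) hlr (by omega)
        (fun i => by
          have := hb (i + 1)
          rw [List.getD_cons_succ] at this
          rw [← this]
          congr 1
          omega) (prev := some ⟨l, hlr⟩) (by simp [depBefore, hlr])
      rw [droneLists_succ] at ih
      dsimp only at ih
      rw [hbs] at ih
      obtain ⟨m, hm⟩ : ∃ m, bss.length = m + 1 := ⟨bss.length - 1, by omega⟩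
      rw [hd, assignAll_cons_cons, hp, hpa, harr, ih, List.length_cons, List.range'_succ,
        List.map_cons, hm, Nat.add_sub_cancel, Nat.add_sub_cancel, List.range'_succ, List.map_cons,
        List.range'_succ, List.map_cons, droneLists_succ]

/-- No drone is lost or duplicated from one segment to the next. The disjointness of the three
lists, on which all assignment rules rest, follows from this. -/
theorem droneLists_perm (l : ℕ) : ((I.droneLists blocks D l).1 ++ ((I.droneLists blocks D l).2.1 ++
    (I.droneLists blocks D l).2.2)).Perm (List.range D) := by
  induction l with
  | zero => exact List.Perm.refl _
  | succ l ih =>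
    refine List.Perm.trans ?_ ih
    rw [droneLists_succ]
    dsimp only
    rw [List.append_assoc]
    refine (List.perm_append_comm_assoc _ _ _).trans ?_
    refine List.Perm.append_left _ ?_
    rw [← List.append_assoc]
    exact ((I.hittingDrones_append_missingDrones_perm _ _).append_right _).trans
      (I.map_fst_pairs_append_leftover_perm _ _ _ _)

variable {blocks D}

/-- The hypotheses under which the distribution of the blocks succeeds. -/
structure Packing (blocks : ℕ → List (List (Fin I.n))) (m D : ℕ) : Prop where
  run : ∀ l ≤ I.r, I.NSRun (I.segment l) (blocks l)
  length_le : ∀ l ≤ I.r, (blocks l).length ≤ m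
  drones_eq : D = m + 2 * I.omega

namespace Packing

variable {I} {m : ℕ}

theorem flatten_nodup (h : I.Packing blocks m D) {l : ℕ} (hl : l ≤ I.r) :
    (blocks l).flatten.Nodup := by
  rw [← Multiset.coe_nodup, ← I.contents_coe, (h.run l hl).contents_eq]
  exact (I.segment l).nodup

theorem snd_flatten_nodup (h : I.Packing blocks m D) {l : ℕ} (hl : l ≤ I.r) :
    ((I.pairsAt blocks D l).map Prod.snd).flatten.Nodup := by
  obtain ⟨bs, h₁, h₂⟩ := I.map_snd_pairs_subperm (I.depBefore l) (blocks l)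
    (I.droneLists blocks D l).2.1 (I.droneLists blocks D l).2.2
  exact h₁.flatten.nodup_iff.1 ((h.flatten_nodup hl).sublist h₂.flatten)

theorem length_last_le (h : I.Packing blocks m D) {l : ℕ} (hl : l ≤ I.r + 1) :
    (I.droneLists blocks D l).1.length ≤ I.omega := by
  cases l with
  | zero => simp [droneLists]
  | succ l =>
    rw [droneLists_succ]
    exact I.length_hittingDrones_le (h.snd_flatten_nodup (by omega))

/-- After a segment these two lists consist of the drones just used, at most `m`, and the previous
last drones, at most `omega`. -/
theorem length_last_add_served_le (h : I.Packing blocks m D) {l : ℕ} (hl : l ≤ I.r + 1) :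
    (I.droneLists blocks D l).1.length + (I.droneLists blocks D l).2.1.length ≤ I.omega + m := by
  cases l with
  | zero => simp [droneLists]
  | succ l =>
    have h₁ := (I.hittingDrones_append_missingDrones_perm (I.arrAfter l)
      (I.pairsAt blocks D l)).length_eq
    have h₂ := h.length_last_le (l := l) (by omega)
    have h₃ := (I.map_snd_pairs_subperm (I.depBefore l) (blocks l)
      (I.droneLists blocks D l).2.1 (I.droneLists blocks D l).2.2).length_le
    have h₄ := h.length_le l (by omega)
    rw [droneLists_succ]
    simp only [List.length_append, List.length_map] at *
    change (I.pairsAt blocks D l).length ≤ _ at h₃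
    omega

/-- This is where `m + 2 * omega` drones are needed. At least `omega` are idle, enough for the first
blocks, and at most `omega` are blocked as last drones, which leaves enough for all blocks. So
neither `zip` truncates. -/
theorem snd_perm (h : I.Packing blocks m D) {l : ℕ} (hl : l ≤ I.r) :
    ((I.pairsAt blocks D l).map Prod.snd).Perm (blocks l) := by
  have h₁ := (I.droneLists_perm blocks D l).length_eq
  have h₂ := h.length_last_le (l := l) (by omega)
  have h₃ := h.length_last_add_served_le (l := l) (by omega)
  have h₄ := I.length_hitting_le (t := I.depBefore l) (h.flatten_nodup hl)
  have h₅ := h.drones_eq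
  have h₆ := h.length_le l hl
  simp only [List.length_append, List.length_range] at h₁
  exact I.map_snd_pairs_perm (by omega) (by omega)

end Packing

end Instance

namespace Instance

variable {I : Instance} {blocks : ℕ → List (List (Fin I.n))} {m D : ℕ}

/-! ### The implementation carries out the algorithm -/

variable (I blocks D) in
/-- The result of the implementation, given the blocks. -/
def outcomeOf : I.Outcome where
  drones := D
  assigned := (List.range' 0 (I.r + 1)).map (I.pairsAt blocks D)
  serviced := (List.range' 0 I.r).map fun l => (I.droneLists blocks D (l + 1)).2.1

theorem assignedAt_outcomeOf {l : ℕ} (hl : l ≤ I.r) :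
    (I.outcomeOf blocks D).assignedAt l = I.pairsAt blocks D l := by
  have h : l < ((List.range' 0 (I.r + 1)).map (I.pairsAt blocks D)).length := by simp; omega
  simp only [Outcome.assignedAt, outcomeOf]
  rw [List.getD_eq_getElem _ _ h]
  simp

theorem assignedAt_outcomeOf_of_lt {l : ℕ} (hl : I.r < l) :
    (I.outcomeOf blocks D).assignedAt l = [] := by
  simp only [Outcome.assignedAt, outcomeOf]
  rw [List.getD_eq_default]
  simp; omega

theorem servicedAt_outcomeOf {l : ℕ} (hl : l < I.r) :
    (I.outcomeOf blocks D).servicedAt l = (I.droneLists blocks D (l + 1)).2.1 := by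
  have h : l < ((List.range' 0 I.r).map
    fun l => (I.droneLists blocks D (l + 1)).2.1).length := by simpa using hl
  simp only [Outcome.servicedAt, outcomeOf]
  rw [List.getD_eq_getElem _ _ h]
  simp

theorem mem_lastDrones_outcomeOf {l : ℕ} (hl : l ≤ I.r) {i : ℕ} :
    i ∈ (I.outcomeOf blocks D).lastDrones l ↔ i ∈ (I.droneLists blocks D (l + 1)).1 := by
  rw [droneLists_succ, mem_hittingDrones, ← assignedAt_outcomeOf hl]
  simp only [Outcome.lastDrones, Set.mem_ofPred_eq, isLast_iff]

theorem mem_busy_outcomeOf {l : ℕ} (hl : l ≤ I.r) {i : ℕ} :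
    i ∈ (I.outcomeOf blocks D).busy l ↔ i ∈ (I.pairsAt blocks D l).map Prod.fst := by
  simp only [Outcome.busy, Set.mem_ofPred_eq, assignedAt_outcomeOf hl, List.mem_map]

theorem droneLists_nodup (l : ℕ) : ((I.droneLists blocks D l).1 ++ ((I.droneLists blocks D l).2.1 ++
    (I.droneLists blocks D l).2.2)).Nodup :=
  (I.droneLists_perm blocks D l).nodup_iff.2 List.nodup_range

theorem lt_of_mem_fst_pairsAt {l i : ℕ} (hi : i ∈ (I.pairsAt blocks D l).map Prod.fst) :
    i ∈ (I.droneLists blocks D l).2.1 ++ (I.droneLists blocks D l).2.2 :=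
  (I.map_fst_pairs_append_leftover_perm _ _ _ _).mem_iff.1 (List.mem_append_left _ hi)

theorem mem_fst_pairsAt_iff {l i : ℕ} : i ∈ (I.pairsAt blocks D l).map Prod.fst ↔
    i ∈ (I.droneLists blocks D (l + 1)).1 ∨
      i ∈ I.missingDrones (I.arrAfter l) (I.pairsAt blocks D l) := by
  rw [← (I.hittingDrones_append_missingDrones_perm (I.arrAfter l) _).mem_iff, List.mem_append,
    droneLists_succ]

theorem mem_served_succ {l i : ℕ} : i ∈ (I.droneLists blocks D (l + 1)).2.1 ↔
    i ∈ (I.droneLists blocks D l).1 ∨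
      i ∈ I.missingDrones (I.arrAfter l) (I.pairsAt blocks D l) := by
  rw [droneLists_succ, List.mem_append]

theorem disjoint_last_served {l i : ℕ} (h₁ : i ∈ (I.droneLists blocks D l).1) :
    i ∉ (I.droneLists blocks D l).2.1 ∧ i ∉ (I.droneLists blocks D l).2.2 := by
  have h := (List.nodup_append'.1 (droneLists_nodup (I := I) (blocks := blocks) (D := D) l)).2.2 h₁
  rw [List.mem_append] at h
  exact not_or.1 h

theorem disjoint_served_idle {l i : ℕ} (h₁ : i ∈ (I.droneLists blocks D l).2.1) :
    i ∉ (I.droneLists blocks D l).2.2 :=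
  (List.nodup_append'.1 (List.nodup_append'.1
    (droneLists_nodup (I := I) (blocks := blocks) (D := D) l)).2.1).2.2 h₁

theorem nodup_fst_pairsAt (l : ℕ) : ((I.pairsAt blocks D l).map Prod.fst).Nodup := by
  have h := (List.nodup_append'.1
    (droneLists_nodup (I := I) (blocks := blocks) (D := D) l)).2.1
  rw [← (I.map_fst_pairs_append_leftover_perm (I.depBefore l) (blocks l) _ _).nodup_iff] at h
  exact (List.nodup_append'.1 h).1

theorem mem_pairsAt {l : ℕ} {p : ℕ × List (Fin I.n)} (hp : p ∈ I.pairsAt blocks D l) :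
    (I.Hit (I.depBefore l) p.2 ∧ p.1 ∈ (I.droneLists blocks D l).2.2) ∨
      (¬ I.Hit (I.depBefore l) p.2) := by
  classical
  rcases List.mem_append.1 hp with h | h
  · obtain ⟨h₁, h₂⟩ := List.of_mem_zip (show (p.1, p.2) ∈ _ from h)
    exact Or.inl ⟨by simpa using (List.mem_filter.1 h₂).2, h₁⟩
  · obtain ⟨h₁, h₂⟩ := List.of_mem_zip (show (p.1, p.2) ∈ _ from h)
    exact Or.inr (by simpa using (List.mem_filter.1 h₂).2)

theorem lt_of_mem_droneLists {l i : ℕ} (hi : i ∈ (I.droneLists blocks D l).1 ∨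
    i ∈ (I.droneLists blocks D l).2.1 ∨ i ∈ (I.droneLists blocks D l).2.2) : i < D := by
  rw [← List.mem_range, ← (I.droneLists_perm blocks D l).mem_iff, List.mem_append, List.mem_append]
  exact hi

/-- Blocks are nonempty and costs positive, so a drone has used energy exactly when it has worked.
This lets the implementation ignore battery levels. -/
theorem Packing.spent_pos_iff (h : I.Packing blocks m D) {l : ℕ} (hl : l ≤ I.r) (i : ℕ) :
    0 < (I.outcomeOf blocks D).spent i l ↔ i ∈ (I.outcomeOf blocks D).busy l := by
  rw [Outcome.spent_eq_load]
  constructor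
  · intro hp
    by_contra hb
    have : (I.outcomeOf blocks D).work i l = [] := by
      rw [List.eq_nil_iff_forall_not_mem]
      intro j hj
      obtain ⟨p, h₁, h₂, -⟩ := (Outcome.mem_work _).1 hj
      exact hb ⟨p, h₁, h₂⟩
    rw [this] at hp
    simp at hp
  · rintro ⟨p, hp, rfl⟩
    apply I.load_pos
    have hp' := hp
    rw [assignedAt_outcomeOf hl] at hp'
    have hb : p.2 ∈ blocks l := (h.snd_perm hl).mem_iff.1 (List.mem_map_of_mem hp')
    obtain ⟨j, hj⟩ := List.exists_mem_of_ne_nil _ ((h.run l hl).block (Multiset.mem_coe.2 hb)).2.1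
    exact List.ne_nil_of_mem ((Outcome.mem_work _).2 ⟨p, hp, rfl, hj⟩)

theorem Packing.battery_sub_spent_lt_iff (h : I.Packing blocks m D) {l : ℕ} (hl : l ≤ I.r) {i : ℕ}
    (hb : (I.outcomeOf blocks D).battery i l < I.B ↔ i ∈ (I.droneLists blocks D l).1) :
    (I.outcomeOf blocks D).battery i l - (I.outcomeOf blocks D).spent i l < I.B ↔
      i ∈ (I.droneLists blocks D l).1 ∨ i ∈ (I.pairsAt blocks D l).map Prod.fst := by
  have h₁ := (I.outcomeOf blocks D).battery_le i l
  have h₂ := Outcome.IsRun.spent_nonneg (o := I.outcomeOf blocks D) i l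
  rw [← hb, ← mem_busy_outcomeOf hl, ← h.spent_pos_iff hl]
  constructor
  · intro hlt
    by_contra hc
    push Not at hc
    linarith [hc.1, hc.2]
  · rintro (h | h) <;> linarith

/-- By induction: the drones not full after a segment's deliveries are the old last drones and those
just used. All of them are serviced except the new last drones. -/
theorem Packing.battery_lt_iff (h : I.Packing blocks m D) (i : ℕ) {l : ℕ} (hl : l ≤ I.r) :
    (I.outcomeOf blocks D).battery i l < I.B ↔ i ∈ (I.droneLists blocks D l).1 := by
  classical
  induction l with
  | zero => simp [Outcome.battery, droneLists]
  | succ l ih =>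
    have ih := h.battery_sub_spent_lt_iff (by omega) (ih (by omega))
    rw [Outcome.battery, servicedAt_outcomeOf hl]
    split_ifs with hs
    · simp only [lt_self_iff_false, false_iff]
      exact fun hlast => (disjoint_last_served hlast).1 hs
    · rw [ih, mem_fst_pairsAt_iff]
      rw [mem_served_succ, not_or] at hs
      tauto

theorem Packing.service_rule (h : I.Packing blocks m D) {l : ℕ} (hl : l < I.r) (i : ℕ) :
    i ∈ (I.outcomeOf blocks D).servicedAt l ↔ i < D ∧ i ∉ (I.outcomeOf blocks D).lastDrones l ∧
      (I.outcomeOf blocks D).battery i l - (I.outcomeOf blocks D).spent i l < I.B := by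
  rw [servicedAt_outcomeOf hl, mem_lastDrones_outcomeOf hl.le,
    h.battery_sub_spent_lt_iff hl.le (h.battery_lt_iff i hl.le)]
  constructor
  · intro hs
    refine ⟨lt_of_mem_droneLists (Or.inr (Or.inl hs)),
      fun hlast => (disjoint_last_served hlast).1 hs, ?_⟩
    rw [mem_fst_pairsAt_iff]
    rw [mem_served_succ] at hs
    tauto
  · rintro ⟨-, h₁, h₂⟩
    rw [mem_fst_pairsAt_iff] at h₂
    rw [mem_served_succ]
    tauto

/-- First blocks take drones from `idle`. The drones of the preceding segment lie in `last` or
`served`, and the last drones of the segment before it in `served`, so both exclusions are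
disjointness of lists. Other blocks avoid `last` because it is never dealt from. -/
theorem Packing.isRun (h : I.Packing blocks m D)
    (hm : (Finset.range (I.r + 1)).sup (fun l => (blocks l).length) = m) :
    (I.outcomeOf blocks D).IsRun where
  length_assigned := by simp [outcomeOf]
  length_serviced := by simp [outcomeOf]
  packed l hl := by
    rw [assignedAt_outcomeOf hl, Multiset.coe_eq_coe.2 (h.snd_perm hl)]
    exact h.run l hl
  drones_eq := by
    have : (I.outcomeOf blocks D).mMax = m := by
      rw [← hm, Outcome.mMax]
      refine Finset.sup_congr rfl fun l hl => ?_
      have hl : l ≤ I.r := by simpa [Nat.lt_succ_iff] using hl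
      rw [assignedAt_outcomeOf hl, ← (h.snd_perm hl).length_eq, List.length_map]
    rw [this]
    exact h.drones_eq
  lt_drones l i hi := by
    by_cases hl : l ≤ I.r
    · rw [mem_busy_outcomeOf hl] at hi
      exact lt_of_mem_droneLists (Or.inr (List.mem_append.1 (lt_of_mem_fst_pairsAt hi)))
    · obtain ⟨p, hp, -⟩ := hi
      rw [assignedAt_outcomeOf_of_lt (not_le.1 hl)] at hp
      simp at hp
  unique l := by
    by_cases hl : l ≤ I.r
    · rw [assignedAt_outcomeOf hl]
      exact nodup_fst_pairsAt l
    · rw [assignedAt_outcomeOf_of_lt (not_le.1 hl)]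
      simp
  first_rule l hl p hp hf := by
    rw [assignedAt_outcomeOf hl] at hp
    rw [isFirst_iff] at hf
    have hidle : p.1 ∈ (I.droneLists blocks D l).2.2 := by
      rcases mem_pairsAt hp with h' | h'
      · exact h'.2
      · exact absurd hf h'
    constructor
    · rintro l rfl hb
      rw [mem_busy_outcomeOf (by omega), mem_fst_pairsAt_iff] at hb
      rcases hb with hb | hb
      · exact (disjoint_last_served hb).2 hidle
      · exact disjoint_served_idle (mem_served_succ.2 (Or.inr hb)) hidle
    · rintro l rfl hb
      rw [mem_lastDrones_outcomeOf (by omega)] at hb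
      exact disjoint_served_idle (mem_served_succ.2 (Or.inl hb)) hidle
  other_rule l hl p hp hf := by
    rw [assignedAt_outcomeOf hl] at hp
    constructor
    · rintro l rfl hb
      rw [mem_lastDrones_outcomeOf (by omega)] at hb
      have h₁ := disjoint_last_served hb
      rcases List.mem_append.1 (lt_of_mem_fst_pairsAt (List.mem_map_of_mem hp)) with h₂ | h₂
      · exact h₁.1 h₂
      · exact h₁.2 h₂
    · rintro ⟨q, hq, hqp, hqf⟩
      rw [assignedAt_outcomeOf hl] at hq
      have := List.inj_on_of_nodup_map (nodup_fst_pairsAt l) hq hp hqp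
      exact hf (this ▸ hqf)
  service_rule l hl i := h.service_rule hl i

/-! ### The blocks computed by the implementation -/

variable (I)

/-- The deliveries in the order of their launching times. -/
def sortedDeliveries : List (Fin I.n) := (sortBy I.launch (List.ofFn id)).val

/-- The segments as lists. -/
def segmentLists : List (List (Fin I.n)) := (I.cutAll (List.finRange I.r) I.sortedDeliveries).val

/-- The blocks of segment `l` computed by the implementation. -/
def blocksAt (l : ℕ) : List (List (Fin I.n)) := (I.algoNSAll I.segmentLists).val.getD l []

theorem sortedDeliveries_perm : I.sortedDeliveries.Perm (List.finRange I.n) := by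
  have := (sortBy_spec I.launch (List.ofFn (id : Fin I.n → Fin I.n))).1
  rwa [List.ofFn_id] at this

theorem sortedDeliveries_pairwise :
    I.sortedDeliveries.Pairwise fun i j => I.launch i ≤ I.launch j :=
  (sortBy_spec I.launch _).2

theorem length_segmentLists : I.segmentLists.length = I.r + 1 := by
  rw [segmentLists, length_cutAll, List.length_finRange]

theorem flatten_segmentLists : I.segmentLists.flatten = I.sortedDeliveries :=
  I.flatten_cutAll _ _

theorem length_colour : (I.colour (List.finRange I.n)).val.length = I.omega := by
  rw [← omegaOn_univ]
  exact (I.colour_spec (List.nodup_finRange I.n)).2.2 _ (by simp)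

theorem blocksAt_run {l : ℕ} (hl : l ≤ I.r) : I.NSRun (I.segment l) (I.blocksAt l) := by
  have hlt : l < I.segmentLists.length := by rw [length_segmentLists]; omega
  have hnd : I.segmentLists.flatten.Nodup := by
    rw [flatten_segmentLists, I.sortedDeliveries_perm.nodup_iff]
    exact List.nodup_finRange _
  have e : I.blocksAt l = (I.algoNS I.segmentLists[l]).val := by
    rw [blocksAt, val_algoNSAll, List.getD_eq_getElem _ _ (by simpa using hlt)]
    simp
  rw [e]
  refine I.algoNS_spec ((List.nodup_flatten.1 hnd).1 _ (List.getElem_mem hlt)) fun j => ?_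
  rw [I.mem_cutAll_iff (fun j => I.sortedDeliveries_perm.mem_iff.2 (List.mem_finRange j))
    I.sortedDeliveries_pairwise hl]
  change j ∈ I.segmentLists.getD l [] ↔ _
  rw [List.getD_eq_getElem _ _ hlt]

/-- The largest number of blocks of a segment. -/
def maxBlocks : ℕ := (maxLengthT (I.algoNSAll I.segmentLists).val).val

theorem length_algoNSAll : (I.algoNSAll I.segmentLists).val.length = I.r + 1 := by
  rw [val_algoNSAll, List.length_map, length_segmentLists]

theorem sup_length_blocksAt :
    (Finset.range (I.r + 1)).sup (fun l => (I.blocksAt l).length) = I.maxBlocks := by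
  rw [maxBlocks, val_maxLengthT, length_algoNSAll]
  rfl

theorem packing_blocksAt : I.Packing I.blocksAt I.maxBlocks (I.maxBlocks + 2 * I.omega) where
  run _ hl := I.blocksAt_run hl
  length_le l hl := by
    rw [← sup_length_blocksAt]
    exact Finset.le_sup (f := fun l => (I.blocksAt l).length) (by simpa [Nat.lt_succ_iff] using hl)
  drones_eq := rfl

theorem val_algoSC : I.algoSC.val =
    I.outcomeOf I.blocksAt (I.maxBlocks + 2 * I.omega) := by
  have h := I.val_assignAll I.blocksAt (I.maxBlocks + 2 * I.omega) (l := 0) (Nat.zero_le _)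
    (bss := (I.algoNSAll I.segmentLists).val) (by rw [length_algoNSAll]; omega)
    (fun i => by rw [zero_add]; rfl) (prev := none) rfl
  rw [length_algoNSAll, List.drop_zero, Nat.add_sub_cancel] at h
  have e₀ : I.droneLists I.blocksAt (I.maxBlocks + 2 * I.omega) 0 =
      ([], [], List.range' 0 (I.maxBlocks + 2 * I.omega)) := by
    rw [← List.range_eq_range']
    rfl
  rw [e₀] at h
  simp only [algoSC, Timed.val_bind, Timed.val_pure, val_readT, val_lengthT, val_countFrom,
    List.ofFn_id, length_colour]
  change Outcome.mk _ (I.assignAll none (List.finRange I.r) (I.algoNSAll (I.cutAll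
    (List.finRange I.r) (sortBy I.launch (List.finRange I.n)).val).val).val [] []
    (List.range' 0 _)).val.1 (I.assignAll _ _ _ _ _ _).val.2 = _
  have e : (sortBy I.launch (List.finRange I.n)).val = I.sortedDeliveries := by
    rw [sortedDeliveries, List.ofFn_id]
  rw [e]
  change Outcome.mk (I.maxBlocks + 2 * I.omega) (I.assignAll none (List.finRange I.r)
    (I.algoNSAll I.segmentLists).val [] [] (List.range' 0 (I.maxBlocks + 2 * I.omega))).val.1
    (I.assignAll none (List.finRange I.r)
    (I.algoNSAll I.segmentLists).val [] [] (List.range' 0 (I.maxBlocks + 2 * I.omega))).val.2 = _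
  rw [h]
  rfl

theorem isRun_algoSC : I.algoSC.val.IsRun := by
  rw [val_algoSC]
  exact I.packing_blocksAt.isRun I.sup_length_blocksAt

end Instance

namespace Instance

variable (I : Instance)

/-! ### The running time -/

theorem algoNS_lengths {js : List (Fin I.n)} (hjs : js.Nodup) :
    (I.algoNS js).val.flatten.length = js.length ∧ (I.algoNS js).val.length ≤ js.length := by
  classical
  have h := I.algoNS_spec hjs (s := js.toFinset) (fun _ => List.mem_toFinset)
  have hc := h.contents_eq
  have hle := h.card_le_card
  rw [I.contents_coe] at hc
  have hcard := congrArg Multiset.card hc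
  rw [Multiset.coe_card, ← Finset.card_def, List.toFinset_card_of_nodup hjs] at hcard
  rw [Multiset.coe_card, List.toFinset_card_of_nodup hjs] at hle
  exact ⟨hcard, hle⟩

theorem algoNSAll_lengths {jss : List (List (Fin I.n))} (hjs : jss.flatten.Nodup) :
    (I.algoNSAll jss).val.flatten.flatten.length = jss.flatten.length ∧
      (I.algoNSAll jss).val.flatten.length ≤ jss.flatten.length := by
  rw [val_algoNSAll]
  induction jss with
  | nil => simp
  | cons js jss ih =>
    rw [List.flatten_cons, List.nodup_append] at hjs
    obtain ⟨h₁, h₂⟩ := ih hjs.2.1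
    obtain ⟨h₃, h₄⟩ := I.algoNS_lengths hjs.1
    simp only [List.map_cons, List.flatten_cons, List.flatten_append, List.length_append]
    omega

theorem omega_le_n : I.omega ≤ I.n := by
  obtain ⟨K, hK⟩ := I.conflictGraph.exists_isNClique_cliqueNum
  rw [omega, ← hK.card_eq]
  simpa using K.card_le_univ

theorem maxBlocks_le_n : I.maxBlocks ≤ I.n := by
  rw [← sup_length_blocksAt]
  refine Finset.sup_le fun l hl => ?_
  refine (I.blocksAt_run (by simpa [Nat.lt_succ_iff] using hl)).card_le_card.trans ?_
  simpa using (I.segment l).card_le_univ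

/-- Conflicts are paid for twice: once when the whole instance is coloured to find `omega`, and once
over all segments together. The factor `5` of `H` collects one for that colouring, one for the
second sorting and three for packing the segments. -/
theorem time_algoSC_le {H : ℕ} (hH : ∀ k, 2 ^ k ≤ (I.n + 1) ^ 2 → k ≤ H) :
    I.algoSC.time ≤ I.n * (5 * H + 56) + 2 * I.numConflicts + 20 * I.r + 40 := by
  have hlen : (List.finRange I.n).length = I.n := List.length_finRange
  have hxs : I.sortedDeliveries.length = I.n := by rw [I.sortedDeliveries_perm.length_eq, hlen]
  have hnd : I.segmentLists.flatten.Nodup := by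
    rw [flatten_segmentLists, I.sortedDeliveries_perm.nodup_iff]
    exact List.nodup_finRange _
  have hfl : I.segmentLists.flatten.length = I.n := by rw [flatten_segmentLists, hxs]
  have c₁ := I.listConflicts_le_numConflicts (List.nodup_finRange I.n)
  have c₂ := I.listConflicts_le_numConflicts hnd
  have t₁ := I.time_colour_le hH (List.nodup_finRange I.n) hlen.le
  have t₂ := time_sortBy_le I.launch hH (List.finRange I.n) hlen.le
  have t₃ := I.time_cutAll (List.finRange I.r) I.sortedDeliveries
  have t₄ := I.time_algoNSAll_le hH hnd hfl.le
  have t₅ := time_maxLengthT (I.algoNSAll I.segmentLists).val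
  have t₆ := I.time_assignAll_le none (List.finRange I.r) (I.algoNSAll I.segmentLists).val [] []
    (List.range' 0 (I.maxBlocks + 2 * I.omega))
  obtain ⟨l₁, l₂⟩ := I.algoNSAll_lengths hnd
  have l₃ := I.length_algoNSAll
  have l₄ := I.length_segmentLists
  have l₅ := I.omega_le_n
  have l₆ := I.maxBlocks_le_n
  have es : (sortBy I.launch (List.finRange I.n)).val = I.sortedDeliveries := by
    rw [sortedDeliveries, List.ofFn_id]
  have e : I.algoSC.time = (I.n + 1) + ((I.r + 1) + ((I.colour (List.finRange I.n)).time +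
      ((I.omega + 1) + ((sortBy I.launch (List.finRange I.n)).time +
      ((I.cutAll (List.finRange I.r) I.sortedDeliveries).time +
      ((I.algoNSAll I.segmentLists).time + ((maxLengthT (I.algoNSAll I.segmentLists).val).time +
      ((I.maxBlocks + 2 * I.omega + 1) + (I.assignAll none (List.finRange I.r)
        (I.algoNSAll I.segmentLists).val [] []
        (List.range' 0 (I.maxBlocks + 2 * I.omega))).time)))))))) := by
    simp only [algoSC, Timed.time_bind, Timed.time_pure, val_readT, time_readT, val_lengthT,
      time_lengthT, val_countFrom, time_countFrom, List.ofFn_id, length_colour, es]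
    rfl
  rw [e, t₅]
  rw [hlen] at t₁ t₂
  rw [List.length_finRange, hxs] at t₃
  rw [hfl] at t₄ l₁ l₂
  rw [l₃, l₁] at t₆
  rw [l₃]
  rw [l₄] at t₄
  simp only [List.length_nil] at t₆
  have e₁ : I.n * (5 * H + 56) = I.n * (H + 10) + I.n * (H + 4) + I.n * (3 * H + 22) +
    20 * I.n := by ring
  omega

/-- For `N ≥ 1`, `(N + 1) ^ 2 ≤ (2 * N) ^ 2`, and dividing by `log 2 ≥ 1 / 2` gives `H ≤ 2 + 4 * log
N`. Multiplication by `N` makes the case `N = 0` harmless. -/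
theorem log_bound (N : ℕ) : ∃ H : ℕ, (∀ k, 2 ^ k ≤ (N + 1) ^ 2 → k ≤ H) ∧
    (N : ℝ) * H ≤ 2 * N + 4 * (N * Real.log N) := by
  refine ⟨Nat.log 2 ((N + 1) ^ 2), fun k hk => Nat.le_log_of_pow_le (by norm_num) hk, ?_⟩
  rcases Nat.eq_zero_or_pos N with rfl | hN
  · simp
  have hN' : (1 : ℝ) ≤ N := by exact_mod_cast hN
  have h₁ : (Nat.log 2 ((N + 1) ^ 2) : ℝ) ≤ Real.logb 2 (((N + 1) ^ 2 : ℕ) : ℝ) := by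
    exact_mod_cast Real.natLog_le_logb ((N + 1) ^ 2) 2
  have h₂ : Real.log (((N + 1) ^ 2 : ℕ) : ℝ) ≤ 2 * (Real.log 2 + Real.log N) := by
    push_cast
    rw [Real.log_pow, ← Real.log_mul (by norm_num) (by positivity)]
    push_cast
    gcongr
    linarith
  have hlog2 : 1 / 2 ≤ Real.log 2 := by linarith [Real.log_two_gt_d9]
  have hlogN : 0 ≤ Real.log N := Real.log_nonneg hN'
  have h₃ : Real.logb 2 (((N + 1) ^ 2 : ℕ) : ℝ) ≤ 2 + 4 * Real.log N := by
    rw [Real.logb, div_le_iff₀ (by linarith)]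
    nlinarith
  have h₄ := mul_le_mul_of_nonneg_left (h₁.trans h₃) (by linarith : (0 : ℝ) ≤ N)
  linarith

/-- Linear terms are absorbed into `N * log N`, except at `N = 1`, where the logarithm vanishes.
This is one reason for the summand `1` in the final bound. -/
theorem le_two_mul_mul_log_add_one (N : ℕ) : (N : ℝ) ≤ 2 * (N * Real.log N) + 1 := by
  have hlog2 : 1 / 2 ≤ Real.log 2 := by linarith [Real.log_two_gt_d9]
  rcases Nat.lt_or_ge N 2 with h | h
  · interval_cases N <;> simp
  · have hN : (2 : ℝ) ≤ N := by exact_mod_cast h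
    have : Real.log 2 ≤ Real.log N := Real.log_le_log (by norm_num) hN
    nlinarith

/-- The constant is generous: the preceding estimates give coefficients `152`, `2`, `20` and `106`
for the four terms. -/
theorem time_algoSC_le_mul :
    (I.algoSC.time : ℝ) ≤ 200 * (I.n * Real.log I.n + I.numConflicts + I.r + 1) := by
  obtain ⟨H, h₁, h₂⟩ := log_bound I.n
  have h₃ : (I.algoSC.time : ℝ) ≤
      I.n * (5 * H + 56) + 2 * I.numConflicts + 20 * I.r + 40 := by
    exact_mod_cast I.time_algoSC_le h₁
  have h₄ := le_two_mul_mul_log_add_one I.n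
  have h₅ : (0 : ℝ) ≤ I.numConflicts := Nat.cast_nonneg _
  have h₆ : (0 : ℝ) ≤ I.r := Nat.cast_nonneg _
  linarith

end Instance

end DroneDelivery

end

theorem mainTheorem6 :
    (∃ C : ℝ, ∀ I : DroneDelivery.Instance,
      I.algoSC.val.IsRun ∧
      (I.algoSC.time : ℝ) ≤ C * (I.n * Real.log I.n + I.numConflicts + I.r + 1)) ∧
    ∀ (I : DroneDelivery.Instance) (o : I.Outcome), o.IsRun →
      I.IsSolution o.drones (fun i => o.assignment i) ∧
      o.drones = o.mMax + 2 * I.omega ∧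
      (∀ β : ℝ, I.IsFactorNS β → (o.drones : ℝ) ≤ β * I.optSC + 2 * I.omega) ∧
      I.IsFactorNS (2 + I.psi) ∧
      (o.drones : ℝ) ≤ (2 + I.psi) * I.optSC + 2 * I.omega ∧
      I.omega ≤ I.optSC ∧
      (o.drones : ℝ) ≤ (4 + I.psi) * I.optSC := by
  refine ⟨⟨200, fun I => ⟨I.isRun_algoSC, I.time_algoSC_le_mul⟩⟩, fun I o h => ?_⟩
  have hω : (I.omega : ℝ) ≤ I.optSC := by exact_mod_cast h.omega_le_optSC
  have hd := h.drones_le I.isFactorNS_psi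
  exact ⟨h.isSolution, h.drones_eq, fun β hβ => h.drones_le hβ, I.isFactorNS_psi, hd,
    h.omega_le_optSC, by linarith⟩
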